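/- **Setting.** Let $R$ be a real closed field, $C=R[i]$ its algebraic closure, $k$ a subfield of $R$, $n\ge 0$, $\boldsymbol y=(y_1,\dots,y_n)$. For $a\in R^n$ and $f\in R[\boldsymbol y,x]$ write $f(a;x)\in R[x]$ for the specialization. A basic constructible set is a set $V(\mathfrak a)\cap D(q)$, i.e. the points where all elements of the ideal $\mathfrak a$ vanish and the polynomial $q$ does not. $R^n$ carries the Euclidean topology. A semi-algebraic set is semi-algebraically connected if it is not a disjoint union of two non-empty relatively closed semi-algebraic subsets; a semi-algebraically connected component of a set $L$ is a maximal non-empty semi-algebraically connected semi-algebraic subset of $L$. **Geometric delineability.** Let $T=V(I)\cap D(h)$ be basic constructible in $\mathbb A^{n+1}$ and let $S\subseteq R^n$. The geometric fibre of $T$ over $a$ is the set of $z\in C$ with $f(a;z)=0$ for all $f\in I$ and $h(a;z)\neq0$. $T$ is geometrically delineable over $S$ if (1) the cardinality of the geometric fibre is finite and constant for $a\in S$; (2) there are semi-algebraic continuous sections $\xi_1,\dots,\xi_l:S\to T(R)$ of the projection $R^{n+1}\to R^n$, strictly ascending in the last coordinate; (3) every $t\in T(R)$ lying above $S$ equals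 $\xi_i(\pi(t))$ for a unique $i$. By convention $T$ is also called geometrically delineable over $S$ if above $S$ it coincides with $D(h')$ for some $h'\in R[\boldsymbol y,x]$ such that $V(h')$ satisfies (1)–(3) over $S$. **Algorithm $\mathtt{Proj1}(I,J,h)$.** Input: an ideal $I\subseteq k[\boldsymbol y,x]$, a prime ideal $J\subseteq I\cap k[\boldsymbol y]$ of $k[\boldsymbol y]$, and $h\in k[\boldsymbol y,x]$. 1. If $1\in I$, return $\{V(J)\}$. 2. Compute a reduced Gröbner basis $\mathcal G$ of $I$ for some block order $x>T_{\boldsymbol y}$. 3. If $I\cap k[\boldsymbol y]\ne J$: write $V(J)\setminus V(I\cap k[\boldsymbol y])$ as a finite union of basic constructible sets $L_i$, choose finitely many primes $J_i$ with $\bigcap_i J_i=\sqrt{I\cap k[\boldsymbol y]}$, and return $\{L_i\}\cup\bigcup_i\mathtt{Proj1}(J_i\,k[\boldsymbol y,x]+I,J_i,h)$. 4. If $\mathcal G\subseteq k[\boldsymbol y]$, return $\mathtt{Proj1}(I+\langle h\rangle,J,1)$. 5. Otherwise put $w=\prod_{g\in\mathcal G\setminus J}\mathrm{LC}_x(g)$,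 $s=\min_{g\in\mathcal G\setminus J}\deg_x g$, and let $H_h=(\operatorname{tr}L_{x^{i+j}h})_{0\le i,j<s}$ be the matrix of the parametric Hermite form, where $L_b$ is multiplication by $b$ on the $(k[\boldsymbol y]/J)_w$-module $(k[\boldsymbol y,x]/I)_w$. Let $\sum_{i=0}^s c_i\lambda^i$ be its characteristic polynomial. Choose finitely many primes $J_i$ with $\bigcap_i J_i=\sqrt{J+\langle w\rangle}$ and return the sets $V(J+\langle c_0,\dots,c_{i-1}\rangle)\cap D(w c_i)$, $0\le i<s$ (with the $c_j\in(k[\boldsymbol y]/J)_w$ represented by polynomial numerators, after multiplication by powers of $w$), together with $\bigcup_i\mathtt{Proj1}(J_i\,k[\boldsymbol y,x]+I,J_i,h)$. **Theorem.** For every input $(I,J,h)$ as above, and whatever choices are made in the steps: * $\mathtt{Proj1}(I,J,h)$ terminates (no call gets stuck, there is no infinite chain of recursive calls, and a finite output is returned). * For every basic constructible set $L\subseteq R^n$ in an output, $V(I)\cap D(h)$ is geometrically delineable over each semi-algebraically connected component of $L$. Moreover every $L$ is contained in $V(J)$, and over each point of $V(J)\subseteq R^n$ outside the union of the output sets the geometric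 fibre of $V(I)\cap D(h)$ is empty. * If $(I,J,h)$ reaches step 5, then for every $p\in V(J)\cap D(w)\subseteq R^n$ and $0\le r\le s$: $\operatorname{rank}H_h(p)=r$ if and only if $c_0(p)=\dots=c_{s-r-1}(p)=0$ and $c_{s-r}(p)\ne0$. In particular, for $0\le i<s$, $p$ lies in the output set with index $i$ of step 5 if and only if $\operatorname{rank}H_h(p)=s-i$. -/

import Mathlib

namespace GeomCAD

open Polynomial

noncomputable section

/-! ### Semi-algebraic geometry over an ordered field `R`

`R ^ n` is `Fin n → R`; with the order topology on `R` its product topology is the Euclidean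
topology.  The projection `R ^ (n + 1) → R ^ n` forgetting the last coordinate is `Fin.init`. -/

section Semialgebraic

variable {R : Type*} [Field R] [LinearOrder R]

/-- Basic semi-algebraic sets: finitely many equations `f = 0` and inequalities `h > 0`. -/
def IsBasicSemialgebraic {σ : Type*} (S : Set (σ → R)) : Prop :=
  ∃ P Q : Finset (MvPolynomial σ R),
    S = {a | (∀ f ∈ P, MvPolynomial.eval a f = 0) ∧ ∀ h ∈ Q, 0 < MvPolynomial.eval a h}

/-- Semi-algebraic sets: finite unions of basic semi-algebraic sets. -/
def IsSemialgebraic {σ : Type*} (S : Set (σ → R)) : Prop :=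
  ∃ F : Set (Set (σ → R)), F.Finite ∧ (∀ B ∈ F, IsBasicSemialgebraic B) ∧ S = ⋃₀ F

/-- The map `f` is a semi-algebraic function on `S ⊆ R ^ m` with values in `R ^ p`: its graph,
a subset of `R ^ (m + p)`, is semi-algebraic. -/
def IsSemialgebraicFunOn {m p : ℕ} (S : Set (Fin m → R)) (f : (Fin m → R) → (Fin p → R)) : Prop :=
  IsSemialgebraic {v : Fin (m + p) → R | ∃ a ∈ S, v = Fin.append a (f a)}

/-- `S` is not a disjoint union of two non-empty semi-algebraic subsets that are closed in `S`. -/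
def IsSemialgConnected [TopologicalSpace R] {n : ℕ} (S : Set (Fin n → R)) : Prop :=
  ¬ ∃ A B : Set (Fin n → R), IsSemialgebraic A ∧ IsSemialgebraic B ∧ A.Nonempty ∧ B.Nonempty ∧
    Disjoint A B ∧ A ∪ B = S ∧
    IsClosed ((↑) ⁻¹' A : Set S) ∧ IsClosed ((↑) ⁻¹' B : Set S)

/-- `S` is a semi-algebraically connected component of `L`: a maximal non-empty
semi-algebraically connected semi-algebraic subset of `L`. -/
structure IsSemialgComponent [TopologicalSpace R] {n : ℕ} (S L : Set (Fin n → R)) : Prop where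
  subset : S ⊆ L
  nonempty : S.Nonempty
  semialgebraic : IsSemialgebraic S
  connected : IsSemialgConnected S
  maximal : ∀ S' : Set (Fin n → R), S ⊆ S' → S' ⊆ L → IsSemialgebraic S' →
    IsSemialgConnected S' → S' = S

end Semialgebraic

/-! ### Basic constructible sets and geometric delineability

The ring `K[y₁, …, yₙ, x]` is written as `K[y₁, …, yₙ][x]`. -/

/-- The polynomial ring `K[y, x]` in `n + 1` variables, as `K[y][x]`. -/
abbrev PolyYX (K : Type*) [CommRing K] (n : ℕ) : Type _ := Polynomial (MvPolynomial (Fin n) K)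

section Delineability

variable {K : Type*} [Field K] {n : ℕ}

/-- The univariate polynomial `f(a; x)` over `R` obtained by substituting `a ∈ R ^ n` for `y`. -/
def specialize {R : Type*} [Field R] [Algebra K R] (a : Fin n → R) (f : PolyYX K n) : R[X] :=
  f.map (MvPolynomial.aeval a : MvPolynomial (Fin n) K →ₐ[K] R).toRingHom

/-- The `R`-rational points of `T = V(I) ∩ D(h)` in `R ^ (n + 1)`. -/
def realPoints (R : Type*) [Field R] [Algebra K R] (I : Ideal (PolyYX K n)) (h : PolyYX K n) :
    Set (Fin (n + 1) → R) :=
  {t | (∀ f ∈ I, (specialize (Fin.init t) f).eval (t (Fin.last n)) = 0) ∧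
    (specialize (Fin.init t) h).eval (t (Fin.last n)) ≠ 0}

/-- The geometric fibre of `T = V(I) ∩ D(h)` over `a ∈ R ^ n`: the solutions `z` in the algebraic
closure `C` of `R` of `f(a; z) = 0` (`f ∈ I`), `h(a; z) ≠ 0`. -/
def geomFibre {R : Type*} [Field R] [Algebra K R] (I : Ideal (PolyYX K n)) (h : PolyYX K n)
    (a : Fin n → R) : Set (AlgebraicClosure R) :=
  {z | (∀ f ∈ I, aeval z (specialize a f) = 0) ∧ aeval z (specialize a h) ≠ 0}

variable {R : Type*} [Field R] [LinearOrder R] [TopologicalSpace R] [Algebra K R]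

/-- Conditions 1 to 3 of geometric delineability of `T = V(I) ∩ D(h)` over `S`: the number of
points of the geometric fibre is finite and constant on `S`, and the real points of `T` above `S`
are the disjoint union of the graphs of finitely many semi-algebraic continuous sections,
arranged in strictly ascending order of the last coordinate. -/
def HasSections (I : Ideal (PolyYX K n)) (h : PolyYX K n) (S : Set (Fin n → R)) : Prop :=
  (∃ N : ℕ, ∀ a ∈ S, (geomFibre I h a).encard = N) ∧
  ∃ (l : ℕ) (ξ : Fin l → (Fin n → R) → (Fin (n + 1) → R)),
    (∀ i, IsSemialgebraicFunOn S (ξ i) ∧ ContinuousOn (ξ i) S) ∧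
    (∀ i, ∀ a ∈ S, ξ i a ∈ realPoints R I h ∧ Fin.init (ξ i a) = a) ∧
    (∀ i j, i < j → ∀ a ∈ S, ξ i a (Fin.last n) < ξ j a (Fin.last n)) ∧
    ∀ t ∈ realPoints R I h, Fin.init t ∈ S → ∃! i, t = ξ i (Fin.init t)

/-- Geometric delineability of `T = V(I) ∩ D(h)` over `S`.  By convention `T` is also
geometrically delineable over `S` if, above `S`, it coincides (over the algebraic closure) with
`D(h')` for some `h' ∈ R[y, x]` such that `V(h')` is geometrically delineable over `S`. -/
def IsGeomDelineable (I : Ideal (PolyYX K n)) (h : PolyYX K n) (S : Set (Fin n → R)) : Prop :=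
  HasSections I h S ∨
  ∃ h' : PolyYX R n,
    (∀ a ∈ S, geomFibre I h a = geomFibre (⊥ : Ideal (PolyYX R n)) h' a) ∧
    HasSections (Ideal.span {h'}) 1 S

end Delineability

/-- A basic constructible set `V(𝔞) ∩ D(q)` in affine `n`-space, given by `𝔞` and `q`. -/
structure BasicConstructible (k : Type*) [Field k] (n : ℕ) where
  ideal : Ideal (MvPolynomial (Fin n) k)
  poly : MvPolynomial (Fin n) k

section Algorithm

variable {k : Type*} [Field k] {n : ℕ}

/-- The algebraic set `V(𝔞)` in `R ^ n`. -/
def zeroLocus (R : Type*) [Field R] [Algebra k R] (𝔞 : Ideal (MvPolynomial (Fin n) k)) :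
    Set (Fin n → R) :=
  {p | ∀ f ∈ 𝔞, MvPolynomial.aeval p f = 0}

/-- The points of `V(𝔞) ∩ D(q)` in `R ^ n`. -/
def BasicConstructible.points (R : Type*) [Field R] [Algebra k R] (L : BasicConstructible k n) :
    Set (Fin n → R) :=
  {p | p ∈ zeroLocus R L.ideal ∧ MvPolynomial.aeval p L.poly ≠ 0}

/-! ### Gröbner bases for the block order `x > T_y` -/

/-- The exponent of the leading monomial of `f ∈ k[y, x]` for the block order `x > T_y`, which
compares the powers of `x` first and breaks ties by the monomial order `T_y = m`.  Exponents are
pairs (power of `x`, exponent of `y`), and divisibility of monomials is the componentwise order. -/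
def leadingExp (m : MonomialOrder (Fin n)) (f : PolyYX k n) : ℕ × (Fin n →₀ ℕ) :=
  (f.natDegree, m.degree f.leadingCoeff)

/-- `G` is a reduced Gröbner basis of `I` for the block order `x > T_y`, `T_y = m`. -/
structure IsReducedGroebnerBasis (m : MonomialOrder (Fin n)) (G : Finset (PolyYX k n))
    (I : Ideal (PolyYX k n)) : Prop where
  span_eq : Ideal.span (G : Set (PolyYX k n)) = I
  leading : ∀ f ∈ I, f ≠ 0 → ∃ g ∈ G, leadingExp m g ≤ leadingExp m f
  monic : ∀ g ∈ G, m.leadingCoeff g.leadingCoeff = 1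
  reduced : ∀ g ∈ G, ∀ g' ∈ G, g' ≠ g → ∀ (i : ℕ) (α : Fin n →₀ ℕ),
    (g.coeff i).coeff α ≠ 0 → ¬ leadingExp m g' ≤ (i, α)

/-- A list of prime ideals with intersection `√𝔞`, i.e. `V(𝔞)` is the union of the irreducible
closed sets `V(P)`. The list of minimal primes of `𝔞` is one; redundant lists are allowed too. -/
def IsPrimeDecomposition (𝔞 : Ideal (MvPolynomial (Fin n) k))
    (Ps : List (Ideal (MvPolynomial (Fin n) k))) : Prop :=
  (∀ P ∈ Ps, P.IsPrime) ∧ sInf {P | P ∈ Ps} = 𝔞.radical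

/-! ### The parametric Hermite form -/

section Hermite

variable (J : Ideal (MvPolynomial (Fin n) k)) (w : MvPolynomial (Fin n) k)

/-- `A_w = (k[y] / J)_w`. -/
abbrev BaseRing : Type _ := Localization.Away (Ideal.Quotient.mk J w)

/-- The canonical map `k[y] → A_w`. -/
def toBase : MvPolynomial (Fin n) k →+* BaseRing J w :=
  (algebraMap (MvPolynomial (Fin n) k ⧸ J) (BaseRing J w)).comp (Ideal.Quotient.mk J)

/-- `B_w = (k[y, x] / I)_w`, as the quotient of `A_w[x]` by the ideal generated by `I`
(where `J ⊆ I`). -/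
abbrev TotalRing (I : Ideal (PolyYX k n)) : Type _ :=
  (BaseRing J w)[X] ⧸ I.map (Polynomial.mapRingHom (toBase J w))

/-- The matrix `(tr L_{x ^ (i + j) h})` of size `s`, where `L_b` is multiplication by `b` on the
`A_w`-module `B_w`. -/
def hermiteMatrix (I : Ideal (PolyYX k n)) (h : PolyYX k n) (s : ℕ) :
    Matrix (Fin s) (Fin s) (BaseRing J w) :=
  Matrix.of fun i j =>
    Algebra.trace (BaseRing J w) (TotalRing J w I)
      (Ideal.Quotient.mk _ (X ^ ((i : ℕ) + (j : ℕ)) * h.map (toBase J w)))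

/-- Evaluation of elements of `A_w` at a point `p` of `V(J) ∩ D(w)` in `R ^ n`. -/
def evalBase {R : Type*} [Field R] [Algebra k R] (p : Fin n → R) (hJ : p ∈ zeroLocus R J)
    (hw : MvPolynomial.aeval p w ≠ 0) : BaseRing J w →+* R :=
  IsLocalization.Away.lift (S := BaseRing J w) (Ideal.Quotient.mk J w)
    (g := Ideal.Quotient.lift J
      (MvPolynomial.aeval p : MvPolynomial (Fin n) k →ₐ[k] R).toRingHom hJ)
    (isUnit_iff_ne_zero.mpr hw)

end Hermite

/-! ### The algorithm -/

/-- The data `(I, J, h)` on which the algorithm is called. -/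
structure Input (k : Type*) [Field k] (n : ℕ) where
  I : Ideal (PolyYX k n)
  J : Ideal (MvPolynomial (Fin n) k)
  h : PolyYX k n

/-- The input condition: `J` is prime and `J ⊆ I ∩ k[y]`. -/
def Input.IsValid (c : Input k n) : Prop :=
  c.J.IsPrime ∧ c.J ≤ c.I.comap (C : MvPolynomial (Fin n) k →+* PolyYX k n)

/-- The arguments `(P · k[y, x] + I, P, h)` of a recursive call. -/
def Input.restrict (c : Input k n) (P : Ideal (MvPolynomial (Fin n) k)) : Input k n :=
  ⟨P.map (C : MvPolynomial (Fin n) k →+* PolyYX k n) ⊔ c.I, P, c.h⟩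

open Classical in
/-- `G \ J`. -/
def nonBase (J : Ideal (MvPolynomial (Fin n) k)) (G : Finset (PolyYX k n)) :
    Finset (PolyYX k n) :=
  G.filter fun g => g ∉ (C : MvPolynomial (Fin n) k →+* PolyYX k n) '' J

/-- `w`, the product of the leading coefficients with respect to `x` of the elements of `G \ J`. -/
def wPoly (J : Ideal (MvPolynomial (Fin n) k)) (G : Finset (PolyYX k n)) :
    MvPolynomial (Fin n) k :=
  ∏ g ∈ nonBase J G, g.leadingCoeff

/-- `s`, the minimal degree in `x` of the elements of `G \ J`. -/
def sDeg (J : Ideal (MvPolynomial (Fin n) k)) (G : Finset (PolyYX k n)) : ℕ :=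
  sInf (Polynomial.natDegree '' (nonBase J G : Set (PolyYX k n)))

/-- The matrix `H_h` computed by the algorithm from `(I, J, h)` and `G`. -/
def Input.hermite (c : Input k n) (G : Finset (PolyYX k n)) :
    Matrix (Fin (sDeg c.J G)) (Fin (sDeg c.J G)) (BaseRing c.J (wPoly c.J G)) :=
  hermiteMatrix c.J (wPoly c.J G) c.I c.h (sDeg c.J G)

/-- The coefficient `c_i ∈ A_w` of the characteristic polynomial of `H_h`. -/
def Input.charCoeff (c : Input k n) (G : Finset (PolyYX k n)) (i : ℕ) :
    BaseRing c.J (wPoly c.J G) :=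
  (c.hermite G).charpoly.coeff i

/-- The polynomials `e i` are numerators of the coefficients `c_i`: `e i = w ^ N * c_i` in `A_w`
for some `N`. -/
def Input.IsNumerators (c : Input k n) (G : Finset (PolyYX k n))
    (e : ℕ → MvPolynomial (Fin n) k) : Prop :=
  ∀ i < sDeg c.J G, ∃ N : ℕ, toBase c.J (wPoly c.J G) (e i) =
    toBase c.J (wPoly c.J G) (wPoly c.J G) ^ N * c.charCoeff G i

/-- `V(J + ⟨c_0, …, c_{i-1}⟩) ∩ D(w c_i)`, with `c_j` represented by the numerator `e j`. -/
def Input.piece (c : Input k n) (G : Finset (PolyYX k n)) (e : ℕ → MvPolynomial (Fin n) k)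
    (i : ℕ) : BasicConstructible k n :=
  ⟨c.J ⊔ Ideal.span (e '' {j | j < i}), wPoly c.J G * e i⟩

/-- All tests before the computation of `H_h` have been passed: `1 ∉ I`, `I ∩ k[y] = J`, and
the reduced Gröbner basis `G` of `I` is not contained in `k[y]`. -/
structure Input.ReachesHermite (c : Input k n) (m : MonomialOrder (Fin n))
    (G : Finset (PolyYX k n)) : Prop where
  one_notMem : (1 : PolyYX k n) ∉ c.I
  elim_eq : c.I.comap (C : MvPolynomial (Fin n) k →+* PolyYX k n) = c.J
  basis : IsReducedGroebnerBasis m G c.I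
  not_subset :
    ¬ (G : Set (PolyYX k n)) ⊆ Set.range (C : MvPolynomial (Fin n) k →+* PolyYX k n)

/-- `Step R c Ls cs`: the execution of the body of `Proj1` on `c` may add the basic constructible
sets `Ls` to the output and make the recursive calls `cs`.  The choices left to the subroutines
(the order `T_y`, the decompositions, the numerators) are arbitrary. -/
inductive Step (R : Type*) [Field R] [Algebra k R] :
    Input k n → List (BasicConstructible k n) → List (Input k n) → Prop
  | empty (c : Input k n) (h1 : (1 : PolyYX k n) ∈ c.I) :
      Step R c [⟨c.J, 1⟩] []
  | notDominant (c : Input k n) (h1 : (1 : PolyYX k n) ∉ c.I)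
      (hne : c.I.comap (C : MvPolynomial (Fin n) k →+* PolyYX k n) ≠ c.J)
      (Ls : List (BasicConstructible k n))
      (hLs : ⋃ L ∈ Ls, L.points R = zeroLocus R c.J \
        zeroLocus R (c.I.comap (C : MvPolynomial (Fin n) k →+* PolyYX k n)))
      (Ps : List (Ideal (MvPolynomial (Fin n) k)))
      (hPs : IsPrimeDecomposition
        (c.I.comap (C : MvPolynomial (Fin n) k →+* PolyYX k n)) Ps) :
      Step R c Ls (Ps.map c.restrict)
  | notFinite (c : Input k n) (h1 : (1 : PolyYX k n) ∉ c.I)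
      (heq : c.I.comap (C : MvPolynomial (Fin n) k →+* PolyYX k n) = c.J)
      (m : MonomialOrder.{0, 0} (Fin n)) (G : Finset (PolyYX k n))
      (hG : IsReducedGroebnerBasis m G c.I)
      (hsub : (G : Set (PolyYX k n)) ⊆
        Set.range (C : MvPolynomial (Fin n) k →+* PolyYX k n)) :
      Step R c [] [⟨c.I ⊔ Ideal.span {c.h}, c.J, 1⟩]
  | hermite (c : Input k n) (m : MonomialOrder.{0, 0} (Fin n)) (G : Finset (PolyYX k n))
      (hG : c.ReachesHermite m G)
      (e : ℕ → MvPolynomial (Fin n) k) (he : c.IsNumerators G e)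
      (Ps : List (Ideal (MvPolynomial (Fin n) k)))
      (hPs : IsPrimeDecomposition (c.J ⊔ Ideal.span {wPoly c.J G}) Ps) :
      Step R c ((List.range (sDeg c.J G)).map (c.piece G e)) (Ps.map c.restrict)

/-- `Run R c out`: the recursive algorithm `Proj1`, called on `c`, may return the list `out`. -/
inductive Run (R : Type*) [Field R] [Algebra k R] :
    Input k n → List (BasicConstructible k n) → Prop
  | intro (c : Input k n) (Ls : List (BasicConstructible k n)) (cs : List (Input k n))
      (hstep : Step R c Ls cs) (outs : Fin cs.length → List (BasicConstructible k n))
      (hrec : ∀ i, Run R (cs.get i) (outs i)) :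
      Run R c (Ls ++ (List.ofFn outs).flatten)

/-- `Proj1` terminates on `c`: the body can be executed, and whatever choices are made in its
execution, `Proj1` terminates on each of the finitely many recursive calls.  As the predicate is
inductive, there is no infinite chain of recursive calls. -/
inductive Terminates (R : Type*) [Field R] [Algebra k R] : Input k n → Prop
  | intro (c : Input k n) (hex : ∃ Ls cs, Step R c Ls cs)
      (hrec : ∀ Ls cs, Step R c Ls cs → ∀ c' ∈ cs, Terminates R c') : Terminates R c

end Algorithm

end

end GeomCAD

/-!
Over a point `p ∈ V(J) ∩ D(w)` at which the algorithm computes a Hermite form, `A_w[x] / I` is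
`A_w[x] / (f₀)` for a monic `f₀` of degree `s`: the element of least positive degree in the reduced
Gröbner basis divides `I` up to powers of its leading coefficient, which is invertible in `A_w`
(`Input.ReachesHermite.exists_monic_generator`). The trace of `L_b` at `p` is therefore the sum of
the values of `b` at the complex roots of `f₀(p; x)` (`map_trace_adjoinRoot`), so the Hermite matrix
at `p` is a Hankel matrix of weighted power sums over the geometric fibre, with non-zero weights
(`Input.ReachesHermite.exists_weights`). By the Vandermonde factorization its rank is the number of
points of the fibre (`rank_hankel`, `Input.ReachesHermite.encard_geomFibre`). A symmetric matrix
over an ordered field has `0` as a semisimple eigenvalue, so its rank is read off from the lowest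
non-zero coefficient of its characteristic polynomial (`rank_eq_iff_charpoly_coeff`).

Let `S` be a semi-algebraically connected set on which this rank is constantly `r`. The leading
`r × r` block of the Hermite matrix is invertible on `S`, and solving a linear system with it gives
a monic polynomial `F` of degree `r`, with coefficients regular on `S`, whose complex roots at
`a ∈ S` are exactly the `r` points of the fibre (`exists_separable_of_power_sums`). So `F` is
separable over every point of `S`. Simple real roots are stable under small changes of the
coefficients (`eventually_sortedRoot_near`), hence their number is locally constant on `S`; it is
also semi-algebraic in `a`, being the signature of the trace form of `F`
(`isSemialgebraic_setOf_card_roots`), and thus constant. The roots in ascending order are the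
required sections (`exists_sections`): they are continuous, and semi-algebraic because the `j`-th
root is the root with a prescribed number of roots above it, which is again a signature condition.
Real root counting by signatures makes quantifier elimination unnecessary; the semi-algebraic sets
needed are Boolean combinations of polynomial conditions, since the signature of a symmetric matrix
is found by successive Schur complements (`isSemialgebraic_setOf_sigPos_eq`). The facts used about
real closed fields are that `R[i]` is algebraically closed and the intermediate value theorem for
polynomials.

The recursion strictly enlarges the prime ideal `J`, except for the call on `(I + ⟨h⟩, J, 1)`, which
enlarges `I` or, if `h ∈ I`, replaces `h` by `1`; termination is Noetherian induction
(`terminates_of_isValid`). Correctness is proved along the recursion with the additional invariant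
that the output sets cover `V(J)` whenever `h = 1` (`IsCorrect`). The call on `(I + ⟨h⟩, J, 1)`
occurs when `I` is generated by `J`; there the fibre is the complement of the zeros of `h(a; x)`,
which is what the convention about `D(h')` in the definition of delineability is for
(`IsCorrect.of_sup_span`).
-/

namespace GeomCAD

open Polynomial

noncomputable section

set_option linter.unusedSectionVars false

/-! ### The algebraic closure of a real closed field -/

section RealClosed

/-- A finite Galois extension of a field in which odd-degree polynomials have roots has degree a
power of two: the fixed field of a Sylow `2`-subgroup has odd degree, so it is the base field. -/
theorem exists_finrank_eq_two_pow {R E : Type*} [Field R] [IsRealClosed R] [CharZero R] [Field E]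
    [Algebra R E] [FiniteDimensional R E] [IsGalois R E] :
    ∃ m : ℕ, Module.finrank R E = 2 ^ m := by
  have : Fact (Nat.Prime 2) := ⟨Nat.prime_two⟩
  obtain ⟨H⟩ : Nonempty (Sylow 2 Gal(E/R)) := inferInstance
  let L := IntermediateField.fixedField (H : Subgroup Gal(E/R))
  have h1 : Module.finrank L E = Nat.card H := IntermediateField.finrank_fixedField_eq_card _
  have h2 : Module.finrank R L * Module.finrank L E = Module.finrank R E :=
    Module.finrank_mul_finrank R L E
  have hindex : Module.finrank R L = (H : Subgroup Gal(E/R)).index := by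
    have h3 := (H : Subgroup Gal(E/R)).card_mul_index
    rw [IsGalois.card_aut_eq_finrank, ← h2, h1, mul_comm] at h3
    exact (Nat.eq_of_mul_eq_mul_right Nat.card_pos h3).symm
  have hodd : Odd (Module.finrank R L) := by
    rw [hindex, ← Nat.not_even_iff_odd, even_iff_two_dvd]
    exact H.not_dvd_index
  obtain ⟨α, hα⟩ := Field.exists_primitive_element R L
  have hint : IsIntegral R α := .of_finite R α
  have hdeg : (minpoly R α).natDegree = Module.finrank R L := by
    rw [← IntermediateField.adjoin.finrank hint, hα, IntermediateField.finrank_top']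
  obtain ⟨x, hx⟩ := IsRealClosed.exists_isRoot_of_odd_natDegree (hdeg ▸ hodd)
  have h4 : (minpoly R α).natDegree = 1 := natDegree_eq_of_degree_eq_some
    (degree_eq_one_of_irreducible_of_root (minpoly.irreducible hint) hx)
  obtain ⟨m, hm⟩ := H.isPGroup'.exists_card_eq
  refine ⟨m, ?_⟩
  rw [← h2, ← hdeg, h4, one_mul, h1, hm]

/-- A field of characteristic zero in which every element is a square has no non-trivial Galois
extension of degree a power of two, since such an extension would contain a quadratic one. -/
theorem finrank_eq_one_of_isSquare {K E : Type*} [Field K] [CharZero K] (hK : ∀ x : K, IsSquare x)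
    [Field E] [Algebra K E] [FiniteDimensional K E] [IsGalois K E] {m : ℕ}
    (hm : Module.finrank K E = 2 ^ m) : Module.finrank K E = 1 := by
  have : Fact (Nat.Prime 2) := ⟨Nat.prime_two⟩
  rcases m with _ | m
  · simpa using hm
  exfalso
  obtain ⟨H, hH⟩ := Sylow.exists_subgroup_card_pow_prime (G := Gal(E/K)) 2 (n := m)
    (by rw [IsGalois.card_aut_eq_finrank, hm]; exact pow_dvd_pow 2 m.le_succ)
  let L := IntermediateField.fixedField H
  have h1 : Module.finrank L E = 2 ^ m :=
    (IntermediateField.finrank_fixedField_eq_card H).trans hH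
  have h2 : Module.finrank K L = 2 := by
    have h3 : Module.finrank K L * Module.finrank L E = Module.finrank K E :=
      Module.finrank_mul_finrank K L E
    rw [h1, hm, pow_succ, mul_comm] at h3
    exact Nat.eq_of_mul_eq_mul_left (by positivity) h3
  obtain ⟨α, hα⟩ := Field.exists_primitive_element K L
  have hint : IsIntegral K α := .of_finite K α
  have hdeg : (minpoly K α).natDegree = 2 := by
    rw [← h2, ← IntermediateField.adjoin.finrank hint, hα, IntermediateField.finrank_top']
  have hirr := minpoly.irreducible hint
  have hmon := minpoly.monic hint
  set f := minpoly K α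
  obtain ⟨d, hd⟩ := hK (f.coeff 1 ^ 2 / 4 - f.coeff 0)
  have hroot : f.IsRoot (d - f.coeff 1 / 2) := by
    have h5 : f.coeff 2 = 1 := by rw [← hdeg]; exact hmon
    rw [IsRoot, eval_eq_sum_range, hdeg]
    simp only [Finset.sum_range_succ, Finset.sum_range_zero, h5]
    linear_combination -hd
  have h4 : f.natDegree = 1 := natDegree_eq_of_degree_eq_some
    (degree_eq_one_of_irreducible_of_root hirr hroot)
  omega

variable {R : Type*} [Field R] [LinearOrder R] [IsStrictOrderedRing R]

theorem add_sq_pos_of_ne_zero (x : R) {b : R} (hb : b ≠ 0) : 0 < x ^ 2 + b ^ 2 := by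
  positivity

variable [IsRealClosed R]

variable (R) in
/-- A square root of `-1` in the algebraic closure. -/
def imagUnit : AlgebraicClosure R :=
  (IsAlgClosed.exists_pow_nat_eq (-1 : AlgebraicClosure R) (n := 2) two_pos).choose

variable (R) in
theorem imagUnit_sq : imagUnit R ^ 2 = -1 :=
  (IsAlgClosed.exists_pow_nat_eq (-1 : AlgebraicClosure R) (n := 2) two_pos).choose_spec

/-- The element `a + b i` of the algebraic closure. -/
def mkComplex (a b : R) : AlgebraicClosure R :=
  algebraMap R _ a + algebraMap R _ b * imagUnit R

/-- Square roots in `R[i]` are computed from square roots of non-negative elements of `R`. -/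
theorem exists_complex_sqrt (a b : R) : ∃ c d : R, c ^ 2 - d ^ 2 = a ∧ 2 * c * d = b := by
  obtain ⟨ρ, hρ0, hρ⟩ : ∃ ρ : R, 0 ≤ ρ ∧ ρ ^ 2 = a ^ 2 + b ^ 2 := by
    obtain ⟨ρ, hρ⟩ := IsRealClosed.exists_eq_pow_of_nonneg
      (show (0 : R) ≤ a ^ 2 + b ^ 2 by positivity) two_ne_zero
    exact ⟨|ρ|, abs_nonneg _, by rw [sq_abs, hρ]⟩
  have habs : |a| ≤ ρ := abs_le_of_sq_le_sq (by nlinarith [sq_nonneg b]) hρ0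
  obtain ⟨c, hc⟩ := IsRealClosed.exists_eq_pow_of_nonneg
    (show (0 : R) ≤ (ρ + a) / 2 by linarith [neg_le_of_abs_le habs]) two_ne_zero
  obtain ⟨d, hd⟩ := IsRealClosed.exists_eq_pow_of_nonneg
    (show (0 : R) ≤ (ρ - a) / 2 by linarith [le_of_abs_le habs]) two_ne_zero
  have h : (2 * c * d) ^ 2 = b ^ 2 := by
    have : (2 * c * d) ^ 2 = 4 * (c ^ 2) * d ^ 2 := by ring
    rw [this, ← hc, ← hd]
    linear_combination hρ
  rcases sq_eq_sq_iff_eq_or_eq_neg.mp h with h | h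
  · exact ⟨c, d, by rw [← hc, ← hd]; ring, h⟩
  · exact ⟨c, -d, by rw [neg_sq, ← hc, ← hd]; ring, by linarith⟩

/-- The algebraic closure of a real closed field `R` is `R[i]`: a finite Galois extension of `R`
containing `R[i]` has degree a power of two over `R[i]`, where all elements are squares. -/
theorem exists_eq_mkComplex (z : AlgebraicClosure R) : ∃ a b : R, z = mkComplex a b := by
  have : CharZero R := inferInstance
  let A := IntermediateField.adjoin R {imagUnit R, z}
  have : FiniteDimensional R A :=
    IntermediateField.finiteDimensional_adjoin fun x _ => Algebra.IsIntegral.isIntegral x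
  -- `R ⊆ K = R[i] ⊆ E ∋ z` with `E` Galois over `R`; `K` will turn out to be all of `E`
  let E := IntermediateField.normalClosure R A (AlgebraicClosure R)
  have : IsGalois R E := ⟨⟩
  have hAE : A ≤ E := IntermediateField.le_normalClosure A
  have hi : imagUnit R ∈ E := hAE (IntermediateField.subset_adjoin R _ (by simp))
  have hz : z ∈ E := hAE (IntermediateField.subset_adjoin R _ (by simp))
  let i : E := ⟨imagUnit R, hi⟩
  have hi2 : i ^ 2 = -1 := Subtype.ext (imagUnit_sq R)
  let K := IntermediateField.adjoin R {i}
  have hmemK (a b : R) : algebraMap R E a + algebraMap R E b * i ∈ K :=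
    add_mem (K.algebraMap_mem a)
      (mul_mem (K.algebraMap_mem b) (IntermediateField.mem_adjoin_simple_self R i))
  have hform : ∀ x ∈ K, ∃ a b : R, x = algebraMap R E a + algebraMap R E b * i := by
    intro x hx
    have hx' : x ∈ Algebra.adjoin R {i} := by
      rwa [← IntermediateField.adjoin_simple_toSubalgebra_of_isAlgebraic
        (Algebra.IsAlgebraic.isAlgebraic i)]
    clear hx
    induction hx' using Algebra.adjoin_induction with
    | mem x hx => exact ⟨0, 1, by simpa using hx⟩
    | algebraMap r => exact ⟨r, 0, by simp⟩
    | add x y _ _ ihx ihy =>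
      obtain ⟨a, b, rfl⟩ := ihx
      obtain ⟨c, d, rfl⟩ := ihy
      exact ⟨a + c, b + d, by simp only [map_add]; ring⟩
    | mul x y _ _ ihx ihy =>
      obtain ⟨a, b, rfl⟩ := ihx
      obtain ⟨c, d, rfl⟩ := ihy
      refine ⟨a * c - b * d, a * d + b * c, ?_⟩
      simp only [map_add, map_mul, map_sub]
      linear_combination (algebraMap R E b * algebraMap R E d) * hi2
  have hsq : ∀ x : K, IsSquare x := by
    rintro ⟨x, hx⟩
    obtain ⟨a, b, rfl⟩ := hform x hx
    obtain ⟨c, d, h1, h2⟩ := exists_complex_sqrt a b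
    refine ⟨⟨_, hmemK c d⟩, Subtype.ext ?_⟩
    simp only [MulMemClass.mk_mul_mk, ← h1, ← h2, map_sub, map_mul, map_pow, map_ofNat]
    linear_combination -(algebraMap R E d) ^ 2 * hi2
  obtain ⟨m, hm⟩ := exists_finrank_eq_two_pow (R := R) (E := E)
  obtain ⟨m', -, hm'⟩ := (Nat.dvd_prime_pow Nat.prime_two).mp
    (hm ▸ Dvd.intro_left _ (Module.finrank_mul_finrank R K E))
  have h1 := finrank_eq_one_of_isSquare hsq hm'
  have hzK : (⟨z, hz⟩ : E) ∈ K := by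
    rw [IntermediateField.finrank_eq_one_iff_eq_top.mp h1]
    trivial
  obtain ⟨a, b, h⟩ := hform _ hzK
  exact ⟨a, b, congrArg Subtype.val h⟩

theorem not_sq_eq_neg_one (x : R) : x ^ 2 ≠ -1 := by
  nlinarith [sq_nonneg x]

theorem mkComplex_injective {a b c d : R} (h : mkComplex a b = mkComplex c d) :
    a = c ∧ b = d := by
  have hinj := (algebraMap R (AlgebraicClosure R)).injective
  have h' : algebraMap R (AlgebraicClosure R) (a - c) = algebraMap R _ (d - b) * imagUnit R := by
    simp only [mkComplex] at h
    simp only [map_sub]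
    linear_combination h
  have h2 : (a - c) ^ 2 = - (d - b) ^ 2 := by
    apply hinj
    rw [map_pow, h', mul_pow, imagUnit_sq, map_neg, map_pow]
    ring
  have h3 : a - c = 0 := by
    by_contra hne
    have := add_sq_pos_of_ne_zero (d - b) hne
    linarith
  have h4 : d - b = 0 := by
    by_contra hne
    have := add_sq_pos_of_ne_zero (a - c) hne
    linarith
  exact ⟨by linarith, by linarith⟩

/-- The real part of an element of `R[i]`. -/
def rePart (z : AlgebraicClosure R) : R := (exists_eq_mkComplex z).choose

/-- The imaginary part of an element of `R[i]`. -/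
def imPart (z : AlgebraicClosure R) : R := (exists_eq_mkComplex z).choose_spec.choose

theorem mkComplex_re_im (z : AlgebraicClosure R) : mkComplex (rePart z) (imPart z) = z :=
  (exists_eq_mkComplex z).choose_spec.choose_spec.symm

@[simp] theorem rePart_mkComplex (a b : R) : rePart (mkComplex a b) = a :=
  (mkComplex_injective (mkComplex_re_im (mkComplex a b))).1

@[simp] theorem imPart_mkComplex (a b : R) : imPart (mkComplex a b) = b :=
  (mkComplex_injective (mkComplex_re_im (mkComplex a b))).2

theorem mkComplex_add (a b c d : R) :
    mkComplex a b + mkComplex c d = mkComplex (a + c) (b + d) := by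
  simp only [mkComplex, map_add]; ring

theorem mkComplex_mul (a b c d : R) :
    mkComplex a b * mkComplex c d = mkComplex (a * c - b * d) (a * d + b * c) := by
  simp only [mkComplex, map_add, map_sub, map_mul]
  linear_combination (algebraMap R _ b * algebraMap R _ d) * imagUnit_sq R

theorem algebraMap_eq_mkComplex (a : R) : algebraMap R (AlgebraicClosure R) a = mkComplex a 0 := by
  simp [mkComplex]

theorem rePart_add (z w : AlgebraicClosure R) : rePart (z + w) = rePart z + rePart w := by
  conv_lhs => rw [← mkComplex_re_im z, ← mkComplex_re_im w, mkComplex_add, rePart_mkComplex]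

theorem imPart_add (z w : AlgebraicClosure R) : imPart (z + w) = imPart z + imPart w := by
  conv_lhs => rw [← mkComplex_re_im z, ← mkComplex_re_im w, mkComplex_add, imPart_mkComplex]

theorem rePart_mul (z w : AlgebraicClosure R) :
    rePart (z * w) = rePart z * rePart w - imPart z * imPart w := by
  conv_lhs => rw [← mkComplex_re_im z, ← mkComplex_re_im w, mkComplex_mul, rePart_mkComplex]

theorem imPart_mul (z w : AlgebraicClosure R) :
    imPart (z * w) = rePart z * imPart w + imPart z * rePart w := by
  conv_lhs => rw [← mkComplex_re_im z, ← mkComplex_re_im w, mkComplex_mul, imPart_mkComplex]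

@[simp] theorem rePart_algebraMap (a : R) : rePart (algebraMap R (AlgebraicClosure R) a) = a := by
  rw [algebraMap_eq_mkComplex, rePart_mkComplex]

@[simp] theorem imPart_algebraMap (a : R) : imPart (algebraMap R (AlgebraicClosure R) a) = 0 := by
  rw [algebraMap_eq_mkComplex, imPart_mkComplex]

theorem eq_algebraMap_of_imPart_eq_zero {z : AlgebraicClosure R} (hz : imPart z = 0) :
    z = algebraMap R _ (rePart z) := by
  conv_lhs => rw [← mkComplex_re_im z, hz, ← algebraMap_eq_mkComplex]

variable (R) in
/-- `i` and `-i` are conjugate, since `-1` is not a square in `R`. -/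
theorem exists_conj : ∃ σ : AlgebraicClosure R ≃ₐ[R] AlgebraicClosure R,
    σ (imagUnit R) = -imagUnit R := by
  have hmin : ∀ z : AlgebraicClosure R, z ^ 2 = -1 → minpoly R z = X ^ 2 + C 1 := by
    intro z hz
    have hdeg : (X ^ 2 + C 1 : R[X]).natDegree = 2 := natDegree_X_pow_add_C
    have hirr : Irreducible (X ^ 2 + C 1 : R[X]) := by
      rw [irreducible_iff_roots_eq_zero_of_degree_le_three (by omega) (by omega)]
      refine Multiset.eq_zero_of_forall_notMem fun x hx => ?_
      have := (mem_roots'.mp hx).2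
      simp only [IsRoot, eval_add, eval_pow, eval_X, eval_C] at this
      exact not_sq_eq_neg_one x (by linarith)
    refine (minpoly.eq_of_irreducible_of_monic hirr ?_ (monic_X_pow_add_C 1 two_ne_zero)).symm
    simp [hz]
  have h : IsConjRoot R (-imagUnit R) (imagUnit R) := by
    rw [IsConjRoot, hmin _ (imagUnit_sq R), hmin _ (by rw [neg_sq, imagUnit_sq])]
  obtain ⟨σ, hσ⟩ := isConjRoot_iff_exists_algEquiv.mp h
  exact ⟨σ, hσ⟩

variable (R) in
/-- Complex conjugation of `R[i]`. -/
def conjEquiv : AlgebraicClosure R ≃ₐ[R] AlgebraicClosure R := (exists_conj R).choose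

theorem conjEquiv_mkComplex (a b : R) : conjEquiv R (mkComplex a b) = mkComplex a (-b) := by
  simp [mkComplex, conjEquiv, (exists_conj R).choose_spec]

@[simp] theorem rePart_conjEquiv (z : AlgebraicClosure R) :
    rePart (conjEquiv R z) = rePart z := by
  conv_lhs => rw [← mkComplex_re_im z, conjEquiv_mkComplex, rePart_mkComplex]

@[simp] theorem imPart_conjEquiv (z : AlgebraicClosure R) :
    imPart (conjEquiv R z) = -imPart z := by
  conv_lhs => rw [← mkComplex_re_im z, conjEquiv_mkComplex, imPart_mkComplex]

@[simp] theorem conjEquiv_conjEquiv (z : AlgebraicClosure R) :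
    conjEquiv R (conjEquiv R z) = z := by
  conv_lhs => rw [← mkComplex_re_im z, conjEquiv_mkComplex, conjEquiv_mkComplex, neg_neg,
    mkComplex_re_im]

theorem aeval_conjEquiv (f : R[X]) (z : AlgebraicClosure R) :
    aeval (conjEquiv R z) f = conjEquiv R (aeval z f) :=
  aeval_algHom_apply (conjEquiv R).toAlgHom z f

/-! ### Polynomials over a real closed field -/

/-- Every polynomial over a real closed field is a product of constants, linear polynomials and
quadratic polynomials `(X - a) ^ 2 + b ^ 2` with `b ≠ 0`. -/
theorem polynomial_induction_of_isRealClosed {P : R[X] → Prop} (hC : ∀ c, P (C c))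
    (hlin : ∀ a f, f ≠ 0 → P f → P ((X - C a) * f))
    (hquad : ∀ a b f, b ≠ 0 → f ≠ 0 → P f → P (((X - C a) ^ 2 + C b ^ 2) * f)) (f : R[X]) :
    P f := by
  induction hd : f.natDegree using Nat.strong_induction_on generalizing f with
  | _ d ih =>
    subst hd
    by_cases h0 : f.natDegree = 0
    · rw [eq_C_of_natDegree_eq_zero h0]; exact hC _
    have hf : f ≠ 0 := by rintro rfl; simp at h0
    obtain ⟨z, hz⟩ := IsAlgClosed.exists_aeval_eq_zero (AlgebraicClosure R) f
      (by rw [degree_eq_natDegree hf]; exact_mod_cast h0)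
    by_cases hb : imPart z = 0
    · rw [eq_algebraMap_of_imPart_eq_zero hb, aeval_algebraMap_apply,
        map_eq_zero_iff _ (algebraMap R (AlgebraicClosure R)).injective] at hz
      obtain ⟨g, rfl⟩ := dvd_iff_isRoot.mpr hz
      have hg : g ≠ 0 := right_ne_zero_of_mul hf
      refine hlin _ _ hg (ih _ ?_ g rfl)
      rw [natDegree_mul (X_sub_C_ne_zero _) hg, natDegree_X_sub_C]
      omega
    · set q : R[X] := (X - C (rePart z)) ^ 2 + C (imPart z) ^ 2 with hq
      have hq2 : q.natDegree = 2 := by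
        rw [hq, ← C_pow, natDegree_add_C, natDegree_pow, natDegree_X_sub_C]
      have hq0 : q ≠ 0 := by intro h; simp [h] at hq2
      have hirr : Irreducible q := by
        rw [irreducible_iff_roots_eq_zero_of_degree_le_three (by omega) (by omega)]
        refine Multiset.eq_zero_of_forall_notMem fun x hx => ?_
        have := (mem_roots'.mp hx).2
        simp only [hq, IsRoot, eval_add, eval_pow, eval_X, eval_C, eval_sub] at this
        exact (add_sq_pos_of_ne_zero (x - rePart z) hb).ne' this
      have hqz : aeval z q = 0 := by
        conv_lhs => rw [← mkComplex_re_im z]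
        simp only [hq, mkComplex, map_add, map_pow, map_sub, aeval_X, aeval_C]
        linear_combination (algebraMap R (AlgebraicClosure R) (imPart z)) ^ 2 * imagUnit_sq R
      have hdvd : q ∣ f := by
        have h2 : Associated (minpoly R z) q :=
          (minpoly.irreducible (Algebra.IsIntegral.isIntegral z)).associated_of_dvd hirr
            (minpoly.dvd R z hqz)
        exact h2.symm.dvd.trans (minpoly.dvd R z hz)
      obtain ⟨g, rfl⟩ := hdvd
      have hg : g ≠ 0 := right_ne_zero_of_mul hf
      refine hquad _ _ _ hb hg (ih _ ?_ g rfl)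
      rw [natDegree_mul hq0 hg]
      omega

/-- The intermediate value theorem for polynomials over a real closed field: a polynomial without
roots in `[u, v]` has the same sign at both ends. -/
theorem eval_mul_eval_pos_of_no_root {u v : R} (huv : u ≤ v) (f : R[X])
    (hf : ∀ x, u ≤ x → x ≤ v → f.eval x ≠ 0) : 0 < f.eval u * f.eval v := by
  induction f using polynomial_induction_of_isRealClosed with
  | hC c =>
    have := hf u le_rfl huv
    simp only [eval_C] at this ⊢
    exact mul_self_pos.mpr this
  | hlin a f _ ih =>
    have h1 : 0 < f.eval u * f.eval v := ih fun x hx hx' h => hf x hx hx' (by simp [h])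
    have h2 : 0 < (u - a) * (v - a) := by
      by_contra hneg
      refine hf a ?_ ?_ (by simp) <;> by_contra hlt <;> push Not at hlt
      · exact hneg (mul_pos (by linarith) (by linarith))
      · exact hneg (mul_pos_of_neg_of_neg (by linarith) (by linarith))
    simp only [eval_mul, eval_sub, eval_X, eval_C]
    nlinarith [mul_pos h2 h1]
  | hquad a b f hb _ ih =>
    have h1 : 0 < f.eval u * f.eval v := ih fun x hx hx' h => hf x hx hx' (by simp [h])
    simp only [eval_mul, eval_sub, eval_X, eval_C, eval_add, eval_pow]
    have := mul_pos (mul_pos (add_sq_pos_of_ne_zero (u - a) hb)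
      (add_sq_pos_of_ne_zero (v - a) hb)) h1
    linarith

/-- Away from its real roots, a polynomial of degree `d` grows like `(1 + |x|) ^ d`: the factor
`x - a` is comparable to `1 + |x|` as long as `x` stays away from `a`, and so is
`(x - a) ^ 2 + b ^ 2` to `(1 + |x|) ^ 2`, as `b ≠ 0`. -/
theorem exists_lower_bound_away_from_roots (f : R[X]) (hf : f ≠ 0) {ε : R} (hε : 0 < ε) :
    ∃ κ > 0, ∀ x : R, (∀ y, f.eval y = 0 → ε ≤ |x - y|) →
      κ * (1 + |x|) ^ f.natDegree ≤ |f.eval x| := by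
  have key (a δ : R) (hδ : 0 < δ) :
      ∃ κ > 0, ∀ x : R, δ ≤ |x - a| → κ * (1 + |x|) ≤ |x - a| := by
    refine ⟨δ / (1 + |a| + δ), by positivity, fun x hx => ?_⟩
    rw [div_mul_eq_mul_div, div_le_iff₀ (by positivity)]
    have h1 : |x| ≤ |a| + |x - a| := by
      calc |x| = |a + (x - a)| := by ring_nf
        _ ≤ _ := abs_add_le _ _
    nlinarith [abs_nonneg a, abs_nonneg (x - a)]
  induction f using polynomial_induction_of_isRealClosed with
  | hC c => exact ⟨|c|, by simpa using hf, fun x _ => by simp⟩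
  | hlin a f hf' ih =>
    obtain ⟨κ, hκ, h⟩ := ih hf'
    obtain ⟨κ', hκ', h'⟩ := key a ε hε
    refine ⟨κ' * κ, by positivity, fun x hx => ?_⟩
    have h1 := h x fun y hy => hx y (by simp [hy])
    have h2 := h' x (hx a (by simp))
    rw [natDegree_mul (X_sub_C_ne_zero _) hf', natDegree_X_sub_C, eval_mul, abs_mul, pow_add,
      pow_one]
    calc κ' * κ * ((1 + |x|) * (1 + |x|) ^ f.natDegree)
        = (κ' * (1 + |x|)) * (κ * (1 + |x|) ^ f.natDegree) := by ring
      _ ≤ _ := by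
        simp only [eval_sub, eval_X, eval_C]
        exact mul_le_mul h2 h1 (by positivity) (abs_nonneg _)
  | hquad a b f hb hf' ih =>
    obtain ⟨κ, hκ, h⟩ := ih hf'
    obtain ⟨κ', hκ', h'⟩ := key a |b| (abs_pos.mpr hb)
    have hq : ∃ κ'' > 0, ∀ x : R, κ'' * (1 + |x|) ^ 2 ≤ (x - a) ^ 2 + b ^ 2 := by
      refine ⟨min (κ' ^ 2) ((|b| / (1 + |a| + |b|)) ^ 2), by positivity, fun x => ?_⟩
      rcases le_total |b| |x - a| with hx | hx
      · calc _ ≤ κ' ^ 2 * (1 + |x|) ^ 2 := by gcongr; exact min_le_left _ _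
          _ = (κ' * (1 + |x|)) ^ 2 := by ring
          _ ≤ |x - a| ^ 2 := by gcongr; exact h' x hx
          _ ≤ _ := by rw [sq_abs]; nlinarith [sq_nonneg b]
      · have h1 : |x| ≤ |a| + |x - a| := by
          calc |x| = |a + (x - a)| := by ring_nf
            _ ≤ _ := abs_add_le _ _
        have hb' : 0 < |b| := abs_pos.mpr hb
        calc _ ≤ (|b| / (1 + |a| + |b|)) ^ 2 * (1 + |x|) ^ 2 := by
              gcongr; exact min_le_right _ _
          _ ≤ (|b| / (1 + |a| + |b|)) ^ 2 * (1 + |a| + |b|) ^ 2 := by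
              gcongr ?_ * ?_ ^ 2; linarith
          _ = |b| ^ 2 := by field_simp
          _ ≤ _ := by rw [sq_abs]; nlinarith [sq_nonneg (x - a)]
    obtain ⟨κ'', hκ'', h''⟩ := hq
    refine ⟨κ'' * κ, by positivity, fun x hx => ?_⟩
    have h1 := h x fun y hy => hx y (by simp [hy])
    have hq2 : ((X - C a) ^ 2 + C b ^ 2 : R[X]).natDegree = 2 := by
      rw [← C_pow, natDegree_add_C, natDegree_pow, natDegree_X_sub_C]
    have hq0 : ((X - C a) ^ 2 + C b ^ 2 : R[X]) ≠ 0 := by intro h; simp [h] at hq2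
    rw [natDegree_mul hq0 hf', hq2, eval_mul, abs_mul, pow_add]
    calc κ'' * κ * ((1 + |x|) ^ 2 * (1 + |x|) ^ f.natDegree)
        = (κ'' * (1 + |x|) ^ 2) * (κ * (1 + |x|) ^ f.natDegree) := by ring
      _ ≤ _ := by
        simp only [eval_sub, eval_X, eval_C, eval_add, eval_pow]
        refine mul_le_mul ((h'' x).trans (le_abs_self _)) h1 (by positivity) (abs_nonneg _)

end RealClosed

/-! ### Traces in `A[X] / (f)` as sums over roots -/

section Trace

/-- If `f = ∏ (X - z)` is the characteristic polynomial of `M`, then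
`det p(M) = ∏ p(z)`: both sides are multiplicative in `p`. -/
theorem det_aeval_eq_prod_roots {L ι : Type*} [Field L] [IsAlgClosed L] [Fintype ι] [DecidableEq ι]
    (M : Matrix ι ι L) (p : L[X]) :
    (aeval M p).det = (M.charpoly.roots.map fun z => p.eval z).prod := by
  have hcard : M.charpoly.roots.card = Fintype.card ι := by
    rw [← M.charpoly_natDegree_eq_dim, (IsAlgClosed.splits M.charpoly).natDegree_eq_card_roots]
  have hlin (β : L) : (aeval M (X - C β)).det =
      (M.charpoly.roots.map fun z => (X - C β).eval z).prod := by
    have h1 : M.charpoly.eval β = (M.charpoly.roots.map fun z => β - z).prod := by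
      conv_lhs => rw [(IsAlgClosed.splits M.charpoly).eq_prod_roots_of_monic M.charpoly_monic]
      simp [eval_multiset_prod]
    have h2 : aeval M (X - C β) = -(algebraMap L _ β - M) := by simp
    have h3 : (algebraMap L (Matrix ι ι L) β - M).det = M.charpoly.eval β :=
      (Matrix.eval_charpoly M β).symm
    rw [h2, Matrix.det_neg, h3, h1, ← hcard, ← Multiset.card_map (fun z => β - z),
      ← Multiset.prod_map_neg]
    simp
  rw [(IsAlgClosed.splits p).eq_prod_roots]
  generalize p.leadingCoeff = c
  generalize p.roots = s
  rw [map_mul, Matrix.det_mul]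
  have hc : (aeval M (C c)).det = c ^ Fintype.card ι := by
    rw [aeval_C, Matrix.algebraMap_eq_diagonal, Matrix.det_diagonal]
    simp
  induction s using Multiset.induction_on with
  | empty =>
    rw [Multiset.map_zero, Multiset.prod_zero, map_one, Matrix.det_one, mul_one, hc]
    simp [hcard]
  | cons β s ih =>
    rw [Multiset.map_cons, Multiset.prod_cons, map_mul, Matrix.det_mul, mul_left_comm, ih, hlin,
      ← Multiset.prod_map_mul]
    congr 1
    refine Multiset.map_congr rfl fun z _ => ?_
    simp only [eval_mul]
    ring

/-- The characteristic polynomial of `p(M)` has the roots `p(z)`, for `z` the roots of the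
characteristic polynomial of `M`. -/
theorem trace_aeval_eq_sum_roots {L ι : Type*} [Field L] [IsAlgClosed L] [Fintype ι]
    [DecidableEq ι] (M : Matrix ι ι L) (p : L[X]) :
    (aeval M p).trace = (M.charpoly.roots.map fun z => p.eval z).sum := by
  have h : (aeval M p).charpoly =
      ((M.charpoly.roots.map fun z => p.eval z).map fun w => X - C w).prod := by
    refine funext fun t => ?_
    rw [Matrix.eval_charpoly]
    have h1 : Matrix.scalar ι t - aeval M p = aeval M (C t - p) := by
      rw [map_sub, aeval_C]; rfl
    rw [h1, det_aeval_eq_prod_roots, eval_multiset_prod]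
    simp
  rw [Matrix.trace_eq_sum_roots_charpoly, h, roots_multiset_prod_X_sub_C]

/-- The trace in terms of remainders modulo `f`, a formula compatible with base change. -/
theorem trace_adjoinRoot_eq_sum_coeff {A : Type*} [CommRing A] {f : A[X]} (hf : f.Monic)
    (q : A[X]) : Algebra.trace A (AdjoinRoot f) (AdjoinRoot.mk f q) =
      ∑ i : Fin f.natDegree, ((q * X ^ (i : ℕ)) %ₘ f).coeff i := by
  nontriviality A
  rw [Algebra.trace_eq_matrix_trace (AdjoinRoot.powerBasisAux' hf), Matrix.trace]
  refine Finset.sum_congr rfl fun i _ => ?_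
  rw [Matrix.diag_apply, Algebra.leftMulMatrix_eq_repr_mul]
  have h1 : AdjoinRoot.powerBasisAux' hf i = AdjoinRoot.mk f (X ^ (i : ℕ)) := by
    rw [map_pow, AdjoinRoot.mk_X]
    exact (AdjoinRoot.powerBasis' hf).basis_eq_pow i
  rw [h1, ← map_mul, AdjoinRoot.powerBasisAux'_repr_apply_to_fun, AdjoinRoot.modByMonicHom_mk]

/-- The trace of `q` in `A[X] / (f)`, specialized along `φ : A → L` to an algebraically closed
field, is the sum of the values of `q` at the roots of `f`, counted with multiplicity. -/
theorem map_trace_adjoinRoot {A L : Type*} [CommRing A] [Field L] [IsAlgClosed L] {f : A[X]}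
    (hf : f.Monic) (φ : A →+* L) (q : A[X]) :
    φ (Algebra.trace A (AdjoinRoot f) (AdjoinRoot.mk f q)) =
      ((f.map φ).roots.map fun z => (q.map φ).eval z).sum := by
  have hf' : (f.map φ).Monic := hf.map φ
  have h1 : φ (Algebra.trace A (AdjoinRoot f) (AdjoinRoot.mk f q)) =
      Algebra.trace L (AdjoinRoot (f.map φ)) (AdjoinRoot.mk (f.map φ) (q.map φ)) := by
    rw [trace_adjoinRoot_eq_sum_coeff hf, trace_adjoinRoot_eq_sum_coeff hf', map_sum]
    refine Fintype.sum_equiv (finCongr (hf.natDegree_map φ).symm) _ _ fun i => ?_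
    rw [← coeff_map, map_modByMonic _ hf]
    simp
  rw [h1]
  let pb := AdjoinRoot.powerBasis' hf'
  have hchar : (Algebra.leftMulMatrix pb.basis pb.gen).charpoly = f.map φ := by
    rw [charpoly_leftMulMatrix, AdjoinRoot.powerBasis'_gen,
      AdjoinRoot.minpoly_root hf'.ne_zero, hf'.leadingCoeff, inv_one, C_1, mul_one]
  have h2 : AdjoinRoot.mk (f.map φ) (q.map φ) = aeval pb.gen (q.map φ) := by
    rw [AdjoinRoot.powerBasis'_gen, AdjoinRoot.aeval_eq]
  have h3 := trace_aeval_eq_sum_roots (Algebra.leftMulMatrix pb.basis pb.gen) (q.map φ)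
  rw [hchar] at h3
  rw [← h3, Algebra.trace_eq_matrix_trace pb.basis, h2, aeval_algHom_apply]

end Trace

/-! ### The rank of Hermite forms -/

section HermiteRank

/-- The rank of a matrix over a field does not change under field extension. -/
theorem rank_map_algebraMap {K L ι : Type*} [Field K] [Field L] [Algebra K L] [Fintype ι]
    [DecidableEq ι] (M : Matrix ι ι K) : (M.map (algebraMap K L)).rank = M.rank := by
  classical
  obtain ⟨T, T', D, h⟩ := Matrix.Pivot.exists_list_transvec_mul_diagonal_mul_list_transvec M
  have hdet (l : List (Matrix.TransvectionStruct ι K)) :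
      (l.map Matrix.TransvectionStruct.toMatrix).prod.det = 1 :=
    Matrix.TransvectionStruct.det_toMatrix_prod l
  generalize hA : (T.map Matrix.TransvectionStruct.toMatrix).prod = A at h
  generalize hB : (T'.map Matrix.TransvectionStruct.toMatrix).prod = B at h
  have hA1 : A.det = 1 := hA ▸ hdet T
  have hB1 : B.det = 1 := hB ▸ hdet T'
  have hmap (N : Matrix ι ι K) (hN : N.det = 1) : IsUnit (N.map (algebraMap K L)).det := by
    have : (N.map (algebraMap K L)).det = algebraMap K L N.det :=
      (RingHom.map_det (algebraMap K L) N).symm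
    rw [this, hN, map_one]
    exact isUnit_one
  rw [h, Matrix.rank_mul_eq_left_of_isUnit_det _ _ (hB1 ▸ isUnit_one),
    Matrix.rank_mul_eq_right_of_isUnit_det _ _ (hA1 ▸ isUnit_one), Matrix.map_mul, Matrix.map_mul,
    Matrix.rank_mul_eq_left_of_isUnit_det _ _ (hmap B hB1),
    Matrix.rank_mul_eq_right_of_isUnit_det _ _ (hmap A hA1), Matrix.diagonal_map (map_zero _),
    Matrix.rank_diagonal, Matrix.rank_diagonal]
  simp

/-- The Vandermonde matrix of at most `s` points has a right inverse, given by Lagrange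
interpolation. -/
theorem exists_rightInverse_vandermonde {L : Type*} [Field L] [DecidableEq L] (Z : Finset L) {s : ℕ}
    (hs : Z.card ≤ s) : ∃ W : Matrix (Fin s) Z L,
      (Matrix.of fun (z : Z) (i : Fin s) => (z : L) ^ (i : ℕ)) * W = 1 := by
  refine ⟨Matrix.of fun i z => (Lagrange.basis Z id (z : L)).coeff i, ?_⟩
  ext z' z
  have hdeg : (Lagrange.basis Z id (z : L)).natDegree < s := by
    rw [Lagrange.natDegree_basis Function.injective_id.injOn z.2]
    have := Finset.card_pos.mpr ⟨_, z.2⟩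
    omega
  have h1 := eval_eq_sum_range' hdeg (z' : L)
  rw [Finset.sum_range] at h1
  rw [Matrix.mul_apply]
  simp only [Matrix.of_apply]
  rw [Finset.sum_congr rfl fun i _ => mul_comm _ _, ← h1]
  by_cases h : z' = z
  · subst h
    rw [Matrix.one_apply_eq]
    exact Lagrange.eval_basis_self Function.injective_id.injOn z'.2
  · rw [Matrix.one_apply_ne h]
    exact Lagrange.eval_basis_of_ne (v := id) (fun h' => h (Subtype.ext h'.symm)) z'.2

/-- The Hankel matrix of weighted power sums factors as `Vᵀ D V`, with `V` the Vandermonde matrix of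
the points and `D` the diagonal matrix of the weights. -/
theorem rank_hankel {L : Type*} [Field L] [DecidableEq L] (Z : Finset L) {s : ℕ}
    (hs : Z.card ≤ s) (d : L → L) :
    (Matrix.of fun i j : Fin s => ∑ z ∈ Z, d z * z ^ ((i : ℕ) + j)).rank =
      (Z.filter fun z => d z ≠ 0).card := by
  obtain ⟨W, hW⟩ := exists_rightInverse_vandermonde Z hs
  set V : Matrix Z (Fin s) L := Matrix.of fun (z : Z) (i : Fin s) => (z : L) ^ (i : ℕ)
  set D : Matrix Z Z L := Matrix.diagonal fun z => d z
  have hH : (Matrix.of fun i j : Fin s => ∑ z ∈ Z, d z * z ^ ((i : ℕ) + j)) =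
      V.transpose * D * V := by
    ext i j
    rw [Matrix.mul_apply]
    simp only [D, V, Matrix.mul_diagonal, Matrix.transpose_apply, Matrix.of_apply]
    rw [← Finset.sum_coe_sort]
    exact Finset.sum_congr rfl fun z _ => by ring
  rw [hH]
  have h1 : (V.transpose * D * V).rank ≤ D.rank :=
    (Matrix.rank_mul_le_left _ _).trans (Matrix.rank_mul_le_right _ _)
  have h2 : D.rank ≤ (V.transpose * D * V).rank := by
    have h3 : D = W.transpose * (V.transpose * D * V) * W := by
      calc D = (V * W).transpose * D * (V * W) := by rw [hW]; simp
        _ = _ := by rw [Matrix.transpose_mul]; simp only [Matrix.mul_assoc]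
    conv_lhs => rw [h3]
    exact (Matrix.rank_mul_le_left _ _).trans (Matrix.rank_mul_le_right _ _)
  rw [le_antisymm h1 h2, Matrix.rank_diagonal, Fintype.card_subtype]
  refine Finset.card_bij (fun z _ => (z : L)) (fun z hz => ?_) (fun _ _ _ _ h => Subtype.ext h)
    fun z hz => ?_
  · simpa using hz
  · rw [Finset.mem_filter] at hz
    exact ⟨⟨z, hz.1⟩, by simpa using hz.2, rfl⟩

/-- Sums over roots with multiplicity as weighted sums over distinct roots. -/
theorem sum_map_roots_eq_sum_toFinset {L : Type*} [Field L] [DecidableEq L] (s : Multiset L)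
    (u : L → L) : (s.map u).sum = ∑ z ∈ s.toFinset, (s.count z : L) * u z := by
  rw [Finset.sum_multiset_map_count]
  simp [nsmul_eq_mul]

/-- The rank of a symmetric matrix over an ordered field can be read off from its characteristic
polynomial, as `0` is a semisimple eigenvalue. -/
theorem natTrailingDegree_charpoly_add_rank {K : Type*} [Field K] [LinearOrder K]
    [IsStrictOrderedRing K] {ι : Type*} [Fintype ι] [DecidableEq ι] (M : Matrix ι ι K)
    (hM : M.transpose = M) : M.charpoly.natTrailingDegree + M.rank = Fintype.card ι := by
  have hker : ∀ v, M.mulVec (M.mulVec v) = 0 → M.mulVec v = 0 := by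
    intro v hv
    have h1 : v ∈ LinearMap.ker (M.transpose * M).mulVecLin := by
      rw [hM, LinearMap.mem_ker, Matrix.mulVecLin_apply, ← Matrix.mulVec_mulVec, hv]
    rw [Matrix.ker_mulVecLin_transpose_mul_self] at h1
    exact h1
  have hpow : ∀ k v, ((M.mulVecLin) ^ k) v = 0 → M.mulVec v = 0 := by
    intro k
    induction k with
    | zero => intro v hv; rw [show v = 0 by simpa using hv, Matrix.mulVec_zero]
    | succ k ih =>
      intro v hv
      rw [pow_succ, Module.End.mul_apply] at hv
      exact hker v (ih _ hv)
  have h1 : Module.End.maxGenEigenspace M.mulVecLin 0 = LinearMap.ker M.mulVecLin := by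
    ext v
    rw [Module.End.mem_maxGenEigenspace, LinearMap.mem_ker]
    simp only [zero_smul, sub_zero]
    exact ⟨fun ⟨k, hk⟩ => hpow k v hk, fun h => ⟨1, by simpa using h⟩⟩
  have h2 := LinearMap.finrank_maxGenEigenspace_zero_eq M.mulVecLin
  have h3 : M.mulVecLin.charpoly = M.charpoly := by
    rw [← Matrix.toLin'_apply', Matrix.charpoly_toLin']
  rw [h1, h3] at h2
  have h4 := M.mulVecLin.finrank_range_add_finrank_ker
  rw [Module.finrank_fintype_fun_eq_card] at h4
  rw [← h2, Matrix.rank, ← h4, add_comm]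

theorem rank_eq_iff_charpoly_coeff {K : Type*} [Field K] [LinearOrder K]
    [IsStrictOrderedRing K] {s : ℕ} (M : Matrix (Fin s) (Fin s) K)
    (hM : M.transpose = M) {r : ℕ} (hr : r ≤ s) :
    M.rank = r ↔ (∀ j < s - r, M.charpoly.coeff j = 0) ∧ M.charpoly.coeff (s - r) ≠ 0 := by
  have h := natTrailingDegree_charpoly_add_rank M hM
  rw [Fintype.card_fin] at h
  have h0 : M.charpoly ≠ 0 := M.charpoly_monic.ne_zero
  constructor
  · intro hrank
    have h1 : s - r = M.charpoly.natTrailingDegree := by omega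
    rw [h1]
    exact ⟨fun j hj => coeff_eq_zero_of_lt_natTrailingDegree hj,
      trailingCoeff_nonzero_iff_nonzero.mpr h0⟩
  · rintro ⟨h1, h2⟩
    have h3 := natTrailingDegree_le_of_ne_zero h2
    have h4 : ¬ M.charpoly.natTrailingDegree < s - r := fun hlt =>
      trailingCoeff_nonzero_iff_nonzero.mpr h0 (h1 _ hlt)
    omega

end HermiteRank

/-! ### Gröbner bases for the block order -/

section Groebner

variable {k : Type*} [Field k] {n : ℕ}

/-- The coefficient of the monomial `x ^ e.1 * y ^ e.2`. -/
def termCoeff (f : PolyYX k n) (e : ℕ × (Fin n →₀ ℕ)) : k := (f.coeff e.1).coeff e.2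

/-- The monomial `a * x ^ e.1 * y ^ e.2`. -/
def term (e : ℕ × (Fin n →₀ ℕ)) (a : k) : PolyYX k n :=
  Polynomial.monomial e.1 (MvPolynomial.monomial e.2 a)

/-- The embedding of the exponents into a well-ordered type which defines the block order. -/
def blockKey (m : MonomialOrder (Fin n)) (e : ℕ × (Fin n →₀ ℕ)) : ℕ ×ₗ m.syn :=
  toLex (e.1, m.toSyn e.2)

theorem blockKey_injective (m : MonomialOrder (Fin n)) : Function.Injective (blockKey m) := by
  intro a b h
  have h' := toLex.injective h
  rw [Prod.mk.injEq] at h'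
  exact Prod.ext h'.1 (m.toSyn.injective h'.2)

theorem blockKey_add_le_add {m : MonomialOrder (Fin n)} {a b : ℕ × (Fin n →₀ ℕ)}
    (e : ℕ × (Fin n →₀ ℕ)) (h : blockKey m a ≤ blockKey m b) :
    blockKey m (e + a) ≤ blockKey m (e + b) := by
  simp only [blockKey, Prod.Lex.toLex_le_toLex, Prod.fst_add, Prod.snd_add, map_add] at h ⊢
  rcases h with h | ⟨h1, h2⟩
  · exact Or.inl (by omega)
  · exact Or.inr ⟨by omega, by gcongr⟩

theorem termCoeff_sub (f g : PolyYX k n) (e) :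
    termCoeff (f - g) e = termCoeff f e - termCoeff g e := by
  simp [termCoeff]

theorem termCoeff_add (f g : PolyYX k n) (e) :
    termCoeff (f + g) e = termCoeff f e + termCoeff g e := by
  simp [termCoeff]

theorem termCoeff_term_mul (e : ℕ × (Fin n →₀ ℕ)) (a : k) (f : PolyYX k n) (e') :
    termCoeff (term e a * f) (e + e') = a * termCoeff f e' := by
  simp only [termCoeff, term, Prod.fst_add, Prod.snd_add]
  rw [add_comm e.1, coeff_monomial_mul, MvPolynomial.coeff_monomial_mul]

theorem exists_of_termCoeff_term_mul_ne_zero {e : ℕ × (Fin n →₀ ℕ)} {a : k} {f : PolyYX k n}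
    {e'} (h : termCoeff (term e a * f) e' ≠ 0) : ∃ e'', e' = e + e'' ∧ termCoeff f e'' ≠ 0 := by
  by_cases h1 : e.1 ≤ e'.1
  · by_cases h2 : e.2 ≤ e'.2
    · refine ⟨e' - e, (add_tsub_cancel_of_le (show e ≤ e' from ⟨h1, h2⟩)).symm, fun h0 => h ?_⟩
      conv_lhs => rw [← add_tsub_cancel_of_le (show e ≤ e' from ⟨h1, h2⟩), termCoeff_term_mul, h0,
        mul_zero]
    · refine absurd ?_ h
      obtain ⟨j, hj⟩ := Nat.exists_eq_add_of_le h1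
      rw [termCoeff, term, hj, add_comm, coeff_monomial_mul, MvPolynomial.coeff_monomial_mul',
        if_neg h2]
  · refine absurd ?_ h
    rw [termCoeff, term, ← C_mul_X_pow_eq_monomial, mul_assoc, coeff_C_mul, coeff_X_pow_mul',
      if_neg h1, mul_zero, MvPolynomial.coeff_zero]

theorem termCoeff_term (e : ℕ × (Fin n →₀ ℕ)) (a : k) (e') :
    termCoeff (term e a) e' = if e' = e then a else 0 := by
  classical
  rw [termCoeff, term, Polynomial.coeff_monomial]
  split_ifs with h1 h2 h2
  · rw [h2, MvPolynomial.coeff_monomial, if_pos rfl]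
  · rw [MvPolynomial.coeff_monomial, if_neg]
    exact fun h => h2 (Prod.ext h1.symm h.symm)
  · exact absurd (by rw [h2]) h1
  · simp

theorem termCoeff_leadingExp (m : MonomialOrder (Fin n)) (f : PolyYX k n) :
    termCoeff f (leadingExp m f) = m.leadingCoeff f.leadingCoeff := rfl

theorem termCoeff_leadingExp_ne_zero (m : MonomialOrder (Fin n)) {f : PolyYX k n} (hf : f ≠ 0) :
    termCoeff f (leadingExp m f) ≠ 0 := by
  rw [termCoeff_leadingExp]
  exact m.leadingCoeff_ne_zero_iff.mpr (leadingCoeff_ne_zero.mpr hf)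

theorem blockKey_le_leadingExp (m : MonomialOrder (Fin n)) {f : PolyYX k n} {e}
    (h : termCoeff f e ≠ 0) : blockKey m e ≤ blockKey m (leadingExp m f) := by
  have h1 : f.coeff e.1 ≠ 0 := fun h0 => h (by rw [termCoeff, h0, MvPolynomial.coeff_zero])
  simp only [blockKey, leadingExp, Prod.Lex.toLex_le_toLex]
  rcases (le_natDegree_of_ne_zero h1).lt_or_eq with h2 | h2
  · exact Or.inl h2
  · refine Or.inr ⟨h2, m.le_degree ?_⟩
    rw [MvPolynomial.mem_support_iff, leadingCoeff, ← h2]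
    exact h

theorem leadingExp_eq_of_forall_le (m : MonomialOrder (Fin n)) {f : PolyYX k n} {e}
    (h : termCoeff f e ≠ 0) (hle : ∀ e', termCoeff f e' ≠ 0 → blockKey m e' ≤ blockKey m e) :
    leadingExp m f = e := by
  have hf : f ≠ 0 := by rintro rfl; simp [termCoeff] at h
  exact blockKey_injective m
    ((hle _ (termCoeff_leadingExp_ne_zero m hf)).antisymm (blockKey_le_leadingExp m h))

theorem leadingExp_term_mul (m : MonomialOrder (Fin n)) {f : PolyYX k n} (hf : f ≠ 0) {a : k}
    (ha : a ≠ 0) (e) : leadingExp m (term e a * f) = e + leadingExp m f := by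
  refine leadingExp_eq_of_forall_le m ?_ fun e' he' => ?_
  · rw [termCoeff_term_mul]
    exact mul_ne_zero ha (termCoeff_leadingExp_ne_zero m hf)
  · obtain ⟨e'', rfl, h⟩ := exists_of_termCoeff_term_mul_ne_zero he'
    exact blockKey_add_le_add e (blockKey_le_leadingExp m h)

/-- Cancelling the leading term of `f` by a polynomial without larger terms makes the leading
exponent drop. -/
theorem blockKey_sub_lt (m : MonomialOrder (Fin n)) {f g : PolyYX k n}
    (hg : ∀ e, termCoeff g e ≠ 0 → blockKey m e ≤ blockKey m (leadingExp m f))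
    (hlead : termCoeff g (leadingExp m f) = termCoeff f (leadingExp m f)) (hne : f - g ≠ 0) :
    blockKey m (leadingExp m (f - g)) < blockKey m (leadingExp m f) := by
  have h := termCoeff_leadingExp_ne_zero m hne
  refine lt_of_le_of_ne ?_ fun heq => h ?_
  · by_contra hlt
    rw [termCoeff_sub] at h
    by_cases h1 : termCoeff f (leadingExp m (f - g)) = 0
    · exact hlt (hg _ fun h2 => h (by rw [h1, h2, sub_zero]))
    · exact hlt (blockKey_le_leadingExp m h1)
  · rw [blockKey_injective m heq, termCoeff_sub, hlead, sub_self]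

/-- The reduction step of multivariate division: if the leading monomial of `g` divides that of
`f`, then subtracting a multiple of `g` lowers the leading exponent of `f`. -/
theorem exists_sub_term_mul_lt (m : MonomialOrder (Fin n)) {f g : PolyYX k n} (hg : g ≠ 0)
    (hle : leadingExp m g ≤ leadingExp m f) : ∃ e a, f - term e a * g ≠ 0 →
      blockKey m (leadingExp m (f - term e a * g)) < blockKey m (leadingExp m f) := by
  obtain ⟨e, he⟩ : ∃ e, leadingExp m f = e + leadingExp m g :=
    ⟨_, (tsub_add_cancel_of_le hle).symm⟩
  refine ⟨e, termCoeff f (leadingExp m f) / termCoeff g (leadingExp m g),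
    blockKey_sub_lt m (fun e' he' => ?_) ?_⟩
  · obtain ⟨e'', rfl, h⟩ := exists_of_termCoeff_term_mul_ne_zero he'
    rw [he]
    exact blockKey_add_le_add e (blockKey_le_leadingExp m h)
  · conv_lhs => rw [he, termCoeff_term_mul, ← he]
    exact div_mul_cancel₀ _ (termCoeff_leadingExp_ne_zero m hg)

/-- Noetherian induction on the leading exponent. -/
theorem induction_on_leadingExp (m : MonomialOrder (Fin n)) {P : PolyYX k n → Prop}
    (h0 : P 0) (h : ∀ f, f ≠ 0 → (∀ f', (f' ≠ 0 →
      blockKey m (leadingExp m f') < blockKey m (leadingExp m f)) → P f') → P f) (f) : P f := by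
  suffices H : ∀ (K : ℕ ×ₗ m.syn) f, f ≠ 0 → blockKey m (leadingExp m f) = K → P f by
    by_cases hf : f = 0
    · exact hf ▸ h0
    · exact H _ f hf rfl
  intro K
  induction K using WellFoundedLT.induction with
  | _ K ih =>
    rintro f hf rfl
    refine h f hf fun f' hf' => ?_
    by_cases h' : f' = 0
    · exact h' ▸ h0
    · exact ih _ (hf' h') f' h' rfl

/-- Normal forms modulo an ideal `I`: if each exponent in `E` is the leading exponent of some
element of `I`, then every polynomial is congruent modulo `I` to one without monomials in `E`. -/
theorem exists_normalForm (m : MonomialOrder (Fin n)) (I : Ideal (PolyYX k n))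
    (E : Set (ℕ × (Fin n →₀ ℕ))) (hE : ∀ e ∈ E, ∃ g ∈ I, g ≠ 0 ∧ leadingExp m g = e)
    (f : PolyYX k n) : ∃ r, f - r ∈ I ∧ ∀ e, termCoeff r e ≠ 0 → e ∉ E := by
  induction f using induction_on_leadingExp m with
  | h0 => exact ⟨0, by simp, by simp [termCoeff]⟩
  | h f hf ih =>
    by_cases hmem : leadingExp m f ∈ E
    · obtain ⟨g, hgI, hg0, hg⟩ := hE _ hmem
      obtain ⟨e, a, hlt⟩ := exists_sub_term_mul_lt m hg0 hg.le
      obtain ⟨r, hr, hr'⟩ := ih _ hlt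
      refine ⟨r, ?_, hr'⟩
      have := I.add_mem hr (I.mul_mem_left (term e a) hgI)
      ring_nf at this ⊢
      exact this
    · obtain ⟨r, hr, hr'⟩ := ih (f - term (leadingExp m f) (termCoeff f (leadingExp m f)))
        (blockKey_sub_lt m (fun e he => by
          rw [termCoeff_term] at he
          rw [(ite_ne_right_iff.mp he).1]) (by rw [termCoeff_term, if_pos rfl]))
      refine ⟨r + term (leadingExp m f) (termCoeff f (leadingExp m f)), ?_, fun e he => ?_⟩
      · convert hr using 1; ring
      · by_cases h1 : e = leadingExp m f
        · rwa [h1]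
        · rw [termCoeff_add, termCoeff_term, if_neg h1, add_zero] at he
          exact hr' e he

/-- Every ideal has a reduced Gröbner basis.  By Dickson's lemma the leading exponents of the ideal
have finitely many minimal elements `e`; the basis consists of the differences of `x ^ e.1 * y ^ e.2`
and its normal form. -/
theorem exists_isReducedGroebnerBasis (m : MonomialOrder (Fin n)) (I : Ideal (PolyYX k n)) :
    ∃ G : Finset (PolyYX k n), IsReducedGroebnerBasis m G I := by
  classical
  set E : Set (ℕ × (Fin n →₀ ℕ)) := {e | ∃ f ∈ I, f ≠ 0 ∧ leadingExp m f = e} with hEdef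
  have hup : ∀ e ∈ E, ∀ e', e ≤ e' → e' ∈ E := by
    rintro _ ⟨f, hf, hf0, rfl⟩ e' hle
    refine ⟨term (e' - leadingExp m f) 1 * f, I.mul_mem_left _ hf, ?_, ?_⟩
    · intro h0
      have := termCoeff_term_mul (e' - leadingExp m f) 1 f (leadingExp m f)
      rw [h0, one_mul] at this
      exact termCoeff_leadingExp_ne_zero m hf0 (by rw [← this]; simp [termCoeff])
    · rw [leadingExp_term_mul m hf0 one_ne_zero, tsub_add_cancel_of_le hle]
  have hfin : {e | Minimal (· ∈ E) e}.Finite :=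
    WellQuasiOrderedLE.finite_of_isAntichain (setOfPred_minimal_antichain _)
  have hex : ∀ e, Minimal (· ∈ E) e →
      ∃ g ∈ I, termCoeff g e = 1 ∧ ∀ e', e' ≠ e → termCoeff g e' ≠ 0 → e' ∉ E := by
    intro e he
    obtain ⟨r, hr, hr'⟩ := exists_normalForm m I E (fun _ h => h) (term e 1)
    refine ⟨_, hr, ?_, fun e' hne h => ?_⟩
    · have h0 : termCoeff r e = 0 := by
        by_contra h
        exact hr' e h he.prop
      rw [termCoeff_sub, termCoeff_term, if_pos rfl, h0, sub_zero]
    · refine hr' e' fun h0 => h ?_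
      rw [termCoeff_sub, termCoeff_term, if_neg hne, h0, sub_zero]
  choose! g hgI hg1 hg2 using hex
  have hg0 : ∀ e, Minimal (· ∈ E) e → g e ≠ 0 := fun e he h0 => by
    have := hg1 e he
    rw [h0] at this
    simp [termCoeff] at this
  have hlead : ∀ e, Minimal (· ∈ E) e → leadingExp m (g e) = e := by
    intro e he
    by_contra hne
    exact hg2 e he _ hne (termCoeff_leadingExp_ne_zero m (hg0 e he)) ⟨_, hgI e he, hg0 e he, rfl⟩
  have hmin : ∀ e ∈ E, ∃ e', Minimal (· ∈ E) e' ∧ e' ≤ e := fun e he => by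
    obtain ⟨e', h1, h2⟩ := exists_minimal_le_of_wellFoundedLT (· ∈ E) e he
    exact ⟨e', h2, h1⟩
  have hspan : Ideal.span ((hfin.toFinset.image g : Finset (PolyYX k n)) : Set (PolyYX k n)) ≤ I := by
    rw [Ideal.span_le]
    intro f hf
    simp only [Finset.coe_image, Set.Finite.coe_toFinset, Set.mem_image, Set.mem_ofPred_eq] at hf
    obtain ⟨e, he, rfl⟩ := hf
    exact hgI e he
  refine ⟨hfin.toFinset.image g, ⟨hspan.antisymm fun f hf => ?_, fun f hf hf0 => ?_, ?_, ?_⟩⟩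
  · obtain ⟨r, hr, hr'⟩ := exists_normalForm m
      (Ideal.span ((hfin.toFinset.image g : Finset (PolyYX k n)) : Set (PolyYX k n))) E
      (fun e he => by
        obtain ⟨e', he', hle⟩ := hmin e he
        have hne : term (e - e') 1 * g e' ≠ 0 := fun h0 => by
          have := termCoeff_term_mul (e - e') 1 (g e') e'
          rw [h0, hg1 e' he'] at this
          simp [termCoeff] at this
        refine ⟨term (e - e') 1 * g e', Ideal.mul_mem_left _ _ (Ideal.subset_span ?_), hne, ?_⟩
        · simp only [Finset.coe_image, Set.Finite.coe_toFinset]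
          exact ⟨e', he', rfl⟩
        · rw [leadingExp_term_mul m (hg0 e' he') one_ne_zero, hlead e' he',
            tsub_add_cancel_of_le hle]) f
    have hrI : r ∈ I := by
      have := I.sub_mem hf (hspan hr)
      rwa [sub_sub_cancel] at this
    by_cases h0 : r = 0
    · rwa [h0, sub_zero] at hr
    · exact absurd ⟨r, hrI, h0, rfl⟩ (hr' _ (termCoeff_leadingExp_ne_zero m h0))
  · obtain ⟨e, he, hle⟩ := hmin _ ⟨f, hf, hf0, rfl⟩
    exact ⟨g e, Finset.mem_image_of_mem g (hfin.mem_toFinset.mpr he), (hlead e he).trans_le hle⟩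
  · intro f hf
    obtain ⟨e, he, rfl⟩ := Finset.mem_image.mp hf
    have he := hfin.mem_toFinset.mp he
    rw [← termCoeff_leadingExp, hlead e he, hg1 e he]
  · intro f hf f' hf' hne i α hcoeff hle
    obtain ⟨e, he, rfl⟩ := Finset.mem_image.mp hf
    obtain ⟨e', he', rfl⟩ := Finset.mem_image.mp hf'
    have he := hfin.mem_toFinset.mp he
    have he' := hfin.mem_toFinset.mp he'
    rw [hlead e' he'] at hle
    by_cases h1 : (i, α) = e
    · exact hne (by rw [he.eq_of_le he'.prop (h1 ▸ hle)])
    · exact hg2 e he _ h1 hcoeff (hup e' he'.prop _ hle)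

/-! ### Consequences of reducedness -/

variable {c : Input k n} {m : MonomialOrder (Fin n)} {G : Finset (PolyYX k n)}

theorem IsReducedGroebnerBasis.ne_zero {I : Ideal (PolyYX k n)}
    (hG : IsReducedGroebnerBasis m G I) {g : PolyYX k n} (hg : g ∈ G) : g ≠ 0 := by
  rintro rfl
  simpa using hG.monic _ hg

theorem IsReducedGroebnerBasis.mem {I : Ideal (PolyYX k n)}
    (hG : IsReducedGroebnerBasis m G I) {g : PolyYX k n} (hg : g ∈ G) : g ∈ I :=
  hG.span_eq ▸ Ideal.subset_span hg

theorem mem_nonBase {J : Ideal (MvPolynomial (Fin n) k)} {g : PolyYX k n} :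
    g ∈ nonBase J G ↔
      g ∈ G ∧ g ∉ (Polynomial.C : MvPolynomial (Fin n) k →+* PolyYX k n) '' J := by
  classical
  simp [nonBase]

/-- An element of the Gröbner basis of `x`-degree zero lies in `I ∩ k[y] = J`. -/
theorem Input.ReachesHermite.mem_base (hG : c.ReachesHermite m G) {g : PolyYX k n} (hg : g ∈ G)
    (hdeg : g.natDegree = 0) :
    g ∈ (Polynomial.C : MvPolynomial (Fin n) k →+* PolyYX k n) '' c.J := by
  refine ⟨g.coeff 0, ?_, (eq_C_of_natDegree_eq_zero hdeg).symm⟩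
  rw [← hG.elim_eq]
  show Polynomial.C (g.coeff 0) ∈ c.I
  rw [← eq_C_of_natDegree_eq_zero hdeg]
  exact hG.basis.mem hg

theorem Input.ReachesHermite.natDegree_pos (hG : c.ReachesHermite m G) {g : PolyYX k n}
    (hg : g ∈ nonBase c.J G) : 0 < g.natDegree := by
  rw [mem_nonBase] at hg
  exact Nat.pos_of_ne_zero fun h => hg.2 (hG.mem_base hg.1 h)

theorem Input.ReachesHermite.exists_natDegree_eq_sDeg (hG : c.ReachesHermite m G) :
    ∃ g ∈ nonBase c.J G, g.natDegree = sDeg c.J G := by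
  obtain ⟨g, hg, hrange⟩ := Set.not_subset.mp hG.not_subset
  have hne : (Polynomial.natDegree '' (nonBase c.J G : Set (PolyYX k n))).Nonempty :=
    ⟨_, g, Finset.mem_coe.mpr (mem_nonBase.mpr ⟨hg, fun ⟨a, _, ha⟩ => hrange ⟨a, ha⟩⟩), rfl⟩
  obtain ⟨g', hg', h⟩ := Nat.sInf_mem hne
  exact ⟨g', hg', h⟩

/-- By reducedness, the leading coefficients of the elements of `G \ J` do not lie in `J`. -/
theorem Input.ReachesHermite.leadingCoeff_notMem (hG : c.ReachesHermite m G) {g : PolyYX k n}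
    (hg : g ∈ nonBase c.J G) : g.leadingCoeff ∉ c.J := by
  intro hJ
  have hpos := hG.natDegree_pos hg
  rw [mem_nonBase] at hg
  have hlc : g.leadingCoeff ≠ 0 := leadingCoeff_ne_zero.mpr (hG.basis.ne_zero hg.1)
  have hI : Polynomial.C g.leadingCoeff ∈ c.I := by
    rw [← hG.elim_eq] at hJ
    exact hJ
  obtain ⟨g', hg', hle⟩ := hG.basis.leading _ hI (C_ne_zero.mpr hlc)
  have hdeg : g'.natDegree = 0 := by
    have := hle.1
    simpa [leadingExp] using this
  refine hG.basis.reduced g hg.1 g' hg' (fun h => ?_) g.natDegree (m.degree g.leadingCoeff)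
    (termCoeff_leadingExp_ne_zero m (hG.basis.ne_zero hg.1)) ⟨?_, ?_⟩
  · rw [h] at hdeg; omega
  · simp [leadingExp, hdeg]
  · simpa [leadingExp] using hle.2

theorem Input.ReachesHermite.wPoly_notMem (hG : c.ReachesHermite m G) [hJ : c.J.IsPrime] :
    wPoly c.J G ∉ c.J := by
  rw [wPoly, hJ.prod_mem_iff]
  rintro ⟨g, hg, h⟩
  exact hG.leadingCoeff_notMem hg h

/-- Elements of `I` of `x`-degree less than `s` reduce to zero modulo the elements of `G` in `J`. -/
theorem Input.ReachesHermite.coeff_mem_of_natDegree_lt (hG : c.ReachesHermite m G)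
    (f : PolyYX k n) : f ∈ c.I → f.natDegree < sDeg c.J G → ∀ i, f.coeff i ∈ c.J := by
  induction f using induction_on_leadingExp m with
  | h0 => intro _ _ i; simp
  | h f hf ih =>
    intro hfI hdeg i
    obtain ⟨g, hg, hle⟩ := hG.basis.leading f hfI hf
    have hgJ : g ∈ (Polynomial.C : MvPolynomial (Fin n) k →+* PolyYX k n) '' c.J := by
      by_contra hgJ
      have h1 : sDeg c.J G ≤ g.natDegree :=
        Nat.sInf_le ⟨g, Finset.mem_coe.mpr (mem_nonBase.mpr ⟨hg, hgJ⟩), rfl⟩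
      have h2 : g.natDegree ≤ f.natDegree := hle.1
      omega
    obtain ⟨j, hj, rfl⟩ := hgJ
    obtain ⟨e, a, hlt⟩ := exists_sub_term_mul_lt m (hG.basis.ne_zero hg) hle
    have hI' := c.I.sub_mem hfI (c.I.mul_mem_left (term e a) (hG.basis.mem hg))
    have h1 : (f - term e a * Polynomial.C j).natDegree ≤ f.natDegree := by
      by_cases h0 : f - term e a * Polynomial.C j = 0
      · rw [h0]; simp
      · have := hlt h0
        simp only [blockKey, leadingExp, Prod.Lex.toLex_lt_toLex] at this
        omega
    have h2 := ih _ hlt hI' (h1.trans_lt hdeg) i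
    rw [coeff_sub, coeff_mul_C] at h2
    have h3 := c.J.add_mem h2 (c.J.mul_mem_left ((term e a).coeff i) hj)
    rwa [sub_add_cancel] at h3

/-- Pseudo-division: after multiplication by a power of its leading coefficient, `I` is generated
by an element `g` of `G \ J` of minimal degree, modulo `J`. -/
theorem Input.ReachesHermite.exists_pow_mul_mem (hG : c.ReachesHermite m G) {g : PolyYX k n}
    (hg : g ∈ nonBase c.J G) (hdeg : g.natDegree = sDeg c.J G) {f : PolyYX k n} (hf : f ∈ c.I) :
    ∃ N : ℕ, Polynomial.C (g.leadingCoeff ^ N) * f ∈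
      Ideal.span {g} ⊔ c.J.map (Polynomial.C : MvPolynomial (Fin n) k →+* PolyYX k n) := by
  induction hd : f.natDegree using Nat.strong_induction_on generalizing f with
  | _ d ih =>
    subst hd
    by_cases hlt : f.natDegree < sDeg c.J G
    · refine ⟨0, Ideal.mem_sup_right ?_⟩
      rw [pow_zero, C_1, one_mul]
      exact Ideal.mem_map_C_iff.mpr (hG.coeff_mem_of_natDegree_lt f hf hlt)
    · push Not at hlt
      have hpos := hG.natDegree_pos hg
      have hgI : g ∈ c.I := hG.basis.mem (mem_nonBase.mp hg).1
      set f' := Polynomial.C g.leadingCoeff * f -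
        Polynomial.C f.leadingCoeff * X ^ (f.natDegree - g.natDegree) * g with hf'
      have hlt' : f'.natDegree < f.natDegree := by
        refine lt_of_le_of_ne ?_ fun heq => ?_
        · refine (natDegree_sub_le _ _).trans (max_le (natDegree_C_mul_le _ _) ?_)
          refine natDegree_mul_le.trans ?_
          have := natDegree_C_mul_X_pow_le f.leadingCoeff (f.natDegree - g.natDegree)
          omega
        · have h0 : f'.coeff f.natDegree = 0 := by
            have h2 : f.natDegree = g.natDegree + (f.natDegree - g.natDegree) := by omega
            rw [hf', coeff_sub, coeff_C_mul, mul_assoc, coeff_C_mul]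
            conv_lhs => enter [2, 2]; rw [h2, add_tsub_cancel_left, coeff_X_pow_mul]
            simp only [coeff_natDegree]
            ring
          rw [← heq, coeff_natDegree, leadingCoeff_eq_zero] at h0
          rw [h0, natDegree_zero] at heq
          omega
      obtain ⟨N, hN⟩ := ih _ hlt' (c.I.sub_mem (c.I.mul_mem_left _ hf) (c.I.mul_mem_left _ hgI)) rfl
      refine ⟨N + 1, ?_⟩
      have h1 : Polynomial.C (g.leadingCoeff ^ (N + 1)) * f =
          Polynomial.C (g.leadingCoeff ^ N) * f' + (Polynomial.C (g.leadingCoeff ^ N) *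
            (Polynomial.C f.leadingCoeff * X ^ (f.natDegree - g.natDegree))) * g := by
        rw [hf', pow_succ, C_mul]; ring
      rw [h1]
      exact add_mem hN (Ideal.mem_sup_left
        (Ideal.mul_mem_left _ _ (Ideal.mem_span_singleton_self g)))

end Groebner

/-! ### The Boolean algebra of semi-algebraic sets -/

section SemialgebraicSets

variable {R : Type*} [Field R] [LinearOrder R] [IsStrictOrderedRing R] {σ τ : Type*}

theorem IsBasicSemialgebraic.isSemialgebraic {S : Set (σ → R)} (h : IsBasicSemialgebraic S) :
    IsSemialgebraic S :=
  ⟨{S}, Set.finite_singleton S, by simpa using h, by simp⟩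

theorem isSemialgebraic_setOf_eval_eq_zero (f : MvPolynomial σ R) :
    IsSemialgebraic {a | MvPolynomial.eval a f = 0} :=
  IsBasicSemialgebraic.isSemialgebraic ⟨{f}, ∅, by simp⟩

theorem isSemialgebraic_setOf_eval_pos (f : MvPolynomial σ R) :
    IsSemialgebraic {a | 0 < MvPolynomial.eval a f} :=
  IsBasicSemialgebraic.isSemialgebraic ⟨∅, {f}, by simp⟩

theorem isSemialgebraic_empty : IsSemialgebraic (∅ : Set (σ → R)) :=
  ⟨∅, Set.finite_empty, by simp, by simp⟩

theorem isSemialgebraic_univ : IsSemialgebraic (Set.univ : Set (σ → R)) :=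
  IsBasicSemialgebraic.isSemialgebraic ⟨∅, ∅, by simp⟩

theorem IsSemialgebraic.union {S T : Set (σ → R)} (hS : IsSemialgebraic S)
    (hT : IsSemialgebraic T) : IsSemialgebraic (S ∪ T) := by
  obtain ⟨F, hF, hF', rfl⟩ := hS
  obtain ⟨G, hG, hG', rfl⟩ := hT
  exact ⟨F ∪ G, hF.union hG, fun B hB => hB.elim (hF' B) (hG' B), (Set.sUnion_union F G).symm⟩

theorem IsBasicSemialgebraic.inter {S T : Set (σ → R)} (hS : IsBasicSemialgebraic S)
    (hT : IsBasicSemialgebraic T) : IsBasicSemialgebraic (S ∩ T) := by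
  classical
  obtain ⟨P, Q, rfl⟩ := hS
  obtain ⟨P', Q', rfl⟩ := hT
  refine ⟨P ∪ P', Q ∪ Q', ?_⟩
  ext a
  simp only [Set.mem_inter_iff, Set.mem_ofPred_eq, Finset.mem_union, or_imp, forall_and]
  tauto

theorem IsSemialgebraic.inter {S T : Set (σ → R)} (hS : IsSemialgebraic S)
    (hT : IsSemialgebraic T) : IsSemialgebraic (S ∩ T) := by
  obtain ⟨F, hF, hF', rfl⟩ := hS
  obtain ⟨G, hG, hG', rfl⟩ := hT
  refine ⟨Set.image2 (· ∩ ·) F G, hF.image2 _ hG, ?_, ?_⟩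
  · rintro _ ⟨A, hA, B, hB, rfl⟩
    exact (hF' A hA).inter (hG' B hB)
  · ext a
    simp only [Set.mem_inter_iff, Set.mem_sUnion, Set.mem_image2]
    constructor
    · rintro ⟨⟨A, hA, haA⟩, B, hB, haB⟩
      exact ⟨A ∩ B, ⟨A, hA, B, hB, rfl⟩, haA, haB⟩
    · rintro ⟨_, ⟨A, hA, B, hB, rfl⟩, haA, haB⟩
      exact ⟨⟨A, hA, haA⟩, B, hB, haB⟩

theorem IsSemialgebraic.biUnion {ι : Type*} {s : Set ι} (hs : s.Finite) {S : ι → Set (σ → R)}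
    (h : ∀ i ∈ s, IsSemialgebraic (S i)) : IsSemialgebraic (⋃ i ∈ s, S i) := by
  induction s, hs using Set.Finite.induction_on with
  | empty => simpa using isSemialgebraic_empty
  | insert _ _ ih =>
    rw [Set.biUnion_insert]
    exact (h _ (Set.mem_insert _ _)).union (ih fun i hi => h i (Set.mem_insert_of_mem _ hi))

theorem IsSemialgebraic.biInter {ι : Type*} {s : Set ι} (hs : s.Finite) {S : ι → Set (σ → R)}
    (h : ∀ i ∈ s, IsSemialgebraic (S i)) : IsSemialgebraic (⋂ i ∈ s, S i) := by
  induction s, hs using Set.Finite.induction_on with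
  | empty => simpa using isSemialgebraic_univ
  | insert _ _ ih =>
    rw [Set.biInter_insert]
    exact (h _ (Set.mem_insert _ _)).inter (ih fun i hi => h i (Set.mem_insert_of_mem _ hi))

theorem isSemialgebraic_setOf_eval_ne_zero (f : MvPolynomial σ R) :
    IsSemialgebraic {a | MvPolynomial.eval a f ≠ 0} := by
  have h := (isSemialgebraic_setOf_eval_pos f).union (isSemialgebraic_setOf_eval_pos (-f))
  convert h using 1
  ext a
  simp only [Set.mem_ofPred_eq, Set.mem_union, map_neg, neg_pos]
  exact ne_iff_lt_or_gt.trans or_comm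

theorem IsSemialgebraic.compl {S : Set (σ → R)} (hS : IsSemialgebraic S) :
    IsSemialgebraic Sᶜ := by
  obtain ⟨F, hF, hF', rfl⟩ := hS
  rw [Set.sUnion_eq_biUnion, Set.compl_iUnion₂]
  refine IsSemialgebraic.biInter hF fun B hB => ?_
  obtain ⟨P, Q, rfl⟩ := hF' B hB
  have h : ({a | (∀ f ∈ P, MvPolynomial.eval a f = 0) ∧ ∀ h ∈ Q, 0 < MvPolynomial.eval a h}ᶜ :
      Set (σ → R)) = (⋃ f ∈ (P : Set _), {a | MvPolynomial.eval a f ≠ 0}) ∪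
        ⋃ h ∈ (Q : Set _), ({a | MvPolynomial.eval a h = 0} ∪ {a | 0 < MvPolynomial.eval a (-h)}) := by
    ext a
    simp only [Set.mem_compl_iff, Set.mem_ofPred_eq, Set.mem_union, Set.mem_iUnion,
      Finset.mem_coe, exists_prop, map_neg, neg_pos, not_and_or, not_forall, not_lt,
      le_iff_eq_or_lt]
  rw [h]
  exact (IsSemialgebraic.biUnion P.finite_toSet fun f _ =>
    isSemialgebraic_setOf_eval_ne_zero f).union (IsSemialgebraic.biUnion Q.finite_toSet fun h _ =>
      (isSemialgebraic_setOf_eval_eq_zero h).union (isSemialgebraic_setOf_eval_pos (-h)))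

theorem IsSemialgebraic.diff {S T : Set (σ → R)} (hS : IsSemialgebraic S)
    (hT : IsSemialgebraic T) : IsSemialgebraic (S \ T) :=
  hS.inter hT.compl

theorem IsSemialgebraic.preimage_comp {S : Set (σ → R)} (hS : IsSemialgebraic S) (e : σ → τ) :
    IsSemialgebraic {a : τ → R | a ∘ e ∈ S} := by
  classical
  obtain ⟨F, hF, hF', rfl⟩ := hS
  refine ⟨(fun B => {a : τ → R | a ∘ e ∈ B}) '' F, hF.image _, ?_, ?_⟩
  · rintro _ ⟨B, hB, rfl⟩
    obtain ⟨P, Q, rfl⟩ := hF' B hB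
    refine ⟨P.image (MvPolynomial.rename e), Q.image (MvPolynomial.rename e), ?_⟩
    ext a
    simp [MvPolynomial.eval_rename]
  · ext a
    simp

/-! ### Regular functions -/

/-- The ring of functions which on `S` are quotients of polynomials with denominators vanishing
nowhere on `S`.  The values off `S` are arbitrary. -/
def regularOn (S : Set (σ → R)) : Subring ((σ → R) → R) where
  carrier := {g | ∃ N d : MvPolynomial σ R, ∀ a ∈ S, MvPolynomial.eval a d ≠ 0 ∧
    g a = MvPolynomial.eval a N / MvPolynomial.eval a d}
  mul_mem' := by
    rintro g g' ⟨N, d, h⟩ ⟨N', d', h'⟩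
    refine ⟨N * N', d * d', fun a ha => ?_⟩
    simp only [map_mul, Pi.mul_apply, (h a ha).2, (h' a ha).2]
    exact ⟨mul_ne_zero (h a ha).1 (h' a ha).1, div_mul_div_comm _ _ _ _⟩
  one_mem' := ⟨1, 1, by simp⟩
  add_mem' := by
    rintro g g' ⟨N, d, h⟩ ⟨N', d', h'⟩
    refine ⟨N * d' + d * N', d * d', fun a ha => ?_⟩
    simp only [map_mul, map_add, Pi.add_apply, (h a ha).2, (h' a ha).2]
    exact ⟨mul_ne_zero (h a ha).1 (h' a ha).1, div_add_div _ _ (h a ha).1 (h' a ha).1⟩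
  zero_mem' := ⟨0, 1, by simp⟩
  neg_mem' := by
    rintro g ⟨N, d, h⟩
    exact ⟨-N, d, fun a ha => ⟨(h a ha).1, by simp [(h a ha).2, neg_div]⟩⟩

theorem eval_mem_regularOn (S : Set (σ → R)) (f : MvPolynomial σ R) :
    (fun a => MvPolynomial.eval a f) ∈ regularOn S := ⟨f, 1, by simp⟩

theorem apply_mem_regularOn (S : Set (σ → R)) (i : σ) : (fun a => a i) ∈ regularOn S :=
  ⟨MvPolynomial.X i, 1, by simp⟩

theorem regularOn_anti {S T : Set (σ → R)} (h : T ⊆ S) : regularOn S ≤ regularOn T := by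
  rintro g ⟨N, d, hg⟩
  exact ⟨N, d, fun a ha => hg a (h ha)⟩

theorem regularOn_congr {S : Set (σ → R)} {g g' : (σ → R) → R} (hg : g ∈ regularOn S)
    (h : ∀ a ∈ S, g' a = g a) : g' ∈ regularOn S := by
  obtain ⟨N, d, hg⟩ := hg
  exact ⟨N, d, fun a ha => by rw [h a ha]; exact hg a ha⟩

theorem inv_mem_regularOn {S : Set (σ → R)} {g : (σ → R) → R} (hg : g ∈ regularOn S)
    (h : ∀ a ∈ S, g a ≠ 0) : g⁻¹ ∈ regularOn S := by
  obtain ⟨N, d, hg⟩ := hg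
  refine ⟨d, N, fun a ha => ⟨fun h0 => h a ha ?_, ?_⟩⟩
  · rw [(hg a ha).2, h0, zero_div]
  · rw [Pi.inv_apply, (hg a ha).2, inv_div]

theorem comp_mem_regularOn {S : Set (σ → R)} {g : (σ → R) → R} (hg : g ∈ regularOn S)
    (e : σ → τ) : (fun a : τ → R => g (a ∘ e)) ∈ regularOn {a : τ → R | a ∘ e ∈ S} := by
  obtain ⟨N, d, hg⟩ := hg
  refine ⟨MvPolynomial.rename e N, MvPolynomial.rename e d, fun a ha => ?_⟩
  rw [MvPolynomial.eval_rename, MvPolynomial.eval_rename]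
  exact hg _ ha

theorem isSemialgebraic_setOf_eq_zero {S : Set (σ → R)} (hS : IsSemialgebraic S)
    {g : (σ → R) → R} (hg : g ∈ regularOn S) : IsSemialgebraic {a ∈ S | g a = 0} := by
  obtain ⟨N, d, hg⟩ := hg
  convert hS.inter (isSemialgebraic_setOf_eval_eq_zero N) using 1
  ext a
  simp only [Set.mem_ofPred_eq, Set.mem_inter_iff]
  refine and_congr_right fun ha => ?_
  rw [(hg a ha).2, div_eq_zero_iff, or_iff_left (hg a ha).1]

theorem isSemialgebraic_setOf_pos {S : Set (σ → R)} (hS : IsSemialgebraic S)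
    {g : (σ → R) → R} (hg : g ∈ regularOn S) : IsSemialgebraic {a ∈ S | 0 < g a} := by
  obtain ⟨N, d, hg⟩ := hg
  convert hS.inter (isSemialgebraic_setOf_eval_pos (N * d)) using 1
  ext a
  simp only [Set.mem_ofPred_eq, Set.mem_inter_iff, map_mul]
  refine and_congr_right fun ha => ?_
  rw [(hg a ha).2, div_pos_iff, mul_pos_iff]

theorem isSemialgebraic_setOf_ne_zero {S : Set (σ → R)} (hS : IsSemialgebraic S)
    {g : (σ → R) → R} (hg : g ∈ regularOn S) : IsSemialgebraic {a ∈ S | g a ≠ 0} := by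
  convert hS.diff (isSemialgebraic_setOf_eq_zero hS hg) using 1
  ext a
  simp only [Set.mem_ofPred_eq, Set.mem_sdiff]
  tauto

theorem continuousOn_of_mem_regularOn [TopologicalSpace R] [OrderTopology R] {S : Set (σ → R)}
    {g : (σ → R) → R} (hg : g ∈ regularOn S) : ContinuousOn g S := by
  obtain ⟨N, d, hg⟩ := hg
  have h : ContinuousOn (fun a => MvPolynomial.eval a N / MvPolynomial.eval a d) S :=
    (MvPolynomial.continuous_eval N).continuousOn.div
      (MvPolynomial.continuous_eval d).continuousOn fun a ha => (hg a ha).1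
  exact h.congr fun a ha => (hg a ha).2

end SemialgebraicSets

/-! ### Signatures of symmetric matrices depending on parameters -/

section Signature

variable {R : Type*} [Field R] [LinearOrder R] [IsStrictOrderedRing R]

/-- The number of positive squares in a diagonalization of the quadratic form `Q`, computed from
coordinates `T` in which `Q` is diagonal. -/
theorem sigPos_eq_ncard {V ι : Type*} [AddCommGroup V] [Module R V] [FiniteDimensional R V]
    [Fintype ι] (Q : QuadraticForm R V) (T : V →ₗ[R] (ι → R)) (hT : Function.Injective T)
    (hdim : Module.finrank R V = Fintype.card ι) (w : ι → R)
    (hQ : ∀ v, Q v = ∑ i, w i * (T v i) ^ 2) : sigPos Q = {i | 0 < w i}.ncard := by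
  have h : QuadraticMap.Equivalent Q (QuadraticMap.weightedSumSquares R w) :=
    ⟨{ LinearMap.linearEquivOfInjective T hT (by rw [hdim, Module.finrank_fintype_fun_eq_card]) with
      map_app' := fun v => by
        rw [hQ, QuadraticMap.weightedSumSquares_apply]
        simp [pow_two] }⟩
  rw [h.sigPos_eq, QuadraticForm.sigPos_weightedSumSquares]

/-- The quadratic form of a square matrix. -/
def matForm {ι : Type*} [Fintype ι] [DecidableEq ι] (M : Matrix ι ι R) : QuadraticForm R (ι → R) :=
  M.toQuadraticForm'

theorem matForm_apply {ι : Type*} [Fintype ι] [DecidableEq ι] (M : Matrix ι ι R) (v : ι → R) :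
    matForm M v = ∑ i, ∑ j, v i * M i j * v j := by
  simp only [matForm, Matrix.toQuadraticForm', LinearMap.BilinMap.toQuadraticMap_apply,
    Matrix.toLinearMap₂'_apply]
  refine Finset.sum_congr rfl fun i _ => Finset.sum_congr rfl fun j _ => ?_
  simp only [smul_eq_mul]
  ring

theorem matForm_eq_dotProduct {ι : Type*} [Fintype ι] [DecidableEq ι] (M : Matrix ι ι R)
    (v : ι → R) : matForm M v = v ⬝ᵥ M.mulVec v := by
  rw [matForm_apply, dotProduct]
  refine Finset.sum_congr rfl fun i _ => ?_
  rw [Matrix.mulVec, dotProduct, Finset.mul_sum]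
  exact Finset.sum_congr rfl fun j _ => by ring

theorem sigPos_matForm_congr {ι : Type*} [Fintype ι] [DecidableEq ι] (M P : Matrix ι ι R)
    (hP : IsUnit P.det) : sigPos (matForm (P.transpose * M * P)) = sigPos (matForm M) := by
  refine QuadraticMap.Equivalent.sigPos_eq ⟨{ P.toLinearEquiv' (P.invertibleOfIsUnitDet hP) with
    map_app' := fun v => ?_ }⟩
  show matForm M (P.mulVec v) = _
  rw [matForm_eq_dotProduct, matForm_eq_dotProduct, Matrix.mul_assoc, ← Matrix.mulVec_mulVec,
    ← Matrix.mulVec_mulVec, Matrix.dotProduct_mulVec v, Matrix.vecMul_transpose]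

/-- The Schur complement of the upper left entry of `M`.  If this entry is zero, it is the lower
right block of `M`, as `x / 0 = 0`. -/
def schurComplement {r : ℕ} (M : Matrix (Fin (r + 1)) (Fin (r + 1)) R) : Matrix (Fin r) (Fin r) R :=
  Matrix.of fun i j => M i.succ j.succ - M 0 i.succ * M 0 j.succ / M 0 0

/-- One step of Lagrange's diagonalization of a symmetric matrix. -/
theorem sigPos_schurComplement {r : ℕ} (M : Matrix (Fin (r + 1)) (Fin (r + 1)) R)
    (hM : M.transpose = M) (h0 : M 0 0 ≠ 0 ∨ ∀ j, M 0 j = 0) :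
    sigPos (matForm M) = sigPos (matForm (schurComplement M)) + if 0 < M 0 0 then 1 else 0 := by
  have : Invertible (2 : R) := invertibleOfNonzero two_ne_zero
  obtain ⟨N, hN, w, ⟨e⟩⟩ : ∃ N, N = r ∧ ∃ w : Fin N → R, QuadraticMap.Equivalent
      (matForm (schurComplement M)) (QuadraticMap.weightedSumSquares R w) :=
    ⟨_, Module.finrank_fin_fun R, (matForm (schurComplement M)).equivalent_weightedSumSquares⟩
  rw [QuadraticMap.Equivalent.sigPos_eq ⟨e⟩, QuadraticForm.sigPos_weightedSumSquares]
  -- the new coordinates: `v₀ + ∑ (M₀ⱼ / M₀₀) vⱼ`, and those diagonalizing the Schur complement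
  let T₀ : (Fin (r + 1) → R) →ₗ[R] R :=
    LinearMap.proj 0 + ∑ j : Fin r, (M 0 j.succ / M 0 0) • LinearMap.proj j.succ
  let tail : (Fin (r + 1) → R) →ₗ[R] (Fin r → R) := LinearMap.funLeft R R Fin.succ
  let T : (Fin (r + 1) → R) →ₗ[R] (Option (Fin N) → R) :=
    LinearMap.pi fun o => o.elim T₀ fun i =>
      LinearMap.proj i ∘ₗ (e.toLinearEquiv : (Fin r → R) →ₗ[R] (Fin N → R)) ∘ₗ tail
  have hT0 : ∀ v, T v none = v 0 + ∑ j : Fin r, M 0 j.succ / M 0 0 * v j.succ := fun v => by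
    simp [T, T₀]
  have hTs : ∀ v i, T v (some i) = e (tail v) i := fun v i => rfl
  have hinj : Function.Injective T := by
    rw [← LinearMap.ker_eq_bot, LinearMap.ker_eq_bot']
    intro v hv
    have h1 : e.toLinearEquiv (tail v) = 0 := by
      ext i
      exact (hTs v i).symm.trans (by rw [hv]; rfl)
    have h2 : tail v = 0 := by
      simpa using h1
    have h3 : ∀ j : Fin r, v j.succ = 0 := fun j => congrFun h2 j
    have h4 := hT0 v
    rw [hv] at h4
    simp only [Pi.zero_apply, h3, mul_zero, Finset.sum_const_zero, add_zero] at h4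
    ext j
    exact Fin.cases h4.symm h3 j
  have hsym : ∀ i j, M i j = M j i := fun i j => by
    conv_lhs => rw [← hM]
    rfl
  have hdiag : ∀ v, matForm M v = ∑ o, (o.elim (M 0 0) w) * (T v o) ^ 2 := by
    intro v
    rw [Fintype.sum_option]
    have h1 : ∑ i, w i * (T v (some i)) ^ 2 = matForm (schurComplement M) (tail v) := by
      rw [← e.map_app, QuadraticMap.weightedSumSquares_apply]
      refine Finset.sum_congr rfl fun i _ => ?_
      rw [hTs, smul_eq_mul, pow_two]
    simp only [Option.elim]
    rw [h1, hT0, matForm_apply, matForm_apply, Fin.sum_univ_succ]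
    simp only [Fin.sum_univ_succ (n := r)]
    rw [Finset.sum_add_distrib]
    set A := ∑ j : Fin r, M 0 j.succ * v j.succ with hA
    have hA1 : ∑ j : Fin r, M 0 j.succ / M 0 0 * v j.succ = A / M 0 0 := by
      rw [hA, Finset.sum_div]
      exact Finset.sum_congr rfl fun j _ => by ring
    have hA2 : ∑ j : Fin r, v 0 * M 0 j.succ * v j.succ = v 0 * A := by
      rw [hA, Finset.mul_sum]
      exact Finset.sum_congr rfl fun j _ => by ring
    have hA3 : ∑ j : Fin r, v j.succ * M j.succ 0 * v 0 = v 0 * A := by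
      rw [hA, Finset.mul_sum]
      exact Finset.sum_congr rfl fun j _ => by rw [hsym j.succ 0]; ring
    have hS : ∑ i : Fin r, ∑ j : Fin r, tail v i * schurComplement M i j * tail v j =
        (∑ i : Fin r, ∑ j : Fin r, v i.succ * M i.succ j.succ * v j.succ) - A ^ 2 / M 0 0 := by
      have h2 : A ^ 2 / M 0 0 = ∑ i : Fin r, ∑ j : Fin r,
          v i.succ * (M 0 i.succ * M 0 j.succ / M 0 0) * v j.succ := by
        rw [pow_two, hA, Finset.sum_mul_sum, Finset.sum_div]
        refine Finset.sum_congr rfl fun i _ => ?_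
        rw [Finset.sum_div]
        exact Finset.sum_congr rfl fun j _ => by ring
      rw [h2, ← Finset.sum_sub_distrib]
      refine Finset.sum_congr rfl fun i _ => ?_
      rw [← Finset.sum_sub_distrib]
      refine Finset.sum_congr rfl fun j _ => ?_
      have ht : ∀ j, tail v j = v j.succ := fun _ => rfl
      simp only [schurComplement, Matrix.of_apply, ht]
      ring
    rw [hA1, hA2, hA3, hS]
    rcases h0 with h0 | h0
    · field_simp
      ring
    · have hA0 : A = 0 := Finset.sum_eq_zero fun j _ => by rw [h0, zero_mul]
      rw [hA0, h0 0]
      ring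
  rw [sigPos_eq_ncard (matForm M) T hinj (by simp [hN]) _ hdiag]
  have hset : {o : Option (Fin N) | 0 < o.elim (M 0 0) w} =
      some '' {i | 0 < w i} ∪ (if 0 < M 0 0 then {none} else ∅) := by
    ext o
    rcases o with _ | i
    · by_cases h : 0 < M 0 0 <;> simp [h]
    · by_cases h : 0 < M 0 0 <;> simp [h]
  rw [hset, Set.ncard_union_eq, Set.ncard_image_of_injective _ (Option.some_injective _)]
  · by_cases h : 0 < M 0 0 <;> simp [h]
  · by_cases h : 0 < M 0 0 <;> simp [h]

variable {σ : Type*}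

/-- The set of parameters for which a symmetric matrix with regular entries has a given number of
positive squares is semi-algebraic, since Lagrange's diagonalization is a rational algorithm. -/
theorem isSemialgebraic_setOf_sigPos_eq (r : ℕ) : ∀ (S : Set (σ → R)), IsSemialgebraic S →
    ∀ M : (σ → R) → Matrix (Fin r) (Fin r) R, (∀ i j, (fun a => M a i j) ∈ regularOn S) →
    (∀ a ∈ S, (M a).transpose = M a) → ∀ t, IsSemialgebraic {a ∈ S | sigPos (matForm (M a)) = t} := by
  induction r with
  | zero =>
    intro S hS M _ _ t
    have h (a) : sigPos (matForm (M a)) = 0 := by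
      have := sigPos_le_finrank (matForm (M a))
      simpa using this
    by_cases ht : 0 = t
    · simpa [h, ht] using hS
    · simpa [h, ht] using isSemialgebraic_empty
  | succ r ih =>
    -- one elimination step, where the upper left entry is non-zero or its row vanishes
    have hstep : ∀ (S : Set (σ → R)), IsSemialgebraic S →
        ∀ M : (σ → R) → Matrix (Fin (r + 1)) (Fin (r + 1)) R,
        (∀ i j, (fun a => M a i j) ∈ regularOn S) → (∀ a ∈ S, (M a).transpose = M a) →
        ((∀ a ∈ S, M a 0 0 ≠ 0) ∨ ∀ a ∈ S, ∀ j, M a 0 j = 0) →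
        ∀ t, IsSemialgebraic {a ∈ S | sigPos (matForm (M a)) = t} := by
      intro S hS M hM hsym h0 t
      have hM' : ∀ i j, (fun a => schurComplement (M a) i j) ∈ regularOn S := by
        intro i j
        rcases h0 with h0 | h0
        · exact (regularOn S).sub_mem (hM i.succ j.succ) ((regularOn S).mul_mem
            ((regularOn S).mul_mem (hM 0 i.succ) (hM 0 j.succ)) (inv_mem_regularOn (hM 0 0) h0))
            |> fun h => regularOn_congr h fun a _ => by
              simp [schurComplement, div_eq_mul_inv]
        · refine regularOn_congr (hM i.succ j.succ) fun a ha => ?_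
          simp [schurComplement, h0 a ha]
      have hsym' : ∀ a ∈ S, (schurComplement (M a)).transpose = schurComplement (M a) := by
        intro a ha
        ext i j
        have h1 : M a j.succ i.succ = M a i.succ j.succ := congrFun (congrFun (hsym a ha) _) _
        simp only [schurComplement, Matrix.transpose_apply, Matrix.of_apply, h1]
        ring
      have hpos := isSemialgebraic_setOf_pos hS (hM 0 0)
      have key : {a ∈ S | sigPos (matForm (M a)) = t} =
          ({a ∈ S | 0 < M a 0 0} ∩ {a ∈ S | sigPos (matForm (schurComplement (M a))) + 1 = t}) ∪
          ((S \ {a ∈ S | 0 < M a 0 0}) ∩ {a ∈ S | sigPos (matForm (schurComplement (M a))) = t}) := by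
        ext a
        simp only [Set.mem_ofPred_eq, Set.mem_union, Set.mem_inter_iff, Set.mem_sdiff]
        by_cases ha : a ∈ S
        · have := sigPos_schurComplement (M a) (hsym a ha) (h0.imp (· a ha) (· a ha))
          by_cases hp : 0 < M a 0 0
          · rw [if_pos hp] at this; simp [ha, hp, this]
          · rw [if_neg hp] at this; simp [ha, hp, this]
        · simp [ha]
      rw [key]
      refine (hpos.inter ?_).union ((hS.diff hpos).inter (ih S hS _ hM' hsym' t))
      rcases t with _ | t
      · simpa using isSemialgebraic_empty
      · simpa using ih S hS _ hM' hsym' t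
    intro S hS M hM hsym t
    -- a change of basis making the upper left entry non-zero
    let P (ε : R) (j : Fin (r + 1)) : Matrix (Fin (r + 1)) (Fin (r + 1)) R := Matrix.transvection j 0 ε
    let M' (ε : R) (j : Fin (r + 1)) (a : σ → R) := (P ε j).transpose * M a * P ε j
    have hM' (ε j) : ∀ i i', (fun a => M' ε j a i i') ∈ regularOn S := by
      intro i i'
      have h1 : (fun a => M' ε j a i i') =
          ∑ l', (∑ l, (fun _ => P ε j l i) * (fun a => M a l l')) * (fun _ => P ε j l' i') := by
        ext a
        simp [M', Matrix.mul_apply]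
      have hconst (x : R) : (fun _ => x) ∈ regularOn S := by
        simpa using eval_mem_regularOn S (MvPolynomial.C x)
      rw [h1]
      exact sum_mem fun l' _ => mul_mem (sum_mem fun l _ => mul_mem (hconst _) (hM _ _)) (hconst _)
    have hsym' (ε j) : ∀ a ∈ S, (M' ε j a).transpose = M' ε j a := by
      intro a ha
      simp only [M', Matrix.transpose_mul, Matrix.transpose_transpose, hsym a ha, Matrix.mul_assoc]
    have hM00 (ε : R) (j : Fin (r + 1)) (hj : j ≠ 0) (a) (ha : a ∈ S) :
        M' ε j a 0 0 = M a 0 0 + 2 * ε * M a 0 j + ε ^ 2 * M a j j := by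
      have h1 : M a j 0 = M a 0 j := congrFun (congrFun (hsym a ha) _) _
      have h2 : ∀ l, P ε j l 0 = (if l = 0 then 1 else 0) + (if l = j then ε else 0) := by
        intro l
        simp only [P, Matrix.transvection, Matrix.add_apply, Matrix.one_apply, Matrix.single_apply,
          and_true, eq_comm (a := j)]
      simp only [M', Matrix.mul_apply, Matrix.transpose_apply, h2, add_mul, mul_add,
        Finset.sum_add_distrib, Finset.sum_ite_eq', Finset.mem_univ, if_true, ite_mul, mul_ite,
        one_mul, zero_mul, mul_one, mul_zero]
      rw [h1]
      ring
    have hzero : IsSemialgebraic (⋂ j ∈ (Set.univ : Set (Fin (r + 1))), {a ∈ S | M a 0 j = 0}) :=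
      IsSemialgebraic.biInter Set.finite_univ fun j _ => isSemialgebraic_setOf_eq_zero hS (hM 0 j)
    set S₀ := ⋂ j ∈ (Set.univ : Set (Fin (r + 1))), {a ∈ S | M a 0 j = 0} with hS₀
    set S₁ := {a ∈ S | M a 0 0 ≠ 0} with hS₁
    let S₂ (ε : R) (j : Fin (r + 1)) := {a ∈ S | M' ε j a 0 0 ≠ 0}
    have hS₀S : S₀ ⊆ S := fun a ha => (Set.mem_iInter₂.mp ha 0 trivial).1
    -- if `M 0 0 = 0` and `M 0 j ≠ 0`, then `ε = 1` or `ε = -1` makes the new entry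
    -- `2 ε M 0 j + ε ^ 2 M j j` non-zero
    have key : {a ∈ S | sigPos (matForm (M a)) = t} =
        ({a ∈ S₀ | sigPos (matForm (M a)) = t} ∪ {a ∈ S₁ | sigPos (matForm (M a)) = t}) ∪
        ⋃ j ∈ {j : Fin (r + 1) | j ≠ 0}, ({a ∈ S₂ 1 j | sigPos (matForm (M' 1 j a)) = t} ∪
          {a ∈ S₂ (-1) j | sigPos (matForm (M' (-1) j a)) = t}) := by
      have hcongr (ε j) (hj : j ≠ 0) (a) :
          sigPos (matForm (M' ε j a)) = sigPos (matForm (M a)) :=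
        sigPos_matForm_congr _ _ (by
          rw [Matrix.det_transvection_of_ne j 0 hj]; exact isUnit_one)
      apply Set.Subset.antisymm
      · rintro a ⟨ha, hat⟩
        by_cases h1 : M a 0 0 = 0
        · by_cases h2 : ∀ j, M a 0 j = 0
          · exact Or.inl (Or.inl ⟨Set.mem_iInter₂.mpr fun j _ => ⟨ha, h2 j⟩, hat⟩)
          · push Not at h2
            obtain ⟨j, hj⟩ := h2
            have hj0 : j ≠ 0 := by rintro rfl; exact hj h1
            refine Or.inr (Set.mem_iUnion₂.mpr ⟨j, hj0, ?_⟩)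
            by_cases h3 : M' 1 j a 0 0 = 0
            · refine Or.inr ⟨⟨ha, fun h4 => hj ?_⟩, (hcongr _ j hj0 a).trans hat⟩
              rw [hM00 _ j hj0 a ha] at h3 h4
              linarith
            · exact Or.inl ⟨⟨ha, h3⟩, (hcongr _ j hj0 a).trans hat⟩
        · exact Or.inl (Or.inr ⟨⟨ha, h1⟩, hat⟩)
      · rintro a ((⟨ha, hat⟩ | ⟨ha, hat⟩) | ha)
        · exact ⟨hS₀S ha, hat⟩
        · exact ⟨ha.1, hat⟩
        · obtain ⟨j, hj, ⟨ha, hat⟩ | ⟨ha, hat⟩⟩ := Set.mem_iUnion₂.mp ha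
          · exact ⟨ha.1, (hcongr _ j hj a).symm.trans hat⟩
          · exact ⟨ha.1, (hcongr _ j hj a).symm.trans hat⟩
    rw [key]
    have hS₂ (ε j) : IsSemialgebraic {a ∈ S₂ ε j | sigPos (matForm (M' ε j a)) = t} :=
      hstep _ (isSemialgebraic_setOf_ne_zero hS (hM' ε j 0 0)) _
        (fun i i' => regularOn_anti (fun a ha => ha.1) (hM' ε j i i'))
        (fun a ha => hsym' ε j a ha.1) (Or.inl fun a ha => ha.2) t
    refine (IsSemialgebraic.union ?_ ?_).union
      (IsSemialgebraic.biUnion (Set.toFinite _) fun j _ => (hS₂ 1 j).union (hS₂ (-1) j))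
    · exact hstep _ hzero M (fun i j => regularOn_anti hS₀S (hM i j))
        (fun a ha => hsym a (hS₀S ha)) (Or.inr fun a ha j => (Set.mem_iInter₂.mp ha j trivial).2) t
    · exact hstep _ (isSemialgebraic_setOf_ne_zero hS (hM 0 0)) M
        (fun i j => regularOn_anti (fun a ha => ha.1) (hM i j))
        (fun a ha => hsym a ha.1) (Or.inl fun a ha => ha.2) t

end Signature

/-! ### Counting real roots with Hermite forms -/

section RootCounting

variable {R : Type*} [Field R] [LinearOrder R] [IsStrictOrderedRing R] [IsRealClosed R]

theorem rePart_smul (a : R) (z : AlgebraicClosure R) : rePart (a • z) = a * rePart z := by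
  rw [Algebra.smul_def, rePart_mul, rePart_algebraMap, imPart_algebraMap, zero_mul, sub_zero]

theorem imPart_smul (a : R) (z : AlgebraicClosure R) : imPart (a • z) = a * imPart z := by
  rw [Algebra.smul_def, imPart_mul, rePart_algebraMap, imPart_algebraMap, zero_mul, add_zero]

variable (R) in
/-- The real part as a linear map. -/
def reLin : AlgebraicClosure R →ₗ[R] R where
  toFun := rePart
  map_add' := rePart_add
  map_smul' := rePart_smul

variable (R) in
/-- The imaginary part as a linear map. -/
def imLin : AlgebraicClosure R →ₗ[R] R where
  toFun := imPart
  map_add' := imPart_add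
  map_smul' := imPart_smul

theorem reLin_apply (z : AlgebraicClosure R) : reLin R z = rePart z := rfl

theorem eq_zero_of_parts {z : AlgebraicClosure R} (h1 : rePart z = 0) (h2 : imPart z = 0) :
    z = 0 := by
  rw [eq_algebraMap_of_imPart_eq_zero h2, h1, map_zero]

theorem conjEquiv_eq_self {z : AlgebraicClosure R} (h : imPart z = 0) : conjEquiv R z = z := by
  rw [eq_algebraMap_of_imPart_eq_zero h, AlgEquiv.commutes]

/-- The value at `z` of the polynomial with coefficients `u`. -/
def evalCoeffs {r : ℕ} (z : AlgebraicClosure R) : (Fin r → R) →ₗ[R] AlgebraicClosure R where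
  toFun u := ∑ i, u i • z ^ (i : ℕ)
  map_add' u v := by simp [add_smul, Finset.sum_add_distrib]
  map_smul' a u := by simp [mul_smul, Finset.smul_sum]

theorem evalCoeffs_apply {r : ℕ} (z : AlgebraicClosure R) (u : Fin r → R) :
    evalCoeffs z u = ∑ i, u i • z ^ (i : ℕ) := rfl

theorem evalCoeffs_conjEquiv {r : ℕ} (z : AlgebraicClosure R) (u : Fin r → R) :
    evalCoeffs (conjEquiv R z) u = conjEquiv R (evalCoeffs z u) := by
  rw [evalCoeffs_apply, evalCoeffs_apply, map_sum]
  refine Finset.sum_congr rfl fun i _ => ?_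
  rw [Algebra.smul_def, Algebra.smul_def, map_mul, map_pow, AlgEquiv.commutes]

theorem imPart_evalCoeffs {r : ℕ} {z : AlgebraicClosure R} (hz : imPart z = 0) (u : Fin r → R) :
    imPart (evalCoeffs z u) = 0 := by
  have h := congrArg imPart (evalCoeffs_conjEquiv z u)
  rw [conjEquiv_eq_self hz, imPart_conjEquiv] at h
  linarith

/-- A polynomial of degree less than `r` with `r` zeros vanishes. -/
theorem eq_zero_of_evalCoeffs_eq_zero {r : ℕ} {Z : Finset (AlgebraicClosure R)} (hr : r ≤ Z.card)
    {u : Fin r → R} (h : ∀ z ∈ Z, evalCoeffs z u = 0) : u = 0 := by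
  set p : (AlgebraicClosure R)[X] := ∑ i : Fin r, monomial (i : ℕ) (algebraMap R _ (u i)) with hp
  have hcoeff (i : Fin r) : p.coeff i = algebraMap R _ (u i) := by
    rw [hp, finsetSum_coeff, Finset.sum_eq_single i]
    · rw [coeff_monomial, if_pos rfl]
    · intro j _ hj
      rw [coeff_monomial, if_neg fun h => hj (Fin.ext h)]
    · simp
  have hdeg : p.degree < r := by
    refine (degree_sum_le _ _).trans_lt ((Finset.sup_lt_iff (by exact_mod_cast WithBot.bot_lt_coe r)).mpr
      fun i _ => (degree_monomial_le _ _).trans_lt (by exact_mod_cast i.2))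
  have hp0 : p = 0 := by
    refine eq_zero_of_degree_lt_of_eval_finset_eq_zero Z
      (hdeg.trans_le (by exact_mod_cast hr)) fun z hz => ?_
    rw [← h z hz, hp, eval_finsetSum, evalCoeffs_apply]
    simp [Algebra.smul_def]
  ext i
  have := hcoeff i
  rw [hp0, coeff_zero] at this
  exact (map_eq_zero_iff _ (algebraMap R (AlgebraicClosure R)).injective).mp this.symm

open Classical in
/-- Hermite's theorem on signatures.  A pair of conjugate points `z`, `z̄` contributes the real part
of `2 q(z) u(z) ^ 2`, which is `A ^ 2 - B ^ 2` for the real and imaginary parts of `c u(z)`, where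
`c ^ 2 = 2 q(z)`.  Hence the pair adds exactly one positive square, and a real point `x` adds one if
and only if `q(x) > 0`. -/
theorem sigPos_hermite {r : ℕ} (Z : Finset (AlgebraicClosure R)) (hr : Z.card = r)
    (hconj : ∀ z ∈ Z, conjEquiv R z ∈ Z) (q : R[X])
    (hq : ∀ z ∈ Z, imPart z ≠ 0 → aeval z q ≠ 0) (M : Matrix (Fin r) (Fin r) R)
    (hM : ∀ i j, algebraMap R (AlgebraicClosure R) (M i j) =
      ∑ z ∈ Z, aeval z q * z ^ ((i : ℕ) + j)) :
    sigPos (matForm M) = (Z.filter fun z => imPart z = 0 ∧ 0 < rePart (aeval z q)).card +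
      (Z.filter fun z => 0 < imPart z).card := by
  have hsqrt : ∀ z : AlgebraicClosure R, ∃ c : AlgebraicClosure R, c ^ 2 = 2 * aeval z q :=
    fun z => IsAlgClosed.exists_pow_nat_eq _ two_pos
  choose c hc using hsqrt
  -- coordinates diagonalizing the form: the conjugate of a point in the upper half-plane is assigned
  -- the second of the two squares that the pair contributes
  let T : (Fin r → R) →ₗ[R] (Z → R) := LinearMap.pi fun z =>
    if imPart (z : AlgebraicClosure R) = 0 then reLin R ∘ₗ evalCoeffs (z : AlgebraicClosure R)
    else if 0 < imPart (z : AlgebraicClosure R) then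
      reLin R ∘ₗ LinearMap.mulLeft R (c z) ∘ₗ evalCoeffs (z : AlgebraicClosure R)
    else imLin R ∘ₗ LinearMap.mulLeft R (c (conjEquiv R z)) ∘ₗ
      evalCoeffs (conjEquiv R (z : AlgebraicClosure R))
  let w : AlgebraicClosure R → R := fun z =>
    if imPart z = 0 then rePart (aeval z q) else if 0 < imPart z then 1 else -1
  let t : (Fin r → R) → AlgebraicClosure R → R := fun u z =>
    if imPart z = 0 then rePart (evalCoeffs z u)
    else if 0 < imPart z then rePart (c z * evalCoeffs z u)
    else imPart (c (conjEquiv R z) * evalCoeffs (conjEquiv R z) u)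
  have hT : ∀ u (z : Z), T u z = t u z := by
    intro u z
    simp only [T, t, LinearMap.pi_apply]
    split_ifs <;> rfl
  have hlow {z : AlgebraicClosure R} (h : 0 < imPart z) :
      imPart (conjEquiv R z) ≠ 0 ∧ ¬ 0 < imPart (conjEquiv R z) := by
    rw [imPart_conjEquiv]
    constructor <;> linarith
  have hinj : Function.Injective T := by
    rw [← LinearMap.ker_eq_bot, LinearMap.ker_eq_bot']
    intro u hu
    have hu' : ∀ z ∈ Z, t u z = 0 := fun z hz => by
      rw [← hT u ⟨z, hz⟩, hu]; rfl
    have hupper : ∀ z ∈ Z, 0 < imPart z → evalCoeffs z u = 0 := by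
      intro z hz hpos
      have h1 := hu' z hz
      have h2 := hu' _ (hconj z hz)
      simp only [t, if_neg hpos.ne', if_pos hpos] at h1
      simp only [t, if_neg (hlow hpos).1, if_neg (hlow hpos).2, conjEquiv_conjEquiv] at h2
      refine (mul_eq_zero.mp (eq_zero_of_parts h1 h2)).resolve_left fun h0 => ?_
      have := hc z
      rw [h0, zero_pow two_ne_zero] at this
      exact mul_ne_zero two_ne_zero (hq z hz hpos.ne') this.symm
    refine eq_zero_of_evalCoeffs_eq_zero hr.ge fun z hz => ?_
    rcases lt_trichotomy (imPart z) 0 with h | h | h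
    · have := hupper _ (hconj z hz) (by rw [imPart_conjEquiv]; linarith)
      rw [evalCoeffs_conjEquiv] at this
      exact (map_eq_zero_iff _ (conjEquiv R).injective).mp this
    · have h1 := hu' z hz
      simp only [t, if_pos h] at h1
      exact eq_zero_of_parts h1 (imPart_evalCoeffs h u)
    · exact hupper z hz h
  have hdiag : ∀ u, matForm M u = ∑ z : Z, w z * (T u z) ^ 2 := by
    intro u
    let f : AlgebraicClosure R → R := fun z => rePart (aeval z q * evalCoeffs z u ^ 2)
    have h1 : matForm M u = ∑ z ∈ Z, f z := by
      have h2 : algebraMap R (AlgebraicClosure R) (matForm M u) =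
          ∑ z ∈ Z, aeval z q * evalCoeffs z u ^ 2 := by
        rw [matForm_apply]
        simp only [map_sum, map_mul, hM, evalCoeffs_apply, pow_two,
          Finset.mul_sum, Finset.sum_mul, Algebra.smul_def]
        refine (Finset.sum_congr rfl fun i _ => Finset.sum_comm).trans ?_
        rw [Finset.sum_comm]
        refine Finset.sum_congr rfl fun z _ => Finset.sum_comm.trans ?_
        refine Finset.sum_congr rfl fun i _ => Finset.sum_congr rfl fun j _ => ?_
        rw [pow_add]
        ring
      rw [← rePart_algebraMap (matForm M u), h2, ← reLin_apply, map_sum]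
      rfl
    have h3 : ∑ z : Z, w z * (T u z) ^ 2 = ∑ z ∈ Z, w z * (t u z) ^ 2 := by
      rw [← Finset.sum_coe_sort Z]
      exact Finset.sum_congr rfl fun z _ => by rw [hT]
    rw [h1, h3]
    have hperm (g : AlgebraicClosure R → R) :
        ∑ z ∈ Z, g (conjEquiv R z) = ∑ z ∈ Z, g z :=
      Finset.sum_bij (fun z _ => conjEquiv R z) (fun z hz => hconj z hz)
        (fun _ _ _ _ h => (conjEquiv R).injective h)
        (fun z hz => ⟨_, hconj z hz, conjEquiv_conjEquiv z⟩) fun _ _ => rfl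
    have hupper : ∀ z, 0 < imPart z → f z + f (conjEquiv R z) =
        w z * (t u z) ^ 2 + w (conjEquiv R z) * (t u (conjEquiv R z)) ^ 2 := by
      intro z hpos
      have hf : f (conjEquiv R z) = f z := by
        simp only [f, evalCoeffs_conjEquiv, aeval_conjEquiv, ← map_pow, ← map_mul,
          rePart_conjEquiv]
      have h4 : f z + f z = rePart ((c z * evalCoeffs z u) ^ 2) := by
        simp only [f]
        rw [mul_pow, hc, ← rePart_add]
        congr 1
        ring
      rw [hf, h4, pow_two, rePart_mul]
      simp only [w, t, if_neg hpos.ne', if_pos hpos, if_neg (hlow hpos).1, if_neg (hlow hpos).2,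
        conjEquiv_conjEquiv]
      ring
    have hpair : ∀ z, f z + f (conjEquiv R z) =
        w z * (t u z) ^ 2 + w (conjEquiv R z) * (t u (conjEquiv R z)) ^ 2 := by
      intro z
      rcases lt_trichotomy (imPart z) 0 with h | h | h
      · have := hupper (conjEquiv R z) (by rw [imPart_conjEquiv]; linarith)
        rw [conjEquiv_conjEquiv] at this
        rw [add_comm, this, add_comm]
      · have h5 : f z = w z * (t u z) ^ 2 := by
          simp only [f, w, t, if_pos h]
          have h6 := eq_algebraMap_of_imPart_eq_zero (imPart_evalCoeffs h u)
          rw [rePart_mul, pow_two, rePart_mul, imPart_mul, imPart_evalCoeffs h u]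
          ring
        rw [conjEquiv_eq_self h, h5]
      · exact hupper z h
    have h7 : ∑ z ∈ Z, (f z + f (conjEquiv R z)) = ∑ z ∈ Z, (w z * (t u z) ^ 2 +
        w (conjEquiv R z) * (t u (conjEquiv R z)) ^ 2) :=
      Finset.sum_congr rfl fun z _ => hpair z
    rw [Finset.sum_add_distrib, Finset.sum_add_distrib, hperm f,
      hperm fun z => w z * (t u z) ^ 2] at h7
    linarith
  rw [sigPos_eq_ncard (matForm M) T hinj (by simp [hr]) (fun z => w z) hdiag,
    ← Finset.card_union_of_disjoint]
  · rw [← Set.ncard_coe_finset, ← Set.ncard_image_of_injective _ Subtype.val_injective]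
    congr 1
    ext z
    simp only [Set.mem_image, Set.mem_ofPred_eq, Subtype.exists, exists_and_right, exists_eq_right,
      Finset.coe_union, Finset.coe_filter, Set.mem_union, ← and_or_left]
    constructor
    · rintro ⟨hz, hw⟩
      refine ⟨hz, ?_⟩
      simp only [w] at hw
      split_ifs at hw with h1 h2
      · exact Or.inl ⟨h1, hw⟩
      · exact Or.inr h2
      · linarith
    · rintro ⟨hz, ⟨h1, h2⟩ | h1⟩
      · exact ⟨hz, by simpa only [w, if_pos h1] using h2⟩
      · refine ⟨hz, ?_⟩
        simp only [w, if_neg h1.ne', if_pos h1, zero_lt_one]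
  · rw [Finset.disjoint_filter]
    rintro z _ ⟨h1, _⟩ h2
    exact h2.ne' h1

open Classical in
theorem card_conj_stable (Z : Finset (AlgebraicClosure R)) (hconj : ∀ z ∈ Z, conjEquiv R z ∈ Z) :
    (Z.filter fun z => imPart z = 0).card + 2 * (Z.filter fun z => 0 < imPart z).card = Z.card := by
  have h1 : (Z.filter fun z => imPart z < 0).card = (Z.filter fun z => 0 < imPart z).card := by
    refine Finset.card_bij (fun z _ => conjEquiv R z) (fun z hz => ?_)
      (fun _ _ _ _ h => (conjEquiv R).injective h) fun z hz => ?_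
    · rw [Finset.mem_filter] at hz ⊢
      exact ⟨hconj z hz.1, by rw [imPart_conjEquiv]; linarith [hz.2]⟩
    · rw [Finset.mem_filter] at hz
      refine ⟨conjEquiv R z, ?_, conjEquiv_conjEquiv z⟩
      rw [Finset.mem_filter]
      exact ⟨hconj z hz.1, by rw [imPart_conjEquiv]; linarith [hz.2]⟩
  have h2 : Z = (Z.filter fun z => imPart z = 0) ∪ ((Z.filter fun z => 0 < imPart z) ∪
      (Z.filter fun z => imPart z < 0)) := by
    ext z
    simp only [Finset.mem_union, Finset.mem_filter, ← and_or_left]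
    rcases lt_trichotomy (imPart z) 0 with h | h | h <;> simp [h]
  conv_rhs => rw [h2]
  rw [Finset.card_union_of_disjoint, Finset.card_union_of_disjoint, h1, two_mul]
  · rw [Finset.disjoint_filter]; intro z _ h3 h4; linarith
  · rw [Finset.disjoint_union_right, Finset.disjoint_filter, Finset.disjoint_filter]
    exact ⟨fun z _ h3 h4 => h4.ne' h3, fun z _ h3 h4 => h4.ne h3⟩

/-- The Hermite matrix of `q` with respect to `F`, as a matrix of traces. -/
def traceMatrix {A : Type*} [CommRing A] (F q : A[X]) (r : ℕ) : Matrix (Fin r) (Fin r) A :=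
  Matrix.of fun i j =>
    Algebra.trace A (AdjoinRoot F) (AdjoinRoot.mk F (q * X ^ ((i : ℕ) + (j : ℕ))))

open Classical in
/-- The distinct roots of `F` in `R[i]`. -/
def complexRoots (F : R[X]) : Finset (AlgebraicClosure R) :=
  (F.map (algebraMap R (AlgebraicClosure R))).roots.toFinset

theorem mem_complexRoots {F : R[X]} (hF : F ≠ 0) {z : AlgebraicClosure R} :
    z ∈ complexRoots F ↔ aeval z F = 0 := by
  classical
  rw [complexRoots, Multiset.mem_toFinset, mem_roots (map_ne_zero hF), IsRoot, eval_map_algebraMap]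

theorem conjEquiv_mem_complexRoots {F : R[X]} (hF : F ≠ 0) {z : AlgebraicClosure R}
    (hz : z ∈ complexRoots F) : conjEquiv R z ∈ complexRoots F := by
  rw [mem_complexRoots hF] at hz ⊢
  rw [aeval_conjEquiv, hz, map_zero]

theorem card_complexRoots {F : R[X]} (hF : F.Separable) :
    (complexRoots F).card = F.natDegree := by
  classical
  rw [complexRoots, Multiset.toFinset_card_of_nodup (nodup_roots hF.map),
    ← (IsAlgClosed.splits _).natDegree_eq_card_roots, natDegree_map]

theorem algebraMap_traceMatrix {A : Type*} [CommRing A] {F : A[X]} (hF : F.Monic) (φ : A →+* R)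
    (hsep : (F.map φ).Separable) (q : A[X]) {r : ℕ} (i j : Fin r) :
    algebraMap R (AlgebraicClosure R) (φ (traceMatrix F q r i j)) =
      ∑ z ∈ complexRoots (F.map φ), aeval z (q.map φ) * z ^ ((i : ℕ) + j) := by
  classical
  have h := map_trace_adjoinRoot hF ((algebraMap R (AlgebraicClosure R)).comp φ)
    (q * X ^ ((i : ℕ) + (j : ℕ)))
  rw [RingHom.comp_apply] at h
  rw [traceMatrix, Matrix.of_apply, h, ← Polynomial.map_map, complexRoots,
    Finset.sum_eq_multiset_sum, Multiset.toFinset_val, (nodup_roots hsep.map).dedup]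
  refine congrArg Multiset.sum (Multiset.map_congr (by rw [Polynomial.map_map]) fun z _ => ?_)
  rw [eval_map_algebraMap, Polynomial.map_mul, Polynomial.map_pow, map_X, map_mul, map_pow, aeval_X]

/-- Real roots of `F` with a property, counted among the roots in `R[i]`. -/
theorem card_filter_complexRoots {F : R[X]} (hF : F ≠ 0) (P : R → Prop) [DecidablePred P] :
    ((complexRoots F).filter fun z => imPart z = 0 ∧ P (rePart z)).card =
      (F.roots.toFinset.filter P).card := by
  refine (Finset.card_bij (fun x _ => algebraMap R (AlgebraicClosure R) x) (fun x hx => ?_)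
    (fun _ _ _ _ h => (algebraMap R (AlgebraicClosure R)).injective h) fun z hz => ?_).symm
  · rw [Finset.mem_filter, Multiset.mem_toFinset, mem_roots hF, IsRoot] at hx
    rw [Finset.mem_filter, mem_complexRoots hF, aeval_algebraMap_apply, coe_aeval_eq_eval, hx.1]
    simpa using hx.2
  · rw [Finset.mem_filter, mem_complexRoots hF] at hz
    obtain ⟨h1, h2, h3⟩ := hz
    rw [eq_algebraMap_of_imPart_eq_zero h2, aeval_algebraMap_apply, coe_aeval_eq_eval,
      map_eq_zero_iff _ (algebraMap R (AlgebraicClosure R)).injective] at h1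
    refine ⟨rePart z, ?_, (eq_algebraMap_of_imPart_eq_zero h2).symm⟩
    rw [Finset.mem_filter, Multiset.mem_toFinset, mem_roots hF]
    exact ⟨h1, h3⟩

variable {A : Type*} [CommRing A] {F : A[X]} {φ : A →+* R}

/-- The number `p` of positive squares of the trace form determines the number of real roots: there
are `r - p` pairs of conjugate roots, each contributing one positive square. -/
theorem sigPos_traceMatrix_one (hF : F.Monic) (hsep : (F.map φ).Separable) {r : ℕ}
    (hr : F.natDegree = r) :
    2 * sigPos (matForm ((traceMatrix F 1 r).map φ)) = (F.map φ).roots.toFinset.card + r := by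
  classical
  have hF0 : F.map φ ≠ 0 := (hF.map φ).ne_zero
  have hcard : (complexRoots (F.map φ)).card = r := by
    rw [card_complexRoots hsep, hF.natDegree_map, hr]
  have h := sigPos_hermite (complexRoots (F.map φ)) hcard
    (fun z hz => conjEquiv_mem_complexRoots hF0 hz) 1 (by simp)
    ((traceMatrix F 1 r).map φ) (fun i j => by
      have := algebraMap_traceMatrix hF φ hsep 1 i j
      simpa using this)
  have h1 := card_conj_stable (complexRoots (F.map φ))
    (fun z hz => conjEquiv_mem_complexRoots hF0 hz)
  have h2 := card_filter_complexRoots hF0 fun _ => True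
  have h4 : ∀ z : AlgebraicClosure R, 0 < rePart (aeval z (1 : R[X])) := fun z => by
    rw [map_one, ← map_one (algebraMap R (AlgebraicClosure R)), rePart_algebraMap]
    exact one_pos
  simp only [h4, and_true] at h
  simp only [and_true, Finset.filter_true] at h2
  rw [h, ← h2]
  omega

/-- The Hermite form of `X - θ` detects the real roots above `θ`. -/
theorem sigPos_traceMatrix_sub (hF : F.Monic) (hsep : (F.map φ).Separable) {r : ℕ}
    (hr : F.natDegree = r) (θ : A) :
    sigPos (matForm ((traceMatrix F (X - C θ) r).map φ)) +
      sigPos (matForm ((traceMatrix F 1 r).map φ)) =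
        ((F.map φ).roots.toFinset.filter fun x => φ θ < x).card + r := by
  have hF0 : F.map φ ≠ 0 := (hF.map φ).ne_zero
  have hcard : (complexRoots (F.map φ)).card = r := by
    rw [card_complexRoots hsep, hF.natDegree_map, hr]
  have hval (z : AlgebraicClosure R) :
      aeval z (X - C (φ θ)) = z + algebraMap R _ (-φ θ) := by
    simp [sub_eq_add_neg]
  have h := sigPos_hermite (complexRoots (F.map φ)) hcard
    (fun z hz => conjEquiv_mem_complexRoots hF0 hz) (X - C (φ θ)) (fun z _ hz h0 => hz (by
      have := congrArg imPart h0
      rw [hval, imPart_add, imPart_algebraMap, ← map_zero (algebraMap R (AlgebraicClosure R)),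
        imPart_algebraMap] at this
      linarith))
    ((traceMatrix F (X - C θ) r).map φ) (fun i j => by
      have := algebraMap_traceMatrix hF φ hsep (X - C θ) i j
      simpa using this)
  have h1 := card_conj_stable (complexRoots (F.map φ))
    (fun z hz => conjEquiv_mem_complexRoots hF0 hz)
  have h2 := card_filter_complexRoots hF0 fun x => φ θ < x
  have h2' := card_filter_complexRoots hF0 fun _ => True
  have h3 := sigPos_traceMatrix_one hF hsep hr
  have h4 : ∀ z : AlgebraicClosure R, 0 < rePart (aeval z (X - C (φ θ))) ↔ φ θ < rePart z :=
    fun z => by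
      rw [hval, rePart_add, rePart_algebraMap, ← sub_eq_add_neg, sub_pos]
  simp only [h4] at h
  simp only [and_true, Finset.filter_true] at h2'
  rw [← h2]
  omega

end RootCounting

section ParametricRootCounting

variable {R : Type*} [Field R] [LinearOrder R] [IsStrictOrderedRing R] [IsRealClosed R] {σ : Type*}
  {S : Set (σ → R)}

/-- Evaluation of regular functions at a point. -/
def evalAt (S : Set (σ → R)) (a : σ → R) : regularOn S →+* R :=
  (Pi.evalRingHom (fun _ => R) a).comp (regularOn S).subtype

theorem evalAt_apply (a : σ → R) (g : regularOn S) : evalAt S a g = (g : (σ → R) → R) a := rfl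

theorem isSemialgebraic_setOf_sigPos_traceMatrix (hS : IsSemialgebraic S) (F q : (regularOn S)[X])
    (r t : ℕ) :
    IsSemialgebraic {a ∈ S | sigPos (matForm ((traceMatrix F q r).map (evalAt S a))) = t} :=
  isSemialgebraic_setOf_sigPos_eq r S hS _ (fun i j => (traceMatrix F q r i j).2) (fun a _ => by
    ext i j
    show evalAt S a (traceMatrix F q r j i) = evalAt S a (traceMatrix F q r i j)
    simp only [traceMatrix, Matrix.of_apply, add_comm (i : ℕ)]) t

/-- The number of real roots of a separable polynomial with regular coefficients is a
semi-algebraic function of the parameters. -/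
theorem isSemialgebraic_setOf_card_roots (hS : IsSemialgebraic S) {F : (regularOn S)[X]}
    (hF : F.Monic) (hsep : ∀ a ∈ S, (F.map (evalAt S a)).Separable) (t : ℕ) :
    IsSemialgebraic {a ∈ S | (F.map (evalAt S a)).roots.toFinset.card = t} := by
  have h := IsSemialgebraic.biUnion (Set.toFinite {p : Fin (F.natDegree + 1) | 2 * (p : ℕ) =
    t + F.natDegree}) fun p _ => isSemialgebraic_setOf_sigPos_traceMatrix hS F 1 F.natDegree p
  convert h using 1
  ext a
  simp only [Set.mem_ofPred_eq, Set.mem_iUnion, exists_prop]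
  constructor
  · rintro ⟨ha, hat⟩
    have h1 := sigPos_traceMatrix_one hF (hsep a ha) rfl
    have h2 := sigPos_le_finrank (matForm ((traceMatrix F 1 F.natDegree).map (evalAt S a)))
    rw [Module.finrank_fin_fun] at h2
    exact ⟨⟨_, Nat.lt_succ_of_le h2⟩, by rw [h1, hat], ha, rfl⟩
  · rintro ⟨p, hp, ha, hap⟩
    have h1 := sigPos_traceMatrix_one hF (hsep a ha) rfl
    exact ⟨ha, by omega⟩

/-- The number of real roots above a regular function `θ` is a semi-algebraic function of the
parameters. -/
theorem isSemialgebraic_setOf_card_roots_gt (hS : IsSemialgebraic S) {F : (regularOn S)[X]}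
    (hF : F.Monic) (hsep : ∀ a ∈ S, (F.map (evalAt S a)).Separable) (θ : regularOn S) (t : ℕ) :
    IsSemialgebraic {a ∈ S | ((F.map (evalAt S a)).roots.toFinset.filter
      fun x => evalAt S a θ < x).card = t} := by
  have h := IsSemialgebraic.biUnion (Set.toFinite {p : Fin (F.natDegree + 1) × Fin (F.natDegree + 1) |
    (p.1 : ℕ) + p.2 = t + F.natDegree}) fun p _ =>
      (isSemialgebraic_setOf_sigPos_traceMatrix hS F (X - C θ) F.natDegree p.1).inter
        (isSemialgebraic_setOf_sigPos_traceMatrix hS F 1 F.natDegree p.2)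
  convert h using 1
  ext a
  simp only [Set.mem_ofPred_eq, Set.mem_iUnion, exists_prop, Set.mem_inter_iff]
  constructor
  · rintro ⟨ha, hat⟩
    have h1 := sigPos_traceMatrix_sub hF (hsep a ha) rfl θ
    have h2 := sigPos_le_finrank (matForm ((traceMatrix F 1 F.natDegree).map (evalAt S a)))
    have h3 := sigPos_le_finrank (matForm ((traceMatrix F (X - C θ) F.natDegree).map (evalAt S a)))
    rw [Module.finrank_fin_fun] at h2 h3
    exact ⟨⟨⟨_, Nat.lt_succ_of_le h3⟩, ⟨_, Nat.lt_succ_of_le h2⟩⟩, by rw [h1, hat], ⟨ha, rfl⟩, ha, rfl⟩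
  · rintro ⟨p, hp, ⟨ha, hap1⟩, -, hap2⟩
    have h1 := sigPos_traceMatrix_sub hF (hsep a ha) rfl θ
    exact ⟨ha, by omega⟩

end ParametricRootCounting

/-! ### Continuity of simple roots -/

section Continuity

open Filter Topology

variable {R : Type*} [Field R] [LinearOrder R] [IsStrictOrderedRing R] [IsRealClosed R]

/-- The `j`-th real root of `F` in ascending order (counted from zero), if there is one. -/
def sortedRoot (F : R[X]) (j : ℕ) : R :=
  if h : j < F.roots.toFinset.card then F.roots.toFinset.orderEmbOfFin rfl ⟨j, h⟩ else 0

theorem sortedRoot_eq {F : R[X]} {l : ℕ} (hl : F.roots.toFinset.card = l) (j : Fin l) :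
    sortedRoot F j = F.roots.toFinset.orderEmbOfFin hl j := by
  subst hl
  exact dif_pos j.2

theorem sortedRoot_eq_zero {F : R[X]} {j : ℕ} (hj : ¬ j < F.roots.toFinset.card) :
    sortedRoot F j = 0 := dif_neg hj

theorem card_filter_orderEmbOfFin_lt {s : Finset R} {l : ℕ} (hl : s.card = l) (j : Fin l) :
    (s.filter fun x => s.orderEmbOfFin hl j < x).card = l - 1 - j := by
  rw [← Fin.card_Ioi, ← Finset.card_map (s.orderEmbOfFin hl).toEmbedding]
  congr 1
  ext x
  simp only [Finset.mem_filter, Finset.mem_map, Finset.mem_Ioi]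
  constructor
  · rintro ⟨hx, hlt⟩
    have h : x ∈ Set.range (s.orderEmbOfFin hl) := by rwa [Finset.range_orderEmbOfFin]
    obtain ⟨i, rfl⟩ := h
    exact ⟨i, (s.orderEmbOfFin hl).lt_iff_lt.mp hlt, rfl⟩
  · rintro ⟨i, hi, rfl⟩
    exact ⟨Finset.orderEmbOfFin_mem _ _ _, (s.orderEmbOfFin hl).lt_iff_lt.mpr hi⟩

theorem eq_orderEmbOfFin_iff {s : Finset R} {l : ℕ} (hl : s.card = l) (j : Fin l) {x : R}
    (hx : x ∈ s) : x = s.orderEmbOfFin hl j ↔ (s.filter fun y => x < y).card = l - 1 - j := by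
  have h : x ∈ Set.range (s.orderEmbOfFin hl) := by rwa [Finset.range_orderEmbOfFin]
  obtain ⟨i, rfl⟩ := h
  rw [card_filter_orderEmbOfFin_lt, (s.orderEmbOfFin hl).injective.eq_iff, Fin.ext_iff]
  omega

variable [TopologicalSpace R] [OrderTopology R] {α : Type*} {u : Filter α}

theorem tendsto_eval {F : α → R[X]} {P : R[X]} {r : ℕ} (hF : ∀ a, (F a).natDegree ≤ r)
    (hP : P.natDegree ≤ r) (hcoeff : ∀ i, Tendsto (fun a => (F a).coeff i) u (𝓝 (P.coeff i)))
    (x : R) : Tendsto (fun a => (F a).eval x) u (𝓝 (P.eval x)) := by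
  rw [eval_eq_sum_range' (Nat.lt_succ_of_le hP)]
  simp only [fun a => eval_eq_sum_range' (Nat.lt_succ_of_le (hF a)) x]
  exact tendsto_finsetSum _ fun i _ => (hcoeff i).mul_const _

/-- Roots of polynomials close to `P` are close to roots of `P`. -/
theorem eventually_roots_near {F : α → R[X]} {P : R[X]} (hP : P.Monic)
    (hF : ∀ a, (F a).natDegree = P.natDegree)
    (hcoeff : ∀ i, Tendsto (fun a => (F a).coeff i) u (𝓝 (P.coeff i))) {ε : R} (hε : 0 < ε) :
    ∀ᶠ a in u, ∀ x, (F a).eval x = 0 → ∃ y, P.eval y = 0 ∧ |x - y| < ε := by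
  obtain ⟨κ, hκ, hbound⟩ := exists_lower_bound_away_from_roots P hP.ne_zero hε
  have h1 : Tendsto (fun a => ∑ i ∈ Finset.range (P.natDegree + 1), |(F a).coeff i - P.coeff i|) u
      (𝓝 0) := by
    have : Tendsto (fun a => ∑ i ∈ Finset.range (P.natDegree + 1), |(F a).coeff i - P.coeff i|) u
        (𝓝 (∑ i ∈ Finset.range (P.natDegree + 1), |P.coeff i - P.coeff i|)) :=
      tendsto_finsetSum _ fun i _ => ((hcoeff i).sub_const _).abs
    simpa using this
  filter_upwards [h1.eventually_lt_const hκ] with a ha x hx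
  by_contra! hfar
  have h2 := hbound x fun y hy => hfar y hy
  have h3 : |P.eval x| ≤ (∑ i ∈ Finset.range (P.natDegree + 1), |(F a).coeff i - P.coeff i|) *
      (1 + |x|) ^ P.natDegree := by
    have h4 : P.eval x = -∑ i ∈ Finset.range (P.natDegree + 1),
        ((F a).coeff i - P.coeff i) * x ^ i := by
      have h5 := eval_eq_sum_range' (Nat.lt_succ_self P.natDegree) x
      have h6 := eval_eq_sum_range' (Nat.lt_succ_of_le (hF a).le) x
      rw [hx] at h6
      simp only [sub_mul, Finset.sum_sub_distrib, Nat.succ_eq_add_one] at h5 h6 ⊢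
      rw [← h5, ← h6]
      ring
    rw [h4, abs_neg, Finset.sum_mul]
    refine (Finset.abs_sum_le_sum_abs _ _).trans (Finset.sum_le_sum fun i hi => ?_)
    rw [abs_mul, abs_pow]
    refine mul_le_mul_of_nonneg_left ?_ (abs_nonneg _)
    calc |x| ^ i ≤ (1 + |x|) ^ i := by gcongr; linarith
      _ ≤ (1 + |x|) ^ P.natDegree :=
        pow_le_pow_right₀ (by linarith [abs_nonneg x]) (by
          have := Finset.mem_range.mp hi
          omega)
  have h7 : (∑ i ∈ Finset.range (P.natDegree + 1), |(F a).coeff i - P.coeff i|) *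
      (1 + |x|) ^ P.natDegree < κ * (1 + |x|) ^ P.natDegree :=
    mul_lt_mul_of_pos_right ha (by positivity)
  linarith

/-- Near a simple root of `P`, polynomials close to `P` have at most one root: the divided
difference does not vanish, since its limit is the derivative of `P` at the root. -/
theorem eventually_root_unique {F : α → R[X]} {P : R[X]} (hF : ∀ a, (F a).natDegree = P.natDegree)
    (hcoeff : ∀ i, Tendsto (fun a => (F a).coeff i) u (𝓝 (P.coeff i))) {y : R}
    (hy : P.derivative.eval y ≠ 0) :
    ∃ δ > 0, ∀ᶠ a in u, ∀ x x', |x - y| < δ → |x' - y| < δ → (F a).eval x = 0 →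
      (F a).eval x' = 0 → x = x' := by
  let D : α × R × R → R := fun p => ∑ i ∈ Finset.range (P.natDegree + 1),
    (F p.1).coeff i * ∑ j ∈ Finset.range i, p.2.1 ^ j * p.2.2 ^ (i - 1 - j)
  have hD : Tendsto D (u ×ˢ (𝓝 y ×ˢ 𝓝 y)) (𝓝 (P.derivative.eval y)) := by
    have h1 : P.derivative.eval y = ∑ i ∈ Finset.range (P.natDegree + 1),
        P.coeff i * ∑ j ∈ Finset.range i, y ^ j * y ^ (i - 1 - j) := by
      rw [derivative_eval, sum_over_range _ (by simp)]
      refine Finset.sum_congr rfl fun i _ => ?_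
      have h2 : ∀ j ∈ Finset.range i, y ^ j * y ^ (i - 1 - j) = y ^ (i - 1) := fun j hj => by
        rw [← pow_add]
        congr 1
        have := Finset.mem_range.mp hj
        omega
      rw [Finset.sum_congr rfl h2, Finset.sum_const, Finset.card_range, nsmul_eq_mul]
      ring
    rw [h1]
    refine tendsto_finsetSum _ fun i _ => ((hcoeff i).comp tendsto_fst).mul
      (tendsto_finsetSum _ fun j _ => ?_)
    exact ((tendsto_fst.comp tendsto_snd).pow j).mul ((tendsto_snd.comp tendsto_snd).pow _)
  obtain ⟨pa, hpa, pb, hpb, hpab⟩ := eventually_prod_iff.mp (hD.eventually_ne hy)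
  rw [← nhds_prod_eq] at hpb
  obtain ⟨qa, hqa, qb, hqb, hqab⟩ := eventually_prod_iff.mp (nhds_prod_eq (x := y) (y := y) ▸ hpb)
  obtain ⟨δ₁, hδ₁, h1⟩ := (nhds_basis_abs_sub_lt y).eventually_iff.mp hqa
  obtain ⟨δ₂, hδ₂, h2⟩ := (nhds_basis_abs_sub_lt y).eventually_iff.mp hqb
  refine ⟨min δ₁ δ₂, lt_min hδ₁ hδ₂, ?_⟩
  filter_upwards [hpa] with a ha x x' hx hx' h3 h4
  have hne : D (a, x, x') ≠ 0 := hpab ha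
    (hqab (h1 (hx.trans_le (min_le_left _ _))) (h2 (hx'.trans_le (min_le_right _ _))))
  have h5 : (F a).eval x - (F a).eval x' = D (a, x, x') * (x - x') := by
    rw [eval_eq_sum_range' (Nat.lt_succ_of_le (hF a).le),
      eval_eq_sum_range' (Nat.lt_succ_of_le (hF a).le), ← Finset.sum_sub_distrib, Finset.sum_mul]
    refine Finset.sum_congr rfl fun i _ => ?_
    rw [mul_assoc, (Commute.all x x').geom_sum₂_mul i]
    ring
  rw [h3, h4, sub_zero] at h5
  exact sub_eq_zero.mp ((mul_eq_zero.mp h5.symm).resolve_left hne)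

/-- Near a simple root of `P`, polynomials close to `P` have a root, since `P` changes sign. -/
theorem eventually_exists_root {F : α → R[X]} {P : R[X]} (hF : ∀ a, (F a).natDegree = P.natDegree)
    (hcoeff : ∀ i, Tendsto (fun a => (F a).coeff i) u (𝓝 (P.coeff i))) {y : R}
    (hy : P.eval y = 0) (hy' : P.derivative.eval y ≠ 0) {δ : R} (hδ : 0 < δ) :
    ∀ᶠ a in u, ∃ x, |x - y| < δ ∧ (F a).eval x = 0 := by
  obtain ⟨Q, hQ⟩ := dvd_iff_isRoot.mpr hy
  have hQy : Q.eval y ≠ 0 := by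
    rw [hQ, derivative_mul] at hy'
    simpa using hy'
  have h1 : Tendsto (fun t => Q.eval (y - t) * Q.eval (y + t)) (𝓝[>] 0)
      (𝓝 (Q.eval y * Q.eval y)) := by
    have : Continuous fun t => Q.eval (y - t) * Q.eval (y + t) :=
      (Q.continuous.comp (continuous_const.sub continuous_id)).mul
        (Q.continuous.comp (continuous_const.add continuous_id))
    have h := this.tendsto 0
    simp only [sub_zero, add_zero] at h
    exact h.mono_left nhdsWithin_le_nhds
  obtain ⟨t, h2, ht0, htδ⟩ := ((h1.eventually_const_lt (mul_self_pos.mpr hQy)).and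
    (Ioo_mem_nhdsGT hδ)).exists
  have h3 : P.eval (y - t) * P.eval (y + t) < 0 := by
    rw [hQ]
    simp only [eval_mul, eval_sub, eval_X, eval_C]
    nlinarith [mul_pos (mul_pos ht0 ht0) h2]
  have h4 := (tendsto_eval (fun a => (hF a).le) le_rfl hcoeff (y - t)).mul
    (tendsto_eval (fun a => (hF a).le) le_rfl hcoeff (y + t))
  filter_upwards [h4.eventually_lt_const h3] with a ha
  by_contra! hno
  refine ha.not_gt (eval_mul_eval_pos_of_no_root (by linarith) (F a) fun x hx hx' => hno x ?_)
  rw [abs_lt]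
  constructor <;> linarith

/-- The real roots of a separable polynomial depend continuously on its coefficients, and their
number is locally constant. -/
theorem eventually_sortedRoot_near {F : α → R[X]} {P : R[X]} (hP : P.Monic) (hsep : P.Separable)
    (hFm : ∀ a, (F a).Monic) (hF : ∀ a, (F a).natDegree = P.natDegree)
    (hcoeff : ∀ i, Tendsto (fun a => (F a).coeff i) u (𝓝 (P.coeff i))) {ε : R} (hε : 0 < ε) :
    ∀ᶠ a in u, (F a).roots.toFinset.card = P.roots.toFinset.card ∧
      ∀ j, |sortedRoot (F a) j - sortedRoot P j| < ε := by
  have hmem {p : R[X]} (hp : p.Monic) {x : R} : x ∈ p.roots.toFinset ↔ p.eval x = 0 := by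
    rw [Multiset.mem_toFinset, mem_roots hp.ne_zero, IsRoot]
  have hsimple : ∀ y ∈ P.roots.toFinset, P.derivative.eval y ≠ 0 := fun y hy =>
    hsep.eval₂_derivative_ne_zero (RingHom.id R) ((hmem hP).mp hy)
  have huniq : ∀ y ∈ P.roots.toFinset, ∃ δ > 0, ∀ᶠ a in u, ∀ x x', |x - y| < δ → |x' - y| < δ →
      (F a).eval x = 0 → (F a).eval x' = 0 → x = x' :=
    fun y hy => eventually_root_unique hF hcoeff (hsimple y hy)
  choose! δ hδ huniq using huniq
  -- a radius for which the intervals around the roots of `P` are disjoint and uniqueness holds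
  obtain ⟨e, he0, heε, heδ, hgap⟩ : ∃ e > 0, e ≤ ε ∧ (∀ y ∈ P.roots.toFinset, e ≤ δ y) ∧
      ∀ y ∈ P.roots.toFinset, ∀ y' ∈ P.roots.toFinset, y < y' → 2 * e ≤ y' - y := by
    have hsmall {d : R} (hd : 0 < d) : ∀ᶠ e in 𝓝[>] (0 : R), e ≤ d :=
      mem_of_superset (Ioo_mem_nhdsGT hd) fun e he => he.2.le
    have h1 : ∀ᶠ e in 𝓝[>] (0 : R), ∀ y ∈ P.roots.toFinset, e ≤ δ y :=
      (Finset.eventually_all _).mpr fun y hy => hsmall (hδ y hy)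
    have h2 : ∀ᶠ e in 𝓝[>] (0 : R), ∀ y ∈ P.roots.toFinset, ∀ y' ∈ P.roots.toFinset,
        y < y' → 2 * e ≤ y' - y :=
      (Finset.eventually_all _).mpr fun y _ => (Finset.eventually_all _).mpr fun y' _ => by
        by_cases h : y < y'
        · filter_upwards [hsmall (half_pos (sub_pos.mpr h))] with e he _
          linarith
        · exact Eventually.of_forall fun e h' => absurd h' h
    have h0 : ∀ᶠ e in 𝓝[>] (0 : R), 0 < e := self_mem_nhdsWithin
    obtain ⟨e, ⟨⟨⟨he0, he1⟩, he2⟩, he3⟩⟩ := (((h0.and (hsmall hε)).and h1).and h2).exists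
    exact ⟨e, he0, he1, he2, he3⟩
  have hex : ∀ᶠ a in u, ∀ y ∈ P.roots.toFinset, ∃ x, |x - y| < e ∧ (F a).eval x = 0 :=
    (Finset.eventually_all _).mpr fun y hy =>
      eventually_exists_root hF hcoeff ((hmem hP).mp hy) (hsimple y hy) he0
  filter_upwards [hex, eventually_roots_near hP hF hcoeff he0,
    (Finset.eventually_all _).mpr huniq] with a hex hnear huniq
  choose! β hβ hβ0 using hex
  have hmono : ∀ y ∈ P.roots.toFinset, ∀ y' ∈ P.roots.toFinset, y < y' → β y < β y' := by
    intro y hy y' hy' hlt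
    have h1 := (abs_lt.mp (hβ y hy)).2
    have h2 := (abs_lt.mp (hβ y' hy')).1
    have h3 := hgap y hy y' hy' hlt
    linarith
  have hinj : Set.InjOn β P.roots.toFinset := by
    intro y hy y' hy' h
    rcases lt_trichotomy y y' with hlt | heq | hlt
    · exact absurd h (hmono y hy y' hy' hlt).ne
    · exact heq
    · exact absurd h (hmono y' hy' y hy hlt).ne'
  have himage : P.roots.toFinset.image β = (F a).roots.toFinset := by
    ext x
    rw [Finset.mem_image, hmem (hFm a)]
    constructor
    · rintro ⟨y, hy, rfl⟩
      exact hβ0 y hy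
    · intro hx
      obtain ⟨y, hy, hxy⟩ := hnear x hx
      have hy := (hmem hP).mpr hy
      exact ⟨y, hy, huniq y hy _ _ ((hβ y hy).trans_le (heδ y hy)) (hxy.trans_le (heδ y hy))
        (hβ0 y hy) hx⟩
  have hcard : (F a).roots.toFinset.card = P.roots.toFinset.card := by
    rw [← himage, Finset.card_image_of_injOn hinj]
  refine ⟨hcard, fun j => ?_⟩
  by_cases hj : j < P.roots.toFinset.card
  · have h1 := Finset.orderEmbOfFin_unique hcard
      (f := fun i => β (P.roots.toFinset.orderEmbOfFin rfl i))
      (fun i => by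
        rw [← himage]
        exact Finset.mem_image_of_mem β (Finset.orderEmbOfFin_mem _ _ _))
      (fun i i' hlt => hmono _ (Finset.orderEmbOfFin_mem _ _ _) _ (Finset.orderEmbOfFin_mem _ _ _)
        ((P.roots.toFinset.orderEmbOfFin rfl).strictMono hlt))
    have h2 := sortedRoot_eq hcard ⟨j, hj⟩
    have h3 := sortedRoot_eq (F := P) rfl ⟨j, hj⟩
    simp only at h2 h3
    rw [h2, h3, ← h1]
    exact (hβ _ (Finset.orderEmbOfFin_mem _ _ _)).trans_le heε
  · rw [sortedRoot_eq_zero hj, sortedRoot_eq_zero (hcard ▸ hj), sub_zero, abs_zero]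
    exact hε

end Continuity

/-! ### Sections over semi-algebraically connected sets -/

section Sections

open Filter Topology

variable {R : Type*} [Field R] [LinearOrder R] [IsStrictOrderedRing R] [IsRealClosed R]
  [TopologicalSpace R] [OrderTopology R] {n : ℕ} {S : Set (Fin n → R)}

theorem tendsto_coeff_map_evalAt (F : (regularOn S)[X]) (a : S) (i : ℕ) :
    Tendsto (fun b : S => (F.map (evalAt S b)).coeff i) (𝓝 a)
      (𝓝 ((F.map (evalAt S a)).coeff i)) := by
  simp only [coeff_map]
  exact ((continuousOn_iff_continuous_domRestrict.mp
    (continuousOn_of_mem_regularOn (F.coeff i).2)).tendsto a)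

theorem eventually_sortedRoot_map_near {F : (regularOn S)[X]} (hF : F.Monic)
    (hsep : ∀ a ∈ S, (F.map (evalAt S a)).Separable) (a : S) {ε : R} (hε : 0 < ε) :
    ∀ᶠ b : S in 𝓝 a, (F.map (evalAt S b)).roots.toFinset.card =
      (F.map (evalAt S a)).roots.toFinset.card ∧ ∀ j, |sortedRoot (F.map (evalAt S b)) j -
        sortedRoot (F.map (evalAt S a)) j| < ε :=
  eventually_sortedRoot_near (hF.map _) (hsep a a.2) (fun b => hF.map _)
    (fun b => by rw [hF.natDegree_map, hF.natDegree_map]) (tendsto_coeff_map_evalAt F a) hε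

/-- Over a semi-algebraically connected set the number of real roots of a separable polynomial is
constant, being locally constant and semi-algebraic. -/
theorem exists_card_roots_eq (hS : IsSemialgebraic S) (hconn : IsSemialgConnected S)
    {F : (regularOn S)[X]} (hF : F.Monic) (hsep : ∀ a ∈ S, (F.map (evalAt S a)).Separable) :
    ∃ l, ∀ a ∈ S, (F.map (evalAt S a)).roots.toFinset.card = l := by
  rcases S.eq_empty_or_nonempty with rfl | ⟨a₀, ha₀⟩
  · exact ⟨0, by simp⟩
  refine ⟨(F.map (evalAt S a₀)).roots.toFinset.card, fun a₁ ha₁ => ?_⟩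
  by_contra hne
  have hlc : IsLocallyConstant fun a : S => (F.map (evalAt S a)).roots.toFinset.card :=
    (IsLocallyConstant.iff_eventually_eq _).mpr fun a =>
      (eventually_sortedRoot_map_near hF hsep a one_pos).mono fun b hb => hb.1
  have hA := isSemialgebraic_setOf_card_roots hS hF hsep (F.map (evalAt S a₀)).roots.toFinset.card
  refine hconn ⟨_, _, hA, hS.diff hA, ⟨a₀, ha₀, rfl⟩, ⟨a₁, ha₁, fun h => hne h.2⟩,
    Set.disjoint_sdiff_right, Set.union_sdiff_cancel (fun a ha => ha.1), ?_, ?_⟩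
  · convert (hlc.isClopen_fiber (F.map (evalAt S a₀)).roots.toFinset.card).isClosed using 1
    ext a
    simp
  · convert (hlc.isClopen_fiber (F.map (evalAt S a₀)).roots.toFinset.card).compl.isClosed using 1
    ext a
    simp

/-- The cylinder over `S` in `R ^ (n + 1)`. -/
def cylinder (S : Set (Fin n → R)) : Set (Fin (n + 1) → R) := {t | t ∘ Fin.castSucc ∈ S}

/-- Regular functions on `S`, as functions on the cylinder. -/
def cylinderHom (S : Set (Fin n → R)) : regularOn S →+* regularOn (cylinder S) where
  toFun g := ⟨fun t => (g : (Fin n → R) → R) (t ∘ Fin.castSucc), comp_mem_regularOn g.2 _⟩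
  map_one' := rfl
  map_mul' _ _ := rfl
  map_zero' := rfl
  map_add' _ _ := rfl

theorem map_evalAt_cylinderHom (F : (regularOn S)[X]) (t : Fin (n + 1) → R) :
    (F.map (cylinderHom S)).map (evalAt (cylinder S) t) = F.map (evalAt S (Fin.init t)) := by
  rw [Polynomial.map_map]
  rfl

/-- The graph of the `j`-th root is semi-algebraic: the root is singled out by the number of roots
above it. -/
theorem isSemialgebraic_graph_sortedRoot (hS : IsSemialgebraic S) {F : (regularOn S)[X]}
    (hF : F.Monic) (hsep : ∀ a ∈ S, (F.map (evalAt S a)).Separable) {l : ℕ}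
    (hl : ∀ a ∈ S, (F.map (evalAt S a)).roots.toFinset.card = l) (j : Fin l) :
    IsSemialgebraic {t : Fin (n + 1) → R | Fin.init t ∈ S ∧
      t (Fin.last n) = sortedRoot (F.map (evalAt S (Fin.init t))) j} := by
  have hcyl : IsSemialgebraic (cylinder S) := hS.preimage_comp Fin.castSucc
  let θ : regularOn (cylinder S) := ⟨fun t => t (Fin.last n), apply_mem_regularOn _ _⟩
  have hsep' : ∀ t ∈ cylinder S,
      ((F.map (cylinderHom S)).map (evalAt (cylinder S) t)).Separable := fun t ht => by
    rw [map_evalAt_cylinderHom]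
    exact hsep _ ht
  have h1 := isSemialgebraic_setOf_card_roots_gt hcyl (hF.map (cylinderHom S)) hsep' θ (l - 1 - j)
  have h2 := isSemialgebraic_setOf_eq_zero hcyl ((F.map (cylinderHom S)).eval θ).2
  convert h2.inter h1 using 1
  ext t
  simp only [Set.mem_ofPred_eq, Set.mem_inter_iff, map_evalAt_cylinderHom]
  have h3 : (((F.map (cylinderHom S)).eval θ : regularOn (cylinder S)) : (Fin (n + 1) → R) → R) t =
      (F.map (evalAt S (Fin.init t))).eval (t (Fin.last n)) := by
    rw [← evalAt_apply, ← map_evalAt_cylinderHom, eval_map (evalAt (cylinder S) t),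
      show t (Fin.last n) = evalAt (cylinder S) t θ from rfl, eval₂_at_apply]
  have h4 : evalAt (cylinder S) t θ = t (Fin.last n) := rfl
  rw [h3, h4]
  constructor
  · rintro ⟨ht, hroot⟩
    rw [sortedRoot_eq (hl _ ht)] at hroot
    have hmem : t (Fin.last n) ∈ (F.map (evalAt S (Fin.init t))).roots.toFinset := by
      rw [hroot]; exact Finset.orderEmbOfFin_mem _ _ _
    refine ⟨⟨ht, ?_⟩, ht, (eq_orderEmbOfFin_iff (hl _ ht) j hmem).mp hroot⟩
    exact (mem_roots'.mp (Multiset.mem_toFinset.mp hmem)).2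
  · rintro ⟨⟨ht, hroot⟩, -, hcard⟩
    have ht' : Fin.init t ∈ S := ht
    have hmem : t (Fin.last n) ∈ (F.map (evalAt S (Fin.init t))).roots.toFinset :=
      Multiset.mem_toFinset.mpr ((mem_roots (hF.map _).ne_zero).mpr hroot)
    refine ⟨ht', ?_⟩
    rw [sortedRoot_eq (hl _ ht')]
    exact (eq_orderEmbOfFin_iff (hl _ ht') j hmem).mpr hcard

/-- The real roots of a separable polynomial with regular coefficients over a semi-algebraically
connected set are given by finitely many ascending continuous semi-algebraic sections. -/
theorem exists_sections (hS : IsSemialgebraic S) (hconn : IsSemialgConnected S)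
    {F : (regularOn S)[X]} (hF : F.Monic) (hsep : ∀ a ∈ S, (F.map (evalAt S a)).Separable) :
    ∃ (l : ℕ) (ξ : Fin l → (Fin n → R) → (Fin (n + 1) → R)),
      (∀ i, IsSemialgebraicFunOn S (ξ i) ∧ ContinuousOn (ξ i) S) ∧
      (∀ i, ∀ a ∈ S, (F.map (evalAt S a)).eval (ξ i a (Fin.last n)) = 0 ∧ Fin.init (ξ i a) = a) ∧
      (∀ i j, i < j → ∀ a ∈ S, ξ i a (Fin.last n) < ξ j a (Fin.last n)) ∧
      ∀ t : Fin (n + 1) → R, Fin.init t ∈ S →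
        (F.map (evalAt S (Fin.init t))).eval (t (Fin.last n)) = 0 →
        ∃! i, t = ξ i (Fin.init t) := by
  obtain ⟨l, hl⟩ := exists_card_roots_eq hS hconn hF hsep
  have hmem : ∀ a ∈ S, ∀ i : Fin l,
      sortedRoot (F.map (evalAt S a)) i ∈ (F.map (evalAt S a)).roots.toFinset := fun a ha i => by
    rw [sortedRoot_eq (hl a ha)]; exact Finset.orderEmbOfFin_mem _ _ _
  have hlt : ∀ a ∈ S, ∀ i j : Fin l, i < j →
      sortedRoot (F.map (evalAt S a)) i < sortedRoot (F.map (evalAt S a)) j := by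
    intro a ha i j hij
    rw [sortedRoot_eq (hl a ha), sortedRoot_eq (hl a ha)]
    exact (Finset.orderEmbOfFin _ _).strictMono hij
  refine ⟨l, fun i a => Fin.snoc (α := fun _ => R) a (sortedRoot (F.map (evalAt S a)) i),
    fun i => ⟨?_, ?_⟩, fun i a ha => ⟨?_, Fin.init_snoc _ _⟩, fun i j hij a ha => ?_,
    fun t ht hroot => ?_⟩
  · have h1 := (isSemialgebraic_graph_sortedRoot hS hF hsep hl i).preimage_comp
      (Fin.natAdd n : Fin (n + 1) → Fin (n + (n + 1)))
    have h2 : IsSemialgebraic (⋂ j ∈ (Set.univ : Set (Fin n)), {v : Fin (n + (n + 1)) → R |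
        MvPolynomial.eval v (MvPolynomial.X (Fin.natAdd n j.castSucc) -
          MvPolynomial.X (Fin.castAdd (n + 1) j)) = 0}) :=
      IsSemialgebraic.biInter Set.finite_univ fun j _ => isSemialgebraic_setOf_eval_eq_zero _
    unfold IsSemialgebraicFunOn
    beta_reduce
    convert h1.inter h2 using 1
    ext v
    simp only [Set.mem_ofPred_eq, Set.mem_inter_iff, Set.mem_iInter, Set.mem_univ, true_imp_iff,
      map_sub, MvPolynomial.eval_X, sub_eq_zero]
    constructor
    · rintro ⟨a, ha, rfl⟩
      have h3 : Fin.append a (Fin.snoc (α := fun _ => R) a (sortedRoot (F.map (evalAt S a)) i)) ∘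
          Fin.natAdd n = Fin.snoc (α := fun _ => R) a (sortedRoot (F.map (evalAt S a)) i) := by
        ext j; simp
      rw [h3, Fin.init_snoc, Fin.snoc_last]
      refine ⟨⟨ha, rfl⟩, fun j => ?_⟩
      rw [Fin.append_right, Fin.append_left, Fin.snoc_castSucc]
    · rintro ⟨⟨h3, h4⟩, h5⟩
      refine ⟨_, h3, ?_⟩
      ext j
      refine Fin.addCases (fun j => ?_) (fun j => ?_) j
      · rw [Fin.append_left, ← h5]; rfl
      · rw [Fin.append_right, ← h4, Fin.snoc_init_self]
        rfl
  · rw [continuousOn_iff_continuous_domRestrict]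
    refine continuous_pi fun j => ?_
    refine Fin.lastCases ?_ (fun j => ?_) j
    · rw [continuous_iff_continuousAt]
      intro a
      have h : (fun b : S => S.domRestrict (fun a => Fin.snoc (α := fun _ => R) a
          (sortedRoot (F.map (evalAt S a)) i)) b (Fin.last n)) =
          fun b : S => sortedRoot (F.map (evalAt S b)) i := by
        ext b; simp [Set.domRestrict]
      rw [h, ContinuousAt, (nhds_basis_abs_sub_lt _).tendsto_right_iff]
      exact fun ε hε => (eventually_sortedRoot_map_near hF hsep a hε).mono fun b hb => hb.2 i
    · have h : (fun b : S => S.domRestrict (fun a => Fin.snoc (α := fun _ => R) a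
          (sortedRoot (F.map (evalAt S a)) i)) b (Fin.castSucc j)) = fun b : S => (b : Fin n → R) j := by
        ext b; simp [Set.domRestrict]
      rw [h]
      exact (continuous_apply j).comp continuous_subtype_val
  · beta_reduce
    rw [Fin.snoc_last]
    exact (mem_roots'.mp (Multiset.mem_toFinset.mp (hmem a ha i))).2
  · beta_reduce
    rw [Fin.snoc_last, Fin.snoc_last]
    exact hlt a ha i j hij
  · have hx : t (Fin.last n) ∈ Set.range
        ((F.map (evalAt S (Fin.init t))).roots.toFinset.orderEmbOfFin (hl _ ht)) := by
      rw [Finset.range_orderEmbOfFin]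
      exact Multiset.mem_toFinset.mpr ((mem_roots (hF.map _).ne_zero).mpr hroot)
    obtain ⟨i, hi⟩ := hx
    rw [← sortedRoot_eq (hl _ ht)] at hi
    refine ⟨i, ?_, fun i' hi' => ?_⟩
    · simp only [hi, Fin.snoc_init_self]
    · have h1 : t (Fin.last n) = sortedRoot (F.map (evalAt S (Fin.init t))) i' := by
        have h2 := congrFun hi' (Fin.last n)
        beta_reduce at h2
        rwa [Fin.snoc_last] at h2
      rw [← hi] at h1
      rcases lt_trichotomy i i' with h | h | h
      · exact absurd h1 (hlt _ ht _ _ h).ne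
      · exact h.symm
      · exact absurd h1 (hlt _ ht _ _ h).ne'

end Sections

/-! ### The parametric Hermite form at a point -/

section HermitePoint

variable {k R : Type*} [Field k] [Field R] [Algebra k R] {n : ℕ}

theorem evalBase_toBase {J : Ideal (MvPolynomial (Fin n) k)} {w : MvPolynomial (Fin n) k}
    {p : Fin n → R} (hJ : p ∈ zeroLocus R J) (hw : MvPolynomial.aeval p w ≠ 0)
    (f : MvPolynomial (Fin n) k) :
    evalBase J w p hJ hw (toBase J w f) = MvPolynomial.aeval p f := by
  rw [evalBase, toBase, RingHom.comp_apply, IsLocalization.Away.lift_eq]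
  rfl

theorem toBase_eq_zero {J : Ideal (MvPolynomial (Fin n) k)} (w : MvPolynomial (Fin n) k)
    {f : MvPolynomial (Fin n) k} (hf : f ∈ J) : toBase J w f = 0 := by
  rw [toBase, RingHom.comp_apply, Ideal.Quotient.eq_zero_iff_mem.mpr hf, map_zero]

theorem isUnit_toBase (J : Ideal (MvPolynomial (Fin n) k)) (w : MvPolynomial (Fin n) k) :
    IsUnit (toBase J w w) :=
  IsLocalization.Away.algebraMap_isUnit (Ideal.Quotient.mk J w)

theorem exists_toBase_eq (J : Ideal (MvPolynomial (Fin n) k)) (w : MvPolynomial (Fin n) k)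
    (x : BaseRing J w) :
    ∃ (N : ℕ) (f : MvPolynomial (Fin n) k), toBase J w f = toBase J w w ^ N * x := by
  obtain ⟨N, a, ha⟩ := IsLocalization.Away.surj (Ideal.Quotient.mk J w) x
  obtain ⟨f, rfl⟩ := Ideal.Quotient.mk_surjective a
  refine ⟨N, f, ?_⟩
  rw [mul_comm]
  exact ha.symm

/-- The evaluation `A_w[x] → C` at a point `(p, z)`. -/
def fibreEval {J : Ideal (MvPolynomial (Fin n) k)} {w : MvPolynomial (Fin n) k} {p : Fin n → R}
    (hJ : p ∈ zeroLocus R J) (hw : MvPolynomial.aeval p w ≠ 0) (z : AlgebraicClosure R) :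
    (BaseRing J w)[X] →+* AlgebraicClosure R :=
  eval₂RingHom ((algebraMap R (AlgebraicClosure R)).comp (evalBase J w p hJ hw)) z

theorem fibreEval_map_toBase {J : Ideal (MvPolynomial (Fin n) k)} {w : MvPolynomial (Fin n) k}
    {p : Fin n → R} (hJ : p ∈ zeroLocus R J) (hw : MvPolynomial.aeval p w ≠ 0)
    (z : AlgebraicClosure R) (f : PolyYX k n) :
    fibreEval hJ hw z (f.map (toBase J w)) = aeval z (specialize p f) := by
  rw [fibreEval, coe_eval₂RingHom, eval₂_map, specialize, aeval_def, eval₂_map]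
  congr 1
  refine RingHom.ext fun x => ?_
  simp [evalBase_toBase]

variable {c : Input k n} {m : MonomialOrder (Fin n)} {G : Finset (PolyYX k n)}

/-- Over `A_w` the ideal `I` is generated by a monic polynomial of degree `s`, namely an element of
`G \ J` of minimal degree, divided by its leading coefficient. -/
theorem Input.ReachesHermite.exists_monic_generator (hG : c.ReachesHermite m G)
    [Nontrivial (BaseRing c.J (wPoly c.J G))] :
    ∃ f₀ : (BaseRing c.J (wPoly c.J G))[X], f₀.Monic ∧ f₀.natDegree = sDeg c.J G ∧
      c.I.map (Polynomial.mapRingHom (toBase c.J (wPoly c.J G))) = Ideal.span {f₀} := by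
  obtain ⟨g, hg, hdeg⟩ := hG.exists_natDegree_eq_sDeg
  have hunit : IsUnit (toBase c.J (wPoly c.J G) g.leadingCoeff) :=
    isUnit_of_dvd_unit (map_dvd _ (Finset.dvd_prod_of_mem _ hg)) (isUnit_toBase c.J (wPoly c.J G))
  set φ := toBase c.J (wPoly c.J G)
  obtain ⟨v, hv⟩ := hunit.exists_left_inv
  have hgdeg : (g.map φ).natDegree = g.natDegree :=
    natDegree_map_of_leadingCoeff_ne_zero φ hunit.ne_zero
  have hmonic : (C v * g.map φ).Monic :=
    monic_C_mul_of_mul_leadingCoeff_eq_one (by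
      rw [leadingCoeff_map_of_leadingCoeff_ne_zero φ hunit.ne_zero, hv])
  refine ⟨C v * g.map φ, hmonic, ?_, le_antisymm ?_ ?_⟩
  · rw [natDegree_C_mul_of_mul_ne_zero, hgdeg, hdeg]
    rw [leadingCoeff_map_of_leadingCoeff_ne_zero φ hunit.ne_zero, hv]
    exact one_ne_zero
  · rw [Ideal.map_le_iff_le_comap]
    intro f hf
    obtain ⟨N, hN⟩ := hG.exists_pow_mul_mem hg hdeg hf
    rw [Ideal.mem_comap]
    have h1 : Polynomial.mapRingHom φ (C (g.leadingCoeff ^ N) * f) ∈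
        Ideal.span {C v * g.map φ} := by
      have h2 : Ideal.span {g} ⊔ c.J.map (C : MvPolynomial (Fin n) k →+* PolyYX k n) ≤
          (Ideal.span {C v * g.map φ}).comap (Polynomial.mapRingHom φ) := by
        refine sup_le ?_ ?_
        · rw [Ideal.span_singleton_le_iff_mem, Ideal.mem_comap, Ideal.mem_span_singleton]
          refine ⟨C (φ g.leadingCoeff), ?_⟩
          rw [coe_mapRingHom, mul_right_comm, ← C_mul, hv, C_1, one_mul]
        · rw [Ideal.map_le_iff_le_comap]
          intro a ha
          rw [Ideal.mem_comap, Ideal.mem_comap, coe_mapRingHom, map_C, toBase_eq_zero _ ha, C_0]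
          exact zero_mem _
      exact h2 hN
    rw [map_mul, coe_mapRingHom, map_C, map_pow] at h1
    exact (Ideal.unit_mul_mem_iff_mem _ (isUnit_C.mpr (hunit.pow N))).mp h1
  · rw [Ideal.span_singleton_le_iff_mem]
    exact Ideal.mul_mem_left _ _ (Ideal.mem_map_of_mem (Polynomial.mapRingHom φ)
      (hG.basis.mem (mem_nonBase.mp hg).1))

theorem trace_quotient_eq_trace_adjoinRoot {A : Type*} [CommRing A] {𝔞 : Ideal A[X]} {f : A[X]}
    (h : 𝔞 = Ideal.span {f}) (q : A[X]) :
    Algebra.trace A (A[X] ⧸ 𝔞) (Ideal.Quotient.mk 𝔞 q) =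
      Algebra.trace A (AdjoinRoot f) (AdjoinRoot.mk f q) := by
  subst h
  rfl

/-- The trace of `L_{x ^ j h}`: the entries of the Hermite matrix are the values at `i + j`. -/
def Input.powerTrace (c : Input k n) (G : Finset (PolyYX k n)) (j : ℕ) :
    BaseRing c.J (wPoly c.J G) :=
  Algebra.trace _ (TotalRing c.J (wPoly c.J G) c.I)
    (Ideal.Quotient.mk _ (X ^ j * c.h.map (toBase c.J (wPoly c.J G))))

theorem Input.hermite_eq (c : Input k n) (G : Finset (PolyYX k n)) :
    c.hermite G = Matrix.of fun i j : Fin (sDeg c.J G) => c.powerTrace G ((i : ℕ) + j) := rfl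

theorem generator_eval₂_eq_zero_iff {J : Ideal (MvPolynomial (Fin n) k)}
    {w : MvPolynomial (Fin n) k} {I : Ideal (PolyYX k n)} {f₀ : (BaseRing J w)[X]}
    (hI : I.map (Polynomial.mapRingHom (toBase J w)) = Ideal.span {f₀}) {p : Fin n → R}
    (hJ : p ∈ zeroLocus R J) (hw : MvPolynomial.aeval p w ≠ 0) (z : AlgebraicClosure R) :
    f₀.eval₂ ((algebraMap R (AlgebraicClosure R)).comp (evalBase J w p hJ hw)) z = 0 ↔
      ∀ f ∈ I, aeval z (specialize p f) = 0 := by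
  have h1 : f₀.eval₂ ((algebraMap R (AlgebraicClosure R)).comp (evalBase J w p hJ hw)) z = 0 ↔
      Ideal.span {f₀} ≤ RingHom.ker (fibreEval hJ hw z) := by
    rw [Ideal.span_singleton_le_iff_mem, RingHom.mem_ker]
    rfl
  rw [h1, ← hI, Ideal.map_le_iff_le_comap]
  refine forall₂_congr fun f hf => ?_
  rw [Ideal.mem_comap, RingHom.mem_ker, coe_mapRingHom, fibreEval_map_toBase]

/-- The entries of the Hermite matrix at a point `p` of `V(J) ∩ D(w)` are power sums over the
geometric fibre above `p`, with non-zero weights: the weight of `z` is `h(p; z)` times the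
multiplicity of `z`. -/
theorem Input.ReachesHermite.exists_weights [CharZero R] (hG : c.ReachesHermite m G)
    {p : Fin n → R} (hJ : p ∈ zeroLocus R c.J)
    (hw : MvPolynomial.aeval p (wPoly c.J G) ≠ 0) :
    ∃ (Z : Finset (AlgebraicClosure R)) (d : AlgebraicClosure R → AlgebraicClosure R),
      (Z : Set (AlgebraicClosure R)) = geomFibre c.I c.h p ∧ (∀ z ∈ Z, d z ≠ 0) ∧
      Z.card ≤ sDeg c.J G ∧ ∀ j, algebraMap R (AlgebraicClosure R)
        (evalBase c.J (wPoly c.J G) p hJ hw (c.powerTrace G j)) = ∑ z ∈ Z, d z * z ^ j := by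
  classical
  have : Nontrivial (BaseRing c.J (wPoly c.J G)) :=
    (evalBase c.J (wPoly c.J G) p hJ hw).domain_nontrivial
  have : CharZero (AlgebraicClosure R) :=
    charZero_of_injective_algebraMap (algebraMap R (AlgebraicClosure R)).injective
  obtain ⟨f₀, hf₀, hdeg, hI⟩ := hG.exists_monic_generator
  set ψ := (algebraMap R (AlgebraicClosure R)).comp (evalBase c.J (wPoly c.J G) p hJ hw) with hψ
  have hroot : ∀ z, z ∈ (f₀.map ψ).roots ↔ ∀ f ∈ c.I, aeval z (specialize p f) = 0 := by
    intro z
    rw [mem_roots (hf₀.map ψ).ne_zero, IsRoot, eval_map]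
    exact generator_eval₂_eq_zero_iff hI hJ hw z
  let H : AlgebraicClosure R → AlgebraicClosure R := fun z => aeval z (specialize p c.h)
  refine ⟨(f₀.map ψ).roots.toFinset.filter fun z => H z ≠ 0,
    fun z => ((f₀.map ψ).roots.count z : AlgebraicClosure R) * H z, ?_, ?_, ?_, fun j => ?_⟩
  · ext z
    rw [Finset.mem_coe, Finset.mem_filter, Multiset.mem_toFinset, hroot]
    rfl
  · intro z hz
    rw [Finset.mem_filter, Multiset.mem_toFinset] at hz
    exact mul_ne_zero (Nat.cast_ne_zero.mpr (Multiset.count_pos.mpr hz.1).ne') hz.2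
  · refine (Finset.card_filter_le _ _).trans ((Multiset.toFinset_card_le _).trans ?_)
    refine (card_roots' _).trans ?_
    rw [hf₀.natDegree_map, hdeg]
  · have h1 : algebraMap R (AlgebraicClosure R)
        (evalBase c.J (wPoly c.J G) p hJ hw (c.powerTrace G j)) = ψ (c.powerTrace G j) := rfl
    rw [h1, Input.powerTrace, trace_quotient_eq_trace_adjoinRoot hI, map_trace_adjoinRoot hf₀,
      sum_map_roots_eq_sum_toFinset, Finset.sum_filter_of_ne]
    · refine Finset.sum_congr rfl fun z _ => ?_
      have h2 : ((X ^ j * c.h.map (toBase c.J (wPoly c.J G))).map ψ).eval z = z ^ j * H z := by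
        rw [Polynomial.map_mul, eval_mul, Polynomial.map_pow, map_X, eval_pow, eval_X, eval_map]
        exact congrArg _ (fibreEval_map_toBase hJ hw z c.h)
      rw [h2]
      ring
    · intro z _ hne h0
      beta_reduce at hne
      rw [h0, mul_zero, zero_mul] at hne
      exact hne rfl

/-- The rank of the Hermite form at a point is the number of points of the geometric fibre. -/
theorem Input.ReachesHermite.encard_geomFibre [CharZero R] (hG : c.ReachesHermite m G)
    {p : Fin n → R} (hJ : p ∈ zeroLocus R c.J)
    (hw : MvPolynomial.aeval p (wPoly c.J G) ≠ 0) :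
    (geomFibre c.I c.h p).encard =
      ((c.hermite G).map (evalBase c.J (wPoly c.J G) p hJ hw)).rank := by
  classical
  obtain ⟨Z, d, hZ, hd, hcard, htr⟩ := hG.exists_weights hJ hw
  rw [← hZ, Set.encard_coe_eq_coe_finsetCard,
    ← rank_map_algebraMap (L := AlgebraicClosure R), ← Finset.filter_true_of_mem hd,
    ← rank_hankel Z hcard d]
  congr 2
  ext i j
  exact (htr _).symm

/-- As `s > 0`, the ideal `I` has zeros above each point of `V(J) ∩ D(w)`. -/
theorem Input.ReachesHermite.geomFibre_one_nonempty (hG : c.ReachesHermite m G)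
    {p : Fin n → R} (hJ : p ∈ zeroLocus R c.J)
    (hw : MvPolynomial.aeval p (wPoly c.J G) ≠ 0) : (geomFibre c.I 1 p).Nonempty := by
  have : Nontrivial (BaseRing c.J (wPoly c.J G)) :=
    (evalBase c.J (wPoly c.J G) p hJ hw).domain_nontrivial
  obtain ⟨f₀, hf₀, hdeg, hI⟩ := hG.exists_monic_generator
  obtain ⟨g, hg, hgs⟩ := hG.exists_natDegree_eq_sDeg
  set ψ := (algebraMap R (AlgebraicClosure R)).comp (evalBase c.J (wPoly c.J G) p hJ hw)
  have hpos : 0 < (f₀.map ψ).natDegree := by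
    rw [hf₀.natDegree_map, hdeg, ← hgs]
    exact hG.natDegree_pos hg
  obtain ⟨z, hz⟩ := IsAlgClosed.exists_root (f₀.map ψ) (natDegree_pos_iff_degree_pos.mp hpos).ne'
  rw [IsRoot, eval_map] at hz
  exact ⟨z, (generator_eval₂_eq_zero_iff hI hJ hw z).mp hz, by simp [specialize]⟩

variable [LinearOrder R] [IsStrictOrderedRing R]

/-- The rank of the Hermite form at a point is read off from the characteristic polynomial. -/
theorem Input.rank_hermite_eq_iff (c : Input k n) (G : Finset (PolyYX k n)) {p : Fin n → R}
    (hJ : p ∈ zeroLocus R c.J) (hw : MvPolynomial.aeval p (wPoly c.J G) ≠ 0) {r : ℕ}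
    (hr : r ≤ sDeg c.J G) :
    ((c.hermite G).map (evalBase c.J (wPoly c.J G) p hJ hw)).rank = r ↔
      (∀ j < sDeg c.J G - r, evalBase c.J (wPoly c.J G) p hJ hw (c.charCoeff G j) = 0) ∧
      evalBase c.J (wPoly c.J G) p hJ hw (c.charCoeff G (sDeg c.J G - r)) ≠ 0 := by
  have hM : ((c.hermite G).map (evalBase c.J (wPoly c.J G) p hJ hw)).transpose =
      (c.hermite G).map (evalBase c.J (wPoly c.J G) p hJ hw) := by
    ext i j
    rw [Matrix.transpose_apply, Matrix.map_apply, Matrix.map_apply, Input.hermite_eq,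
      Matrix.of_apply, Matrix.of_apply, add_comm]
  rw [rank_eq_iff_charpoly_coeff _ hM hr, Matrix.charpoly_map]
  simp only [coeff_map]
  rfl

theorem Input.mem_piece_iff {c : Input k n} {G : Finset (PolyYX k n)}
    {e : ℕ → MvPolynomial (Fin n) k} (he : c.IsNumerators G e) {p : Fin n → R}
    (hJ : p ∈ zeroLocus R c.J) (hw : MvPolynomial.aeval p (wPoly c.J G) ≠ 0) {i : ℕ}
    (hi : i < sDeg c.J G) :
    p ∈ (c.piece G e i).points R ↔
      ((c.hermite G).map (evalBase c.J (wPoly c.J G) p hJ hw)).rank = sDeg c.J G - i := by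
  have he' : ∀ j < sDeg c.J G, MvPolynomial.aeval p (e j) = 0 ↔
      evalBase c.J (wPoly c.J G) p hJ hw (c.charCoeff G j) = 0 := by
    intro j hj
    obtain ⟨N, hN⟩ := he j hj
    have h1 := congrArg (evalBase c.J (wPoly c.J G) p hJ hw) hN
    rw [map_mul, map_pow, evalBase_toBase, evalBase_toBase] at h1
    rw [h1, mul_eq_zero, or_iff_right (pow_ne_zero N hw)]
  rw [c.rank_hermite_eq_iff G hJ hw (Nat.sub_le _ _), Nat.sub_sub_self hi.le]
  have h1 : p ∈ zeroLocus R (c.piece G e i).ideal ↔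
      ∀ j < i, MvPolynomial.aeval p (e j) = 0 := by
    constructor
    · intro h j hj
      exact h _ (Ideal.mem_sup_right (Ideal.subset_span ⟨j, hj, rfl⟩))
    · intro h f hf
      have h2 : c.J ⊔ Ideal.span (e '' {j | j < i}) ≤
          RingHom.ker (MvPolynomial.aeval p : MvPolynomial (Fin n) k →ₐ[k] R) := by
        refine sup_le (fun f hf => hJ f hf) (Ideal.span_le.mpr ?_)
        rintro _ ⟨j, hj, rfl⟩
        exact h j hj
      exact h2 hf
  have h2 : p ∈ (c.piece G e i).points R ↔ p ∈ zeroLocus R (c.piece G e i).ideal ∧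
      MvPolynomial.aeval p (wPoly c.J G * e i) ≠ 0 := Iff.rfl
  rw [h2, h1, map_mul, mul_ne_zero_iff, and_iff_right hw, Ne, he' i hi]
  exact and_congr_left' (forall₂_congr fun j hj => he' j (hj.trans hi))

end HermitePoint

/-! ### Delineability where the rank of the Hermite form is constant -/

section Delineability

variable {R : Type*} [Field R] [LinearOrder R] [IsStrictOrderedRing R] [IsRealClosed R] {n : ℕ}
  {S : Set (Fin n → R)}

/-- Cramer's rule for the Hankel system `∑ j, τ (i + j) v j = -τ (i + r)`, solved over all rings in
which `δ` becomes an inverse of the determinant. The solution is recorded as the coefficients of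
the monic polynomial `x ^ r + ∑ j, v j x ^ j`. -/
theorem exists_monic_of_hankel {A : Type*} [CommRing A] (τ : ℕ → A) (r : ℕ) (δ : A) :
    ∃ F : A[X], F.Monic ∧ F.natDegree ≤ r ∧ ∀ (L : Type*) [CommRing L] (φ : A →+* L),
      φ ((Matrix.of fun i j : Fin r => τ (i + j)).det * δ) = 1 → ∃ v : Fin r → L,
        (∀ z, (F.map φ).eval z = z ^ r + ∑ j : Fin r, v j * z ^ (j : ℕ)) ∧
        ∀ i : Fin r, φ (τ (i + r)) + ∑ j : Fin r, φ (τ (i + j)) * v j = 0 := by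
  set H : Matrix (Fin r) (Fin r) A := Matrix.of fun i j => τ (i + j) with hH
  let b : Fin r → A := fun i => τ (i + r)
  let u : Fin r → A := H.adjugate.mulVec b
  have hu : ∀ i : Fin r, ∑ j : Fin r, τ (i + j) * u j = H.det * τ (i + r) := by
    intro i
    have h1 : (H.mulVec (H.adjugate.mulVec b)) i = H.det * b i := by
      rw [Matrix.mulVec_mulVec, Matrix.mul_adjugate, Matrix.smul_mulVec, Matrix.one_mulVec]
      rfl
    exact h1
  have hlow : (∑ j : Fin r, C (-δ * u j) * X ^ (j : ℕ) : A[X]).degree < r := by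
    refine (degree_sum_le _ _).trans_lt ((Finset.sup_lt_iff (WithBot.bot_lt_coe r)).mpr
      fun j _ => (degree_C_mul_X_pow_le _ _).trans_lt (WithBot.coe_lt_coe.mpr j.2))
  refine ⟨X ^ r + ∑ j : Fin r, C (-δ * u j) * X ^ (j : ℕ), monic_X_pow_add hlow,
    natDegree_add_le_of_degree_le (natDegree_X_pow_le r) (natDegree_le_of_degree_le hlow.le),
    fun L _ φ hφ => ⟨fun j => φ (-δ * u j), fun z => ?_, fun i => ?_⟩⟩
  · simp [Polynomial.map_sum, eval_finsetSum]
  · have h1 : ∑ j : Fin r, φ (τ (i + j)) * φ (-δ * u j) =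
        -(φ δ * φ (∑ j : Fin r, τ (i + j) * u j)) := by
      rw [map_sum, Finset.mul_sum, ← Finset.sum_neg_distrib]
      refine Finset.sum_congr rfl fun j _ => ?_
      rw [map_mul, map_neg, map_mul]
      ring
    have h2 : φ δ * φ (H.det * τ (i + r)) = φ (H.det * δ) * φ (τ (i + r)) := by
      simp only [map_mul]
      ring
    rw [h1, hu, h2, hφ, one_mul, add_neg_cancel]

/-- Suppose that the specializations of `τ j` are power sums, with non-zero weights, over `r`
distinct points. Then these points are the roots of the specializations of a monic polynomial: by
Cramer's rule, its coefficients solve a system of linear equations with the Hankel matrix of the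
`τ (i + j)`, whose specializations are invertible. -/
theorem exists_separable_of_power_sums {ι A : Type*} [CommRing A] {ev : ι → A →+* R}
    (hinv : ∀ x, (∀ a, ev a x ≠ 0) → ∃ y, ∀ a, ev a (x * y) = 1) {τ : ℕ → A} {r : ℕ}
    {Z : ι → Finset (AlgebraicClosure R)}
    {d : ι → AlgebraicClosure R → AlgebraicClosure R}
    (hcard : ∀ a, (Z a).card = r) (hd : ∀ a, ∀ z ∈ Z a, d a z ≠ 0)
    (hτ : ∀ a j, algebraMap R (AlgebraicClosure R) (ev a (τ j)) =
      ∑ z ∈ Z a, d a z * z ^ j) :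
    ∃ F : A[X], F.Monic ∧ ∀ a, (F.map (ev a)).Separable ∧
      ∀ z, aeval z (F.map (ev a)) = 0 ↔ z ∈ Z a := by
  classical
  set H : Matrix (Fin r) (Fin r) A := Matrix.of fun i j => τ (i + j) with hH
  have hdet : ∀ a, ev a H.det ≠ 0 := by
    intro a h0
    have h1 : ((H.map (ev a)).map (algebraMap R (AlgebraicClosure R))).rank = r := by
      have h2 : (H.map (ev a)).map (algebraMap R (AlgebraicClosure R)) =
          Matrix.of fun i j : Fin r => ∑ z ∈ Z a, d a z * z ^ ((i : ℕ) + j) := by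
        ext i j
        exact hτ a _
      rw [h2, rank_hankel (Z a) (hcard a).le, Finset.filter_true_of_mem (hd a), hcard a]
    rw [rank_map_algebraMap, rank_eq_iff_charpoly_coeff _ (by
      ext i j
      simp only [Matrix.transpose_apply, Matrix.map_apply, hH, Matrix.of_apply, add_comm]) le_rfl,
      Nat.sub_self] at h1
    apply h1.2
    have h3 := Matrix.det_eq_sign_charpoly_coeff (H.map (ev a))
    have h4 : (H.map (ev a)).det = 0 := by
      rw [← h0, RingHom.map_det]
      rfl
    rw [h4] at h3
    exact (mul_eq_zero.mp h3.symm).resolve_left (pow_ne_zero _ (neg_ne_zero.mpr one_ne_zero))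
  obtain ⟨δ, hδ⟩ := hinv _ hdet
  obtain ⟨F, hF, hFdeg, hFv⟩ := exists_monic_of_hankel τ r δ
  have hroot : ∀ a, ∀ z ∈ Z a, aeval z (F.map (ev a)) = 0 := by
    intro a z hz
    obtain ⟨W, hW⟩ := exists_rightInverse_vandermonde (Z a) (hcard a).le
    obtain ⟨v, hv, hsys⟩ := hFv (AlgebraicClosure R)
      ((algebraMap R (AlgebraicClosure R)).comp (ev a)) (by rw [RingHom.comp_apply, hδ a, map_one])
    have heval : ∀ z, aeval z (F.map (ev a)) = z ^ r + ∑ j : Fin r, v j * z ^ (j : ℕ) := by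
      intro z
      rw [← hv, ← Polynomial.map_map, eval_map_algebraMap]
    let g : Z a → AlgebraicClosure R := fun z => d a z * aeval (z : AlgebraicClosure R)
      (F.map (ev a))
    -- the linear equations say that `g` annihilates the Vandermonde matrix
    have h1 : Matrix.vecMul g
        (Matrix.of fun (z : Z a) (i : Fin r) => (z : AlgebraicClosure R) ^ (i : ℕ)) = 0 := by
      ext i
      rw [Matrix.vecMul, dotProduct, Pi.zero_apply]
      have h2 := hsys i
      simp only [RingHom.comp_apply, hτ, Finset.sum_mul] at h2
      rw [Finset.sum_comm, ← Finset.sum_add_distrib] at h2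
      rw [← h2]
      simp only [g, Matrix.of_apply]
      rw [Finset.sum_coe_sort (Z a) (fun z => d a z * aeval z (F.map (ev a)) * z ^ (i : ℕ))]
      refine Finset.sum_congr rfl fun z _ => ?_
      rw [heval, mul_add, add_mul, Finset.mul_sum, Finset.sum_mul]
      congr 1
      · ring
      · refine Finset.sum_congr rfl fun j _ => ?_
        ring
    have h2 : g = 0 := by
      rw [← Matrix.vecMul_one g, ← hW, ← Matrix.vecMul_vecMul, h1, Matrix.zero_vecMul]
    exact (mul_eq_zero.mp (congrFun h2 ⟨z, hz⟩)).resolve_left (hd a z hz)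
  have hroots : ∀ a, (Z a).val = (F.map (ev a)).aroots (AlgebraicClosure R) := by
    intro a
    refine Multiset.eq_of_le_of_card_le ?_ ?_
    · rw [Finset.val_le_iff_val_subset]
      intro z hz
      rw [mem_aroots]
      exact ⟨(hF.map _).ne_zero, hroot a z hz⟩
    · rw [Finset.card_val, hcard a]
      exact (card_roots' _).trans (natDegree_map_le.trans (natDegree_map_le.trans hFdeg))
  refine ⟨F, hF, fun a => ⟨?_, fun z => ?_⟩⟩
  · rw [← nodup_aroots_iff_of_splits (K := AlgebraicClosure R) (hF.map _).ne_zero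
      (IsAlgClosed.splits _), ← hroots a]
    exact (Z a).nodup
  · rw [← Finset.mem_val, hroots a, mem_aroots, and_iff_right (hF.map _).ne_zero]

section

variable {K : Type*} [Field K] [Algebra K R]

theorem mem_realPoints_iff {I : Ideal (PolyYX K n)} {h : PolyYX K n} {t : Fin (n + 1) → R} :
    t ∈ realPoints R I h ↔
      algebraMap R (AlgebraicClosure R) (t (Fin.last n)) ∈ geomFibre I h (Fin.init t) := by
  simp only [realPoints, geomFibre, Set.mem_ofPred_eq, aeval_algebraMap_apply,
    map_eq_zero, coe_aeval_eq_eval, ne_eq]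

variable [TopologicalSpace R]

/-- The conditions on sections depend only on the geometric fibres. -/
theorem HasSections.congr {K' : Type*} [Field K'] [Algebra K' R] {I : Ideal (PolyYX K n)}
    {h : PolyYX K n} {I' : Ideal (PolyYX K' n)} {h' : PolyYX K' n} (H : HasSections I h S)
    (heq : ∀ a ∈ S, geomFibre I' h' a = geomFibre I h a) : HasSections I' h' S := by
  have hreal : ∀ t : Fin (n + 1) → R, Fin.init t ∈ S →
      (t ∈ realPoints R I' h' ↔ t ∈ realPoints R I h) := fun t ht => by
    rw [mem_realPoints_iff, mem_realPoints_iff, heq _ ht]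
  obtain ⟨⟨N, hN⟩, l, ξ, h1, h2, h3, h4⟩ := H
  refine ⟨⟨N, fun a ha => by rw [heq a ha, hN a ha]⟩, l, ξ, h1, fun i a ha => ?_, h3,
    fun t ht hts => h4 t ((hreal t hts).mp ht) hts⟩
  have h5 := h2 i a ha
  exact ⟨(hreal _ (by rw [h5.2]; exact ha)).mpr h5.1, h5.2⟩

theorem IsGeomDelineable.congr {I I' : Ideal (PolyYX K n)} {h h' : PolyYX K n}
    (H : IsGeomDelineable I h S) (heq : ∀ a ∈ S, geomFibre I' h' a = geomFibre I h a) :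
    IsGeomDelineable I' h' S := by
  rcases H with H | ⟨q, hq, H⟩
  · exact Or.inl (H.congr heq)
  · exact Or.inr ⟨q, fun a ha => (heq a ha).trans (hq a ha), H⟩

theorem hasSections_of_geomFibre_eq_empty {I : Ideal (PolyYX K n)} {h : PolyYX K n}
    (hempty : ∀ a ∈ S, geomFibre I h a = ∅) : HasSections I h S := by
  refine ⟨⟨0, fun a ha => by rw [hempty a ha]; simp⟩, 0, fun i => i.elim0, fun i => i.elim0,
    fun i => i.elim0, fun i => i.elim0, fun t ht hts => ?_⟩
  rw [mem_realPoints_iff, hempty _ hts] at ht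
  exact ht.elim

variable [OrderTopology R]

/-- If the points of the geometric fibres are the roots of a separable polynomial of constant
degree whose coefficients are regular on `S`, there are sections. -/
theorem hasSections_of_separable (hS : IsSemialgebraic S) (hconn : IsSemialgConnected S)
    {I : Ideal (PolyYX K n)} {h : PolyYX K n} {F : (regularOn S)[X]} (hF : F.Monic)
    (hsep : ∀ a ∈ S, (F.map (evalAt S a)).Separable)
    (hfib : ∀ a ∈ S, ∀ z, z ∈ geomFibre I h a ↔ aeval z (F.map (evalAt S a)) = 0) :
    HasSections I h S := by
  have hreal : ∀ t : Fin (n + 1) → R, Fin.init t ∈ S → (t ∈ realPoints R I h ↔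
      (F.map (evalAt S (Fin.init t))).eval (t (Fin.last n)) = 0) := by
    intro t ht
    rw [mem_realPoints_iff, hfib _ ht, aeval_algebraMap_apply, map_eq_zero, coe_aeval_eq_eval]
  refine ⟨⟨F.natDegree, fun a ha => ?_⟩, ?_⟩
  · have h1 : geomFibre I h a = complexRoots (F.map (evalAt S a)) := by
      ext z
      rw [hfib a ha, Finset.mem_coe, mem_complexRoots (hF.map _).ne_zero]
    rw [h1, Set.encard_coe_eq_coe_finsetCard, card_complexRoots (hsep a ha), hF.natDegree_map]
  · obtain ⟨l, ξ, h1, h2, h3, h4⟩ := exists_sections hS hconn hF hsep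
    refine ⟨l, ξ, h1, fun i a ha => ?_, h3, fun t ht hts => h4 t hts ((hreal t hts).mp ht)⟩
    have h5 := h2 i a ha
    refine ⟨(hreal _ (by rw [h5.2]; exact ha)).mpr ?_, h5.2⟩
    rw [h5.2]
    exact h5.1

end

variable {k : Type*} [Field k] [Algebra k R] {c : Input k n} {m : MonomialOrder (Fin n)}
  {G : Finset (PolyYX k n)}

open Classical in
/-- Elements of `A_w` give regular functions on subsets of `V(J) ∩ D(w)`; off this set the value
is set to zero. -/
theorem evalBase_mem_regularOn {J : Ideal (MvPolynomial (Fin n) k)}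
    {w : MvPolynomial (Fin n) k}
    (hS : ∀ a ∈ S, a ∈ zeroLocus R J ∧ MvPolynomial.aeval a w ≠ 0) (x : BaseRing J w) :
    (fun a => if h : a ∈ zeroLocus R J ∧ MvPolynomial.aeval a w ≠ 0 then
      evalBase J w a h.1 h.2 x else 0) ∈ regularOn S := by
  obtain ⟨N, f, hf⟩ := exists_toBase_eq J w x
  have heval : ∀ (a : Fin n → R) (q : MvPolynomial (Fin n) k),
      MvPolynomial.eval a (q.map (algebraMap k R)) = MvPolynomial.aeval a q := fun a q => by
    rw [MvPolynomial.eval_map, MvPolynomial.aeval_def]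
  refine ⟨f.map (algebraMap k R), (w ^ N).map (algebraMap k R), fun a ha => ?_⟩
  obtain ⟨hJ, hw⟩ := hS a ha
  beta_reduce
  rw [heval, heval, map_pow, dif_pos (show _ ∧ _ from ⟨hJ, hw⟩)]
  refine ⟨pow_ne_zero N hw, ?_⟩
  rw [eq_div_iff (pow_ne_zero N hw), ← evalBase_toBase hJ hw f, hf, map_mul, map_pow,
    evalBase_toBase, mul_comm]

variable [TopologicalSpace R] [OrderTopology R]

/-- Where the Hermite form has constant rank `r`, the geometric fibre is the set of roots of a
separable polynomial of degree `r`. -/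
theorem Input.ReachesHermite.hasSections (hG : c.ReachesHermite m G) (hS : IsSemialgebraic S)
    (hconn : IsSemialgConnected S)
    (hSw : ∀ a ∈ S, a ∈ zeroLocus R c.J ∧ MvPolynomial.aeval a (wPoly c.J G) ≠ 0) {r : ℕ}
    (hrank : ∀ a (ha : a ∈ S), ((c.hermite G).map
      (evalBase c.J (wPoly c.J G) a (hSw a ha).1 (hSw a ha).2)).rank = r) :
    HasSections c.I c.h S := by
  have hex : ∀ a : S, ∃ (Z : Finset (AlgebraicClosure R))
      (d : AlgebraicClosure R → AlgebraicClosure R),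
      (Z : Set (AlgebraicClosure R)) = geomFibre c.I c.h (a : Fin n → R) ∧ Z.card = r ∧
      (∀ z ∈ Z, d z ≠ 0) ∧ ∀ j, algebraMap R (AlgebraicClosure R) (evalAt S a
        ⟨_, evalBase_mem_regularOn hSw (c.powerTrace G j)⟩) = ∑ z ∈ Z, d z * z ^ j := by
    rintro ⟨a, ha⟩
    obtain ⟨Z, d, hZ, hd, -, htr⟩ := hG.exists_weights (hSw a ha).1 (hSw a ha).2
    refine ⟨Z, d, hZ, ?_, hd, fun j => ?_⟩
    · have h1 := hG.encard_geomFibre (hSw a ha).1 (hSw a ha).2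
      rw [← hZ, Set.encard_coe_eq_coe_finsetCard, hrank a ha] at h1
      exact_mod_cast h1
    · rw [← htr]
      exact congrArg _ (dif_pos (hSw a ha))
  choose Z d hZ hcard hd hτ using hex
  obtain ⟨F, hF, hroots⟩ := exists_separable_of_power_sums (ev := fun a : S => evalAt S a)
    (fun x hx => ⟨⟨_, inv_mem_regularOn x.2 fun a ha => hx ⟨a, ha⟩⟩,
      fun a => mul_inv_cancel₀ (hx a)⟩) hcard hd hτ
  refine hasSections_of_separable hS hconn hF (fun a ha => (hroots ⟨a, ha⟩).1) fun a ha z => ?_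
  rw [(hroots ⟨a, ha⟩).2, ← hZ ⟨a, ha⟩, Finset.mem_coe]

end Delineability

/-! ### Zeros of ideals and geometric fibres -/

section Zeros

variable {k R : Type*} [Field k] [Field R] [Algebra k R] {n : ℕ}

theorem mem_zeroLocus_iff_le_ker {𝔞 : Ideal (MvPolynomial (Fin n) k)} {p : Fin n → R} :
    p ∈ zeroLocus R 𝔞 ↔
      𝔞 ≤ RingHom.ker (MvPolynomial.aeval p : MvPolynomial (Fin n) k →ₐ[k] R) := Iff.rfl

theorem zeroLocus_anti {𝔞 𝔟 : Ideal (MvPolynomial (Fin n) k)} (h : 𝔞 ≤ 𝔟) :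
    zeroLocus R 𝔟 ⊆ zeroLocus R 𝔞 := fun _ hp f hf => hp f (h hf)

theorem mem_zeroLocus_sup_span_singleton {J : Ideal (MvPolynomial (Fin n) k)}
    {w : MvPolynomial (Fin n) k} {p : Fin n → R} (hJ : p ∈ zeroLocus R J)
    (hw : MvPolynomial.aeval p w = 0) : p ∈ zeroLocus R (J ⊔ Ideal.span {w}) := by
  rw [mem_zeroLocus_iff_le_ker, sup_le_iff, Ideal.span_singleton_le_iff_mem]
  exact ⟨hJ, hw⟩

/-- The evaluation `k[y, x] → C` at `(p, z)`. -/
def pointEval (p : Fin n → R) (z : AlgebraicClosure R) : PolyYX k n →+* AlgebraicClosure R :=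
  ((aeval z : R[X] →ₐ[R] AlgebraicClosure R) : R[X] →+* AlgebraicClosure R).comp
    (Polynomial.mapRingHom (MvPolynomial.aeval p : MvPolynomial (Fin n) k →ₐ[k] R).toRingHom)

theorem pointEval_C (p : Fin n → R) (z : AlgebraicClosure R) (f : MvPolynomial (Fin n) k) :
    pointEval p z (C f : PolyYX k n) =
      algebraMap R (AlgebraicClosure R) (MvPolynomial.aeval p f) := by
  rw [pointEval, RingHom.comp_apply, coe_mapRingHom, map_C]
  exact aeval_C _ _

theorem mem_geomFibre_iff {I : Ideal (PolyYX k n)} {h : PolyYX k n} {p : Fin n → R}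
    {z : AlgebraicClosure R} :
    z ∈ geomFibre I h p ↔ I ≤ RingHom.ker (pointEval p z) ∧ aeval z (specialize p h) ≠ 0 :=
  Iff.rfl

theorem map_C_le_ker_pointEval {𝔞 : Ideal (MvPolynomial (Fin n) k)} {p : Fin n → R}
    {z : AlgebraicClosure R} :
    𝔞.map (C : MvPolynomial (Fin n) k →+* PolyYX k n) ≤ RingHom.ker (pointEval p z) ↔
      p ∈ zeroLocus R 𝔞 := by
  rw [Ideal.map_le_iff_le_comap]
  refine forall₂_congr fun f hf => ?_
  rw [Ideal.mem_comap, RingHom.mem_ker, pointEval_C, map_eq_zero]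

theorem span_singleton_le_ker_pointEval {h : PolyYX k n} {p : Fin n → R}
    {z : AlgebraicClosure R} :
    Ideal.span {h} ≤ RingHom.ker (pointEval p z) ↔ aeval z (specialize p h) = 0 := by
  rw [Ideal.span_singleton_le_iff_mem]
  rfl

theorem aeval_specialize_one (p : Fin n → R) (z : AlgebraicClosure R) :
    aeval z (specialize p (1 : PolyYX k n)) = 1 := by
  simp [specialize]

theorem geomFibre_eq_empty_of_notMem {I : Ideal (PolyYX k n)} {p : Fin n → R}
    (hp : p ∉ zeroLocus R (I.comap (C : MvPolynomial (Fin n) k →+* PolyYX k n)))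
    (h : PolyYX k n) : geomFibre I h p = ∅ := by
  refine Set.eq_empty_of_forall_notMem fun z hz => hp ?_
  rw [← map_C_le_ker_pointEval (z := z)]
  exact Ideal.map_comap_le.trans (mem_geomFibre_iff.mp hz).1

theorem geomFibre_eq_empty_of_one_mem {I : Ideal (PolyYX k n)} (h1 : (1 : PolyYX k n) ∈ I)
    (h : PolyYX k n) (p : Fin n → R) : geomFibre I h p = ∅ := by
  refine geomFibre_eq_empty_of_notMem (fun hp => ?_) h
  exact one_ne_zero ((map_one _).symm.trans (hp 1 (by rwa [Ideal.mem_comap, C_1])))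

theorem geomFibre_restrict {c : Input k n} {P : Ideal (MvPolynomial (Fin n) k)} {p : Fin n → R}
    (hp : p ∈ zeroLocus R P) (h : PolyYX k n) :
    geomFibre (c.restrict P).I h p = geomFibre c.I h p := by
  ext z
  rw [mem_geomFibre_iff, mem_geomFibre_iff, Input.restrict, sup_le_iff, map_C_le_ker_pointEval,
    and_iff_right hp]

theorem aeval_specialize_map {h : PolyYX k n} {p : Fin n → R} {z : AlgebraicClosure R} :
    aeval z (specialize p (h.map (MvPolynomial.map (algebraMap k R)) : PolyYX R n)) =
      aeval z (specialize p h) := by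
  rw [specialize, specialize, Polynomial.map_map]
  congr 2
  refine RingHom.ext fun f => ?_
  simp [MvPolynomial.aeval_def]

end Zeros

/-! ### Prime decompositions -/

section PrimeDecomposition

variable {k R : Type*} [Field k] [Field R] [Algebra k R] {n : ℕ}
  {𝔞 : Ideal (MvPolynomial (Fin n) k)} {Ps : List (Ideal (MvPolynomial (Fin n) k))}

theorem IsPrimeDecomposition.le (h : IsPrimeDecomposition 𝔞 Ps)
    {P : Ideal (MvPolynomial (Fin n) k)} (hP : P ∈ Ps) : 𝔞 ≤ P :=
  Ideal.le_radical.trans (h.2.symm.trans_le (sInf_le hP))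

theorem IsPrimeDecomposition.exists_mem_zeroLocus (h : IsPrimeDecomposition 𝔞 Ps) {p : Fin n → R}
    (hp : p ∈ zeroLocus R 𝔞) : ∃ P ∈ Ps, p ∈ zeroLocus R P := by
  classical
  have hprime : (RingHom.ker (MvPolynomial.aeval p : MvPolynomial (Fin n) k →ₐ[k] R)).IsPrime :=
    RingHom.ker_isPrime _
  have h1 : Ps.toFinset.inf id ≤
      RingHom.ker (MvPolynomial.aeval p : MvPolynomial (Fin n) k →ₐ[k] R) := by
    have h2 : (Ps.toFinset : Set (Ideal (MvPolynomial (Fin n) k))) = {P | P ∈ Ps} := by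
      ext P; simp
    rw [Finset.inf_id_eq_sInf, h2, h.2, hprime.radical_le_iff]
    exact hp
  obtain ⟨P, hP, hle⟩ := hprime.inf_le'.mp h1
  exact ⟨P, List.mem_toFinset.mp hP, hle⟩

theorem exists_isPrimeDecomposition (𝔞 : Ideal (MvPolynomial (Fin n) k)) :
    ∃ Ps, IsPrimeDecomposition 𝔞 Ps := by
  have hfin := Ideal.finite_minimalPrimes_of_isNoetherianRing (MvPolynomial (Fin n) k) 𝔞
  refine ⟨hfin.toFinset.toList, fun P hP => ?_, ?_⟩
  · rw [Finset.mem_toList, Set.Finite.mem_toFinset] at hP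
    exact hP.1.1
  · rw [← Ideal.sInf_minimalPrimes]
    congr 1
    ext P
    simp

theorem exists_iUnion_points_eq_diff (J 𝔞 : Ideal (MvPolynomial (Fin n) k)) :
    ∃ Ls : List (BasicConstructible k n),
      ⋃ L ∈ Ls, L.points R = zeroLocus R J \ zeroLocus R 𝔞 := by
  obtain ⟨t, ht⟩ := (isNoetherianRing_iff_ideal_fg _).mp inferInstance 𝔞
  refine ⟨t.toList.map fun f => ⟨J, f⟩, ?_⟩
  ext p
  have h1 : p ∈ zeroLocus R 𝔞 ↔ ∀ f ∈ t, MvPolynomial.aeval p f = 0 := by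
    rw [mem_zeroLocus_iff_le_ker, ← ht, Ideal.span_le]
    rfl
  rw [Set.mem_sdiff, h1]
  simp only [List.mem_map, Finset.mem_toList, Set.iUnion_exists, Set.biUnion_and',
    Set.iUnion_iUnion_eq_right, Set.mem_iUnion, exists_prop, BasicConstructible.points,
    Set.mem_ofPred_eq]
  push Not
  tauto

end PrimeDecomposition

/-! ### Termination -/

section Termination

variable {k R : Type*} [Field k] [Field R] [Algebra k R] {n : ℕ} {c : Input k n}

theorem Input.isValid_restrict (c : Input k n) {P : Ideal (MvPolynomial (Fin n) k)}
    (hP : P.IsPrime) : (c.restrict P).IsValid :=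
  ⟨hP, Ideal.map_le_iff_le_comap.mp le_sup_left⟩

theorem Input.IsValid.sup_span (hc : c.IsValid) (h h' : PolyYX k n) :
    (⟨c.I ⊔ Ideal.span {h}, c.J, h'⟩ : Input k n).IsValid :=
  ⟨hc.1, hc.2.trans (Ideal.comap_mono le_sup_left)⟩

theorem Input.ReachesHermite.lt_of_mem {m : MonomialOrder (Fin n)} {G : Finset (PolyYX k n)}
    (hG : c.ReachesHermite m G) (hc : c.IsValid) {P : Ideal (MvPolynomial (Fin n) k)}
    (hP : c.J ⊔ Ideal.span {wPoly c.J G} ≤ P) : c.J < P := by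
  have := hc.1
  refine lt_of_le_of_ne (le_sup_left.trans hP) fun h => hG.wPoly_notMem ?_
  exact h.ge (hP (Ideal.mem_sup_right (Ideal.mem_span_singleton_self _)))

theorem Step.isValid {Ls : List (BasicConstructible k n)} {cs : List (Input k n)}
    (h : Step R c Ls cs) (hc : c.IsValid) : ∀ c' ∈ cs, c'.IsValid := by
  cases h with
  | empty => simp
  | notDominant _ _ _ _ Ps hPs =>
    simp only [List.mem_map, forall_exists_index, and_imp]
    rintro _ P hP rfl
    exact c.isValid_restrict (hPs.1 P hP)
  | notFinite =>
    simp only [List.mem_singleton, forall_eq]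
    exact hc.sup_span _ _
  | hermite m G hG e he Ps hPs =>
    simp only [List.mem_map, forall_exists_index, and_imp]
    rintro _ P hP rfl
    exact c.isValid_restrict (hPs.1 P hP)

/-- Every recursive call but the one on `(I + ⟨h⟩, J, 1)` strictly enlarges the prime ideal. -/
theorem Step.lt_or_eq {Ls : List (BasicConstructible k n)} {cs : List (Input k n)}
    (h : Step R c Ls cs) (hc : c.IsValid) : ∀ c' ∈ cs, c.J < c'.J ∨
      (1 : PolyYX k n) ∉ c.I ∧ c' = ⟨c.I ⊔ Ideal.span {c.h}, c.J, 1⟩ := by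
  cases h with
  | empty => simp
  | notDominant h1 hne _ _ Ps hPs =>
    simp only [List.mem_map, forall_exists_index, and_imp]
    rintro _ P hP rfl
    exact Or.inl ((lt_of_le_of_ne hc.2 hne.symm).trans_le (hPs.le hP))
  | notFinite h1 =>
    simp only [List.mem_singleton, forall_eq]
    exact Or.inr ⟨h1, trivial⟩
  | hermite m G hG e he Ps hPs =>
    simp only [List.mem_map, forall_exists_index, and_imp]
    rintro _ P hP rfl
    exact Or.inl (hG.lt_of_mem hc (hPs.le hP))

variable (R) in
theorem Input.exists_step (c : Input k n) : ∃ Ls cs, Step R c Ls cs := by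
  by_cases h1 : (1 : PolyYX k n) ∈ c.I
  · exact ⟨_, _, Step.empty c h1⟩
  by_cases heq : c.I.comap (C : MvPolynomial (Fin n) k →+* PolyYX k n) = c.J
  · let m : MonomialOrder.{0, 0} (Fin n) := MonomialOrder.lex
    obtain ⟨G, hG⟩ := exists_isReducedGroebnerBasis m c.I
    by_cases hsub : (G : Set (PolyYX k n)) ⊆
        Set.range (C : MvPolynomial (Fin n) k →+* PolyYX k n)
    · exact ⟨_, _, Step.notFinite c h1 heq m G hG hsub⟩
    · obtain ⟨Ps, hPs⟩ := exists_isPrimeDecomposition (c.J ⊔ Ideal.span {wPoly c.J G})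
      choose N e he using fun i => exists_toBase_eq c.J (wPoly c.J G) (c.charCoeff G i)
      exact ⟨_, _, Step.hermite c m G ⟨h1, heq, hG, hsub⟩ e (fun i _ => ⟨N i, he i⟩) Ps hPs⟩
  · obtain ⟨Ls, hLs⟩ := exists_iUnion_points_eq_diff (R := R) c.J
      (c.I.comap (C : MvPolynomial (Fin n) k →+* PolyYX k n))
    obtain ⟨Ps, hPs⟩ := exists_isPrimeDecomposition
      (c.I.comap (C : MvPolynomial (Fin n) k →+* PolyYX k n))
    exact ⟨_, _, Step.notDominant c h1 heq Ls hLs Ps hPs⟩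

variable (R) in
theorem Input.IsValid.terminates_of (hc : c.IsValid)
    (hJ : ∀ c' : Input k n, c'.IsValid → c.J < c'.J → Terminates R c')
    (hI : (1 : PolyYX k n) ∉ c.I → Terminates R ⟨c.I ⊔ Ideal.span {c.h}, c.J, 1⟩) :
    Terminates R c := by
  refine Terminates.intro c (c.exists_step R) fun Ls cs hstep c' hc' => ?_
  rcases hstep.lt_or_eq hc c' hc' with h | ⟨h1, rfl⟩
  · exact hJ c' (hstep.isValid hc c' hc') h
  · exact hI h1

/-- Noetherian induction, first on `J` and then on `I`. -/
theorem terminates_of_isValid (J : Ideal (MvPolynomial (Fin n) k)) (I : Ideal (PolyYX k n))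
    (h : PolyYX k n) (hc : (⟨I, J, h⟩ : Input k n).IsValid) :
    Terminates R (⟨I, J, h⟩ : Input k n) := by
  induction J using WellFoundedGT.induction generalizing I h with
  | _ J ihJ =>
    induction I using WellFoundedGT.induction generalizing h with
    | _ I ihI =>
      have ihJ' : ∀ c' : Input k n, c'.IsValid → J < c'.J → Terminates R c' :=
        fun c' hc' hlt => ihJ c'.J hlt c'.I c'.h hc'
      have hone : Terminates R (⟨I, J, 1⟩ : Input k n) := by
        refine Input.IsValid.terminates_of R (c := ⟨I, J, 1⟩) hc ihJ' fun h1 => ?_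
        refine ihI _ ?_ 1 (hc.sup_span 1 1)
        exact left_lt_sup.mpr fun hle => h1 (hle (Ideal.mem_span_singleton_self _))
      refine hc.terminates_of R ihJ' fun h1 => ?_
      by_cases hI : h ∈ I
      · have h2 : I ⊔ Ideal.span {h} = I :=
          sup_eq_left.mpr ((Ideal.span_singleton_le_iff_mem _).mpr hI)
        show Terminates R (⟨I ⊔ Ideal.span {h}, J, 1⟩ : Input k n)
        rw [h2]
        exact hone
      · refine ihI _ ?_ 1 (hc.sup_span h 1)
        exact left_lt_sup.mpr fun hle => hI (hle (Ideal.mem_span_singleton_self _))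

theorem Terminates.exists_run (h : Terminates R c) : ∃ out, Run R c out := by
  induction h with
  | intro c hex _ ih =>
    obtain ⟨Ls, cs, hstep⟩ := hex
    choose outs houts using fun i : Fin cs.length => ih Ls cs hstep (cs.get i) (cs.get_mem i)
    exact ⟨_, Run.intro c Ls cs hstep outs houts⟩

end Termination

/-! ### Correctness -/

section Correctness

variable {k R : Type*} [Field k] [Field R] [LinearOrder R] [IsStrictOrderedRing R]
  [IsRealClosed R] [TopologicalSpace R] [OrderTopology R] [Algebra k R] {n : ℕ}
  {S : Set (Fin n → R)}

variable (R) in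
/-- The invariant of the recursion. If `h = 1`, the output sets cover `V(J)`, also where the
geometric fibre of `V(I)` is empty; this is needed for the call on `(I + ⟨h⟩, J, 1)`, whose fibres
are the complements of the fibres of interest. -/
structure IsCorrect (c : Input k n) (out : List (BasicConstructible k n)) : Prop where
  delineable : ∀ L ∈ out, ∀ S ⊆ L.points R, IsSemialgebraic S → IsSemialgConnected S →
    IsGeomDelineable c.I c.h S
  subset : ∀ L ∈ out, L.points R ⊆ zeroLocus R c.J
  covers : ∀ p ∈ zeroLocus R c.J, (geomFibre c.I c.h p).Nonempty ∨ c.h = 1 →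
    ∃ L ∈ out, p ∈ L.points R

theorem isCorrect_of_one_mem {c : Input k n} (h1 : (1 : PolyYX k n) ∈ c.I) :
    IsCorrect R c [⟨c.J, 1⟩] := by
  have hpoints : BasicConstructible.points R ⟨c.J, 1⟩ = zeroLocus R c.J := by
    ext p
    simp [BasicConstructible.points]
  refine ⟨fun L _ S _ _ _ => Or.inl (hasSections_of_geomFibre_eq_empty fun a _ =>
    geomFibre_eq_empty_of_one_mem h1 _ _), ?_, fun p hp _ => ⟨_, List.mem_singleton_self _, ?_⟩⟩
  · simp [hpoints]
  · rwa [hpoints]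

/-- Calls on `(P k[y, x] + I, P, h)` for the primes `P` of a decomposition of an ideal `𝔞 ≥ J`
handle the part of the fibration above `V(𝔞)`. -/
theorem IsCorrect.of_restrict {c : Input k n} {𝔞 : Ideal (MvPolynomial (Fin n) k)} (hJ : c.J ≤ 𝔞)
    {Ls : List (BasicConstructible k n)}
    (hdel : ∀ L ∈ Ls, ∀ S ⊆ L.points R, IsSemialgebraic S → IsSemialgConnected S →
      IsGeomDelineable c.I c.h S)
    (hsub : ∀ L ∈ Ls, L.points R ⊆ zeroLocus R c.J)
    (hcov : ∀ p ∈ zeroLocus R c.J, p ∉ zeroLocus R 𝔞 →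
      (geomFibre c.I c.h p).Nonempty ∨ c.h = 1 → ∃ L ∈ Ls, p ∈ L.points R)
    {Ps : List (Ideal (MvPolynomial (Fin n) k))} (hPs : IsPrimeDecomposition 𝔞 Ps)
    {outs : Fin (Ps.map c.restrict).length → List (BasicConstructible k n)}
    (hrec : ∀ i, IsCorrect R ((Ps.map c.restrict).get i) (outs i)) :
    IsCorrect R c (Ls ++ (List.ofFn outs).flatten) := by
  have hmem : ∀ L, L ∈ Ls ++ (List.ofFn outs).flatten ↔ L ∈ Ls ∨ ∃ i, L ∈ outs i := by
    intro L
    simp only [List.mem_append, List.mem_flatten, List.mem_ofFn, exists_exists_eq_and]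
  have hget : ∀ i, ∃ P ∈ Ps, c.restrict P = (Ps.map c.restrict).get i := fun i =>
    List.mem_map.mp (List.get_mem _ i)
  refine ⟨fun L hL S hS hSa hSc => ?_, fun L hL => ?_, fun p hp hfib => ?_⟩
  · rcases (hmem L).mp hL with hL | ⟨i, hL⟩
    · exact hdel L hL S hS hSa hSc
    · obtain ⟨P, hP, hPi⟩ := hget i
      have h1 := hrec i
      rw [← hPi] at h1
      exact (h1.delineable L hL S hS hSa hSc).congr fun a ha =>
        (geomFibre_restrict (h1.subset L hL (hS ha)) _).symm
  · rcases (hmem L).mp hL with hL | ⟨i, hL⟩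
    · exact hsub L hL
    · obtain ⟨P, hP, hPi⟩ := hget i
      have h1 := hrec i
      rw [← hPi] at h1
      exact (h1.subset L hL).trans (zeroLocus_anti (hJ.trans (hPs.le hP)))
  · by_cases hpa : p ∈ zeroLocus R 𝔞
    · obtain ⟨P, hP, hpP⟩ := hPs.exists_mem_zeroLocus hpa
      obtain ⟨i, hi⟩ := List.get_of_mem (List.mem_map_of_mem (f := c.restrict) hP)
      have h1 := hrec i
      rw [hi] at h1
      obtain ⟨L, hL, hpL⟩ := h1.covers p hpP (by
        have h2 : geomFibre (c.restrict P).I (c.restrict P).h p = geomFibre c.I c.h p :=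
          geomFibre_restrict hpP _
        rw [h2]
        exact hfib)
      exact ⟨L, (hmem L).mpr (Or.inr ⟨i, hL⟩), hpL⟩
    · obtain ⟨L, hL, hpL⟩ := hcov p hp hpa hfib
      exact ⟨L, (hmem L).mpr (Or.inl hL), hpL⟩

theorem aeval_specialize_eq_zero_finite {h : PolyYX R n} {a : Fin n → R} {N : ℕ}
    (hN : (geomFibre (Ideal.span {h}) 1 a).encard = N) :
    {z : AlgebraicClosure R | aeval z (specialize a h) = 0}.Finite := by
  have h1 : {z : AlgebraicClosure R | aeval z (specialize a h) = 0} =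
      geomFibre (Ideal.span {h}) 1 a := by
    ext z
    rw [mem_geomFibre_iff, span_singleton_le_ker_pointEval, aeval_specialize_one]
    simp
  rw [h1]
  exact Set.finite_of_encard_eq_coe hN

/-- If `I` is generated by `J`, the fibres of `V(I) ∩ D(h)` above `V(J)` are the complements of
the fibres of `V(I + ⟨h⟩)`, so that `h` itself can serve as `h'` in the convention about `D(h')`. If
`V(I + ⟨h⟩)` is delineable by that convention, its fibres are complements of finite sets, hence
infinite; then `h` vanishes identically over the points considered. -/
theorem IsCorrect.of_sup_span {c : Input k n}
    (hI : c.I = c.J.map (C : MvPolynomial (Fin n) k →+* PolyYX k n))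
    {out : List (BasicConstructible k n)}
    (hrec : IsCorrect R ⟨c.I ⊔ Ideal.span {c.h}, c.J, 1⟩ out) : IsCorrect R c out := by
  have hfib : ∀ p ∈ zeroLocus R c.J, ∀ z : AlgebraicClosure R,
      z ∈ geomFibre c.I c.h p ↔ aeval z (specialize p c.h) ≠ 0 := by
    intro p hp z
    rw [mem_geomFibre_iff, hI, map_C_le_ker_pointEval, and_iff_right hp]
  have hfib' : ∀ p ∈ zeroLocus R c.J, ∀ z : AlgebraicClosure R,
      z ∈ geomFibre (c.I ⊔ Ideal.span {c.h}) 1 p ↔ aeval z (specialize p c.h) = 0 := by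
    intro p hp z
    rw [mem_geomFibre_iff, hI, sup_le_iff, map_C_le_ker_pointEval, and_iff_right hp,
      span_singleton_le_ker_pointEval, aeval_specialize_one]
    simp
  refine ⟨fun L hL S hS hSa hSc => ?_, hrec.subset, fun p hp _ => hrec.covers p hp (Or.inr rfl)⟩
  have hSJ : ∀ a ∈ S, a ∈ zeroLocus R c.J := fun a ha => hrec.subset L hL (hS ha)
  rcases hrec.delineable L hL S hS hSa hSc with H | ⟨q, hq, ⟨N, hN⟩, -⟩
  · refine Or.inr ⟨c.h.map (MvPolynomial.map (algebraMap k R)), fun a ha => ?_,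
      H.congr fun a ha => ?_⟩
    · ext z
      rw [hfib a (hSJ a ha), mem_geomFibre_iff, and_iff_right bot_le, aeval_specialize_map]
    · ext z
      rw [hfib' a (hSJ a ha), mem_geomFibre_iff, span_singleton_le_ker_pointEval,
        aeval_specialize_one, aeval_specialize_map]
      simp
  · refine Or.inl (hasSections_of_geomFibre_eq_empty fun a ha => ?_)
    have h1 : {z : AlgebraicClosure R | aeval z (specialize a c.h) = 0} =
        {z : AlgebraicClosure R | aeval z (specialize a q) = 0}ᶜ := by
      ext z
      have h2 := Set.ext_iff.mp (hq a ha) z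
      rw [hfib' a (hSJ a ha), mem_geomFibre_iff, and_iff_right bot_le] at h2
      exact h2
    have h3 : {z : AlgebraicClosure R | aeval z (specialize a c.h) = 0}.Infinite := by
      rw [h1]
      exact (aeval_specialize_eq_zero_finite (hN a ha)).infinite_compl
    have h4 : (specialize a c.h).map (algebraMap R (AlgebraicClosure R)) = 0 := by
      refine eq_zero_of_infinite_isRoot _ (h3.mono fun z hz => ?_)
      show IsRoot _ z
      rw [IsRoot, eval_map_algebraMap]
      exact hz
    refine Set.eq_empty_of_forall_notMem fun z hz => (hfib a (hSJ a ha) z).mp hz ?_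
    rw [← eval_map_algebraMap, h4, eval_zero]

theorem Step.isCorrect {c : Input k n} (hc : c.IsValid) {Ls : List (BasicConstructible k n)}
    {cs : List (Input k n)} (hstep : Step R c Ls cs)
    {outs : Fin cs.length → List (BasicConstructible k n)}
    (hrec : ∀ i, IsCorrect R (cs.get i) (outs i)) :
    IsCorrect R c (Ls ++ (List.ofFn outs).flatten) := by
  cases hstep with
  | empty h1 => simpa using isCorrect_of_one_mem h1
  | notDominant h1 hne _ hLs Ps hPs =>
    have hmem : ∀ p, (∃ L ∈ Ls, p ∈ L.points R) ↔ p ∈ zeroLocus R c.J ∧ p ∉ zeroLocus R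
        (c.I.comap (C : MvPolynomial (Fin n) k →+* PolyYX k n)) := by
      intro p
      rw [← Set.mem_sdiff, ← hLs]
      simp
    refine IsCorrect.of_restrict hc.2 (fun L hL S hS _ _ => Or.inl
      (hasSections_of_geomFibre_eq_empty fun a ha => ?_))
      (fun L hL p hp => ((hmem p).mp ⟨L, hL, hp⟩).1)
      (fun p hp hpa _ => (hmem p).mpr ⟨hp, hpa⟩) hPs hrec
    exact geomFibre_eq_empty_of_notMem ((hmem a).mp ⟨L, hL, hS ha⟩).2 _
  | notFinite h1 heq m G hG hsub =>
    have hI : c.I = c.J.map (C : MvPolynomial (Fin n) k →+* PolyYX k n) := by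
      refine le_antisymm ?_ (Ideal.map_le_iff_le_comap.mpr heq.ge)
      rw [← hG.span_eq, Ideal.span_le]
      intro g hg
      obtain ⟨a, rfl⟩ := hsub hg
      refine Ideal.mem_map_of_mem _ ?_
      rw [← heq]
      exact hG.mem hg
    simpa using IsCorrect.of_sup_span hI (hrec 0)
  | hermite m G hG e he Ps hPs =>
    have hw : ∀ i, ∀ p ∈ (c.piece G e i).points R,
        p ∈ zeroLocus R c.J ∧ MvPolynomial.aeval p (wPoly c.J G) ≠ 0 := by
      rintro i p ⟨hp, hpw⟩
      refine ⟨zeroLocus_anti le_sup_left hp, fun h0 => hpw ?_⟩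
      rw [Input.piece, map_mul, h0, zero_mul]
    refine IsCorrect.of_restrict le_sup_left ?_ ?_ ?_ hPs hrec
    · intro L hL S hS hSa hSc
      obtain ⟨i, hi, rfl⟩ := List.mem_map.mp hL
      refine Or.inl (hG.hasSections hSa hSc (fun a ha => hw i a (hS ha)) fun a ha =>
        (Input.mem_piece_iff he _ _ (List.mem_range.mp hi)).mp (hS ha))
    · intro L hL p hp
      obtain ⟨i, hi, rfl⟩ := List.mem_map.mp hL
      exact (hw i p hp).1
    · intro p hp hpa hfib
      have hpw : MvPolynomial.aeval p (wPoly c.J G) ≠ 0 := fun h0 =>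
        hpa (mem_zeroLocus_sup_span_singleton hp h0)
      have hne : (geomFibre c.I c.h p).Nonempty := by
        rcases hfib with h | h
        · exact h
        · rw [h]
          exact hG.geomFibre_one_nonempty hp hpw
      have hrank := hG.encard_geomFibre hp hpw
      set r := ((c.hermite G).map (evalBase c.J (wPoly c.J G) p hp hpw)).rank with hr
      have hr0 : r ≠ 0 := by
        intro h0
        rw [h0, Nat.cast_zero, Set.encard_eq_zero] at hrank
        exact hne.ne_empty hrank
      have hrs : r ≤ sDeg c.J G := by
        simpa using Matrix.rank_le_card_width
          ((c.hermite G).map (evalBase c.J (wPoly c.J G) p hp hpw))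
      have hi : sDeg c.J G - r < sDeg c.J G := by omega
      refine ⟨c.piece G e (sDeg c.J G - r), List.mem_map_of_mem (List.mem_range.mpr hi), ?_⟩
      rw [Input.mem_piece_iff he hp hpw hi, ← hr]
      omega

theorem Run.isCorrect {c : Input k n} {out : List (BasicConstructible k n)} (h : Run R c out)
    (hc : c.IsValid) : IsCorrect R c out := by
  induction h with
  | intro c Ls cs hstep outs _ ih =>
    exact hstep.isCorrect hc fun i => ih i (hstep.isValid hc _ (cs.get_mem i))

end Correctness

end

end GeomCAD

theorem mainTheorem9 {k R : Type*} [Field k] [Field R] [LinearOrder R] [IsStrictOrderedRing R]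
    [IsRealClosed R] [TopologicalSpace R] [OrderTopology R] [Algebra k R] {n : ℕ}
    (c : GeomCAD.Input k n) (hc : c.IsValid) :
    -- termination, whatever choices the subroutines make
    GeomCAD.Terminates R c ∧ (∃ out, GeomCAD.Run R c out) ∧
    (∀ out, GeomCAD.Run R c out →
      -- geometric delineability over the components of the output sets
      (∀ L ∈ out, ∀ S : Set (Fin n → R), GeomCAD.IsSemialgComponent S (L.points R) →
        GeomCAD.IsGeomDelineable c.I c.h S) ∧
      -- the output sets lie in `V(J)` and miss only points of `V(J)` with empty fibre
      (∀ L ∈ out, L.points R ⊆ GeomCAD.zeroLocus R c.J) ∧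
      (∀ p ∈ GeomCAD.zeroLocus R c.J, (∀ L ∈ out, p ∉ L.points R) →
        GeomCAD.geomFibre c.I c.h p = ∅)) ∧
    -- the rank of the parametric Hermite form is read off from its characteristic polynomial
    (∀ (m : MonomialOrder.{0, 0} (Fin n)) (G : Finset (GeomCAD.PolyYX k n)),
      c.ReachesHermite m G →
      ∀ (p : Fin n → R) (hJ : p ∈ GeomCAD.zeroLocus R c.J)
        (hw : MvPolynomial.aeval p (GeomCAD.wPoly c.J G) ≠ 0),
        (∀ r ≤ GeomCAD.sDeg c.J G,
          (((c.hermite G).map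
              (GeomCAD.evalBase c.J (GeomCAD.wPoly c.J G) p hJ hw)).rank = r ↔
            (∀ j < GeomCAD.sDeg c.J G - r,
              GeomCAD.evalBase c.J (GeomCAD.wPoly c.J G) p hJ hw (c.charCoeff G j) = 0) ∧
            GeomCAD.evalBase c.J (GeomCAD.wPoly c.J G) p hJ hw
              (c.charCoeff G (GeomCAD.sDeg c.J G - r)) ≠ 0)) ∧
        ∀ e, c.IsNumerators G e → ∀ i < GeomCAD.sDeg c.J G,
          (p ∈ (c.piece G e i).points R ↔
            ((c.hermite G).map
              (GeomCAD.evalBase c.J (GeomCAD.wPoly c.J G) p hJ hw)).rank =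
                GeomCAD.sDeg c.J G - i)) := by
  have hterm : GeomCAD.Terminates R c := GeomCAD.terminates_of_isValid c.J c.I c.h hc
  refine ⟨hterm, hterm.exists_run, fun out hout => ?_, fun m G _ p hJ hw => ?_⟩
  · have hcorrect := hout.isCorrect hc
    refine ⟨fun L hL S hS => hcorrect.delineable L hL S hS.subset hS.semialgebraic hS.connected,
      hcorrect.subset, fun p hp hout => ?_⟩
    by_contra hne
    obtain ⟨L, hL, hpL⟩ := hcorrect.covers p hp (Or.inl (Set.nonempty_iff_ne_empty.mpr hne))
    exact hout L hL hpL
  · exact ⟨fun r hr => c.rank_hermite_eq_iff G hJ hw hr,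
      fun e he i hi => GeomCAD.Input.mem_piece_iff he hJ hw hi⟩
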